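/- Let $S=S[1]\dots S[n]$ be a binary string and let $L,R\subseteq\{1,\dots,n\}$ be nonempty, not necessarily disjoint, intervals of indices. An $L$-$R$-$3$-cadence of $S$ is a triple $(i,d,3)$ of integers with $d>0$, $i\in L$, $i+2d\in R$ and $S[i]=S[i+d]=S[i+2d]$. (1) Uncompressed strings. There is a random access machine program (registers, a random-access memory containing the characters of $S$, and addition, subtraction, halving, loads, stores and comparisons at unit cost, on words of $O(\log (n+1))$ bits) that, given $S$, $n$ and the end points of $L$ and $R$, decides in $O(|L|+|R|)$ steps whether $S$ has an $L$-$R$-$3$-cadence and, if it has one, outputs such a cadence. The constants do not depend on $S$, $L$ and $R$. (2) Grammar-compressed strings. Let $S$ be given by a straight-line grammar in Chomsky normal form, that is, by nonterminals $v_1,\dots,v_m$ such that the right-hand side of each $v_i$ is either a character or of the form $v_jv_k$ with $j,k<i$, with start symbol $v_m$; the compressed size of $S$ is the number $m$ of nonterminals. There are a program for the same kind of machine and a polynomial $p$ in two variables such that the program, given the grammar and the end points of $L$ and $R$, decides whether $S$ has an $L$-$R$-$3$-cadence and, if it has one, outputs such a cadence, in time at most $$p\left(m,\ \max\left(\frac{|L|}{|R|},\frac{|R|}{|L|}\right)\right),$$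 where a computation of $t$ steps on $w$-bit words (with $w$ large enough for the input and for all intermediate values) counts as time $t\cdot w$. -/

import Mathlib

/-! ## Sub-cadences and `L`-`R`-cadences

Strings are lists; the `i`-th character of `S`, for `1 ≤ i ≤ |S|`, is the list entry with
zero-based index `i - 1`. -/

/-- `(i, d, k)` is a `k`-sub-cadence of `S`: `d > 0`, the indices `i, i + d, …, i + (k - 1) d` are
indices of `S`, and they carry equal characters. -/
def IsSubCadence {α : Type*} (S : List α) (i d k : ℕ) : Prop :=
  0 < d ∧ 1 ≤ i ∧ ∃ a : α, ∀ j < k, S[i + j * d - 1]? = some a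

/-- A nonempty interval `{lo, lo + 1, …, hi}` of indices of a string of length `n`. -/
structure IndexInterval (n : ℕ) where
  lo : ℕ
  hi : ℕ
  one_le_lo : 1 ≤ lo
  lo_le_hi : lo ≤ hi
  hi_le : hi ≤ n

/-- The set of indices of an interval. -/
def IndexInterval.toFinset {n : ℕ} (I : IndexInterval n) : Finset ℕ := Finset.Icc I.lo I.hi

/-- The length `|I|` of an interval. -/
def IndexInterval.length {n : ℕ} (I : IndexInterval n) : ℕ := I.toFinset.card

/-- `(i, d, k)` is an `L`-`R`-`k`-cadence: a `k`-sub-cadence that starts in `L` and ends in `R`.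
The intervals may overlap. -/
def IsLRCadence {α : Type*} (S : List α) (L R : IndexInterval S.length) (i d k : ℕ) : Prop :=
  IsSubCadence S i d k ∧ i ∈ L.toFinset ∧ i + (k - 1) * d ∈ R.toFinset

/-! ## Grammar-compressed strings -/

/-- A straight-line grammar in Chomsky normal form with nonterminals `v_0, …, v_{size - 1}`: the
right-hand side of `v_i` is a character or a pair `v_j v_k` with `j, k < i`; the start symbol is
the last nonterminal. The compressed size is the number `size` of nonterminals. -/
structure SLGrammar (α : Type*) where
  size : ℕ
  size_pos : 0 < size
  rhs : (i : Fin size) → α ⊕ (Fin (i : ℕ) × Fin (i : ℕ))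

/-- The string derived from the nonterminal `v_i`. -/
def SLGrammar.derive {α : Type*} (G : SLGrammar α) (i : ℕ) (hi : i < G.size) : List α :=
  match G.rhs ⟨i, hi⟩ with
  | Sum.inl a => [a]
  | Sum.inr (j, k) =>
      G.derive j (j.isLt.trans hi) ++ G.derive k (k.isLt.trans hi)
termination_by i
decreasing_by
  · exact j.isLt
  · exact k.isLt

/-- The string generated by the grammar, i.e. derived from its start symbol. -/
def SLGrammar.string {α : Type*} (G : SLGrammar α) : List α :=
  G.derive (G.size - 1) (Nat.sub_lt G.size_pos Nat.one_pos)

/-! ## Random access machines with `w`-bit words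

A machine has registers and a random-access memory, all holding natural numbers. It may only
compute values below `2 ^ w`. Every elementary instruction and every evaluation of a branch or loop
condition takes one time step. -/

namespace RAM

/-- The contents of the registers and of the memory. -/
structure State where
  reg : ℕ → ℕ
  mem : ℕ → ℕ

/-- All registers and memory cells hold `w`-bit words. -/
def State.Fits (s : State) (w : ℕ) : Prop :=
  (∀ r, s.reg r < 2 ^ w) ∧ ∀ a, s.mem a < 2 ^ w

/-- What can be assigned to a register in one step: a constant, a sum or a (truncated) difference
of two registers, half (rounded down) of a register, or the content of the memory cell whose address
is in a register. -/
inductive Expr where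
  | const (k : ℕ)
  | add (a b : ℕ)
  | sub (a b : ℕ)
  | half (a : ℕ)
  | load (a : ℕ)

/-- The value of an expression. -/
def Expr.eval (s : State) : Expr → ℕ
  | const k => k
  | add a b => s.reg a + s.reg b
  | sub a b => s.reg a - s.reg b
  | half a => s.reg a / 2
  | load a => s.mem (s.reg a)

/-- Programs. `store a b` writes register `b` to the memory cell whose address is in register `a`;
the condition of `branch a b` and `loop a b` is that register `a` is smaller than register `b`. -/
inductive Program where
  | skip
  | assign (r : ℕ) (e : Expr)
  | store (a b : ℕ)
  | seq (p q : Program)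
  | branch (a b : ℕ) (p q : Program)
  | loop (a b : ℕ) (p : Program)

/-- `Exec w p s t s'`: on a machine with `w`-bit words, the program `p` started in the state `s`
terminates after exactly `t` steps in the state `s'`, without any overflow on the way. -/
inductive Exec (w : ℕ) : Program → State → ℕ → State → Prop
  | skip (s : State) : Exec w .skip s 1 s
  | assign (s : State) (r : ℕ) (e : Expr) (h : e.eval s < 2 ^ w) :
      Exec w (.assign r e) s 1 { s with reg := Function.update s.reg r (e.eval s) }
  | store (s : State) (a b : ℕ) :
      Exec w (.store a b) s 1 { s with mem := Function.update s.mem (s.reg a) (s.reg b) }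
  | seq {p q : Program} {s s' s'' : State} {t t' : ℕ} (hp : Exec w p s t s')
      (hq : Exec w q s' t' s'') : Exec w (.seq p q) s (t + t') s''
  | branch_true {a b : ℕ} {p q : Program} {s s' : State} {t : ℕ} (h : s.reg a < s.reg b)
      (hp : Exec w p s t s') : Exec w (.branch a b p q) s (t + 1) s'
  | branch_false {a b : ℕ} {p q : Program} {s s' : State} {t : ℕ} (h : ¬ s.reg a < s.reg b)
      (hq : Exec w q s t s') : Exec w (.branch a b p q) s (t + 1) s'
  | loop_true {a b : ℕ} {p : Program} {s s' s'' : State} {t t' : ℕ} (h : s.reg a < s.reg b)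
      (hp : Exec w p s t s') (hl : Exec w (.loop a b p) s' t' s'') :
      Exec w (.loop a b p) s (t + t' + 1) s''
  | loop_false {a b : ℕ} {p : Program} {s : State} (h : ¬ s.reg a < s.reg b) :
      Exec w (.loop a b p) s 1 s

/-- `Runs w p s t s'`: the program `p`, started in `s`, terminates after `t` steps in `s'`, and all
words occurring in the computation, including the input, have at most `w` bits. -/
def Runs (w : ℕ) (p : Program) (s : State) (t : ℕ) (s' : State) : Prop :=
  s.Fits w ∧ Exec w p s t s'

/-- Initially, registers `0, …, 3` hold the end points of `L` and `R`, register `4` holds the size of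
the representation of the string, and all other registers are zero. -/
def inputReg {n : ℕ} (L R : IndexInterval n) (size : ℕ) : ℕ → ℕ
  | 0 => L.lo
  | 1 => L.hi
  | 2 => R.lo
  | 3 => R.hi
  | 4 => size
  | _ => 0

/-- The initial state for an uncompressed binary string `S`: the memory cell `i` holds the `i`-th
character of `S`, for `1 ≤ i ≤ |S|`; all other cells are zero. Register `4` holds `|S|`. -/
def inputString (S : List Bool) (L R : IndexInterval S.length) : State where
  reg := inputReg L R S.length
  mem := fun a => if a = 0 then 0 else (S[a - 1]?.getD false).toNat

/-- The initial state for a grammar-compressed binary string: for each nonterminal `v_i`, the memory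
cells `3 i`, `3 i + 1`, `3 i + 2` hold `0, b, 0` if its right-hand side is the character `b` and
`1, j, k` if its right-hand side is `v_j v_k`; all other cells are zero. Register `4` holds the number
of nonterminals. -/
def inputGrammar (G : SLGrammar Bool) (L R : IndexInterval G.string.length) : State where
  reg := inputReg L R G.size
  mem := fun a =>
    if h : a / 3 < G.size then
      match G.rhs ⟨a / 3, h⟩ with
      | Sum.inl b => if a % 3 = 1 then b.toNat else 0
      | Sum.inr (j, k) => if a % 3 = 0 then 1 else if a % 3 = 1 then j else k
    else 0

/-- The final state `s` answers the `L`-`R`-`k`-cadence problem for `S`: either register `0` is `1` and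
registers `1`, `2` hold `i`, `d` for an `L`-`R`-`k`-cadence `(i, d, k)`, or register `0` is `0` and there
is no such cadence. -/
def Answers (k : ℕ) (S : List Bool) (L R : IndexInterval S.length) (s : State) : Prop :=
  (s.reg 0 = 1 ∧ IsLRCadence S L R (s.reg 1) (s.reg 2) k) ∨
    (s.reg 0 = 0 ∧ ¬ ∃ i d : ℕ, IsLRCadence S L R i d k)

end RAM

/-! A triple i, i + d, i + 2d is given by its two ends, which have the same parity, and its midpoint
must carry their common character. All searches rest on one primitive, the next occurrence of a
character from a given position in steps of 1 or 2. `NextSpec` charges A for a call and B for each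
position passed, so one program `mainSearch` serves both claims: plain scanning has constant A and
B, while a walk down the grammar has A linear in m and B = 0.

Suppose first that L lies before R, and fix a parity class, so that both sides are ranges of step 2.
If one range is a constant block of x's, its midpoints with a fixed end j fill a window of
consecutive integers, and j yields a triple iff j and some position of the window carry x. The next
x from the left end of the window either lies inside or rules out every j whose window ends earlier.
After a failure, either the next candidate's window contains the x just found, and the search
succeeds, or j has jumped by more than the block length. Hence there are O(|L|/|R| + |R|/|L|)
rounds, and the positions passed add up to O(|L| + |R|) (`wp_blockSearch`).

If neither range is constant, consider the changes of characters. A change y → z at i - 2, i in the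
left range and a change z → y at j - 2, j in the right one force a triple: the pairs (i - 2, j) and
(i, j - 2) carry y and z and share a midpoint, which carries one of the two (`conflict`). Without
opposite changes, both ranges change exactly once and in the same direction. Then two pairs of equal
constant ranges remain (`parallel`), and for such a pair the midpoints form an interval, so one
search for x decides (`wp_ccSearch`).

If L and R overlap in at least nine positions, the overlap contains a triple, because every binary
string of length nine does (`exists_triple`). Otherwise the overlap is searched directly, and the
part of L before R and the part of R after L give two disjoint problems, with the length ratio worse
by at most a factor of nine (`wp_core`).

For a grammar, a table stores for every nonterminal the length of its string and the first
occurrence of each character at offsets of each parity; the entries of a pair follow from those of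
its parts. One descent from the start symbol, carrying the best candidate to the right of the
current nonterminal, finds a next occurrence in O(m) steps.

Each layer of the program owns a block of registers below 100, and `Agree` records that outer blocks
survive calls. The constants of the table stay in registers from 100 on. -/

namespace RAM

/-! ## Weakest preconditions with running times -/

/-- The program `p` started in `s` terminates, and its running time and final state satisfy `Q`. -/
def Wp (w : ℕ) (p : Program) (s : State) (Q : ℕ → State → Prop) : Prop :=
  ∃ t s', Exec w p s t s' ∧ Q t s'

/-- The state `s` with register `r` set to `v`. -/
def State.set (s : State) (r v : ℕ) : State := { s with reg := Function.update s.reg r v }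

theorem State.set_reg (s : State) (r v r' : ℕ) :
    (s.set r v).reg r' = if r' = r then v else s.reg r' := by
  simp [State.set, Function.update_apply]

theorem State.set_reg_of_ne (s : State) {r r' : ℕ} (v : ℕ) (h : r' ≠ r) :
    (s.set r v).reg r' = s.reg r' := by
  simp [State.set_reg, h]

theorem State.set_mem (s : State) (r v : ℕ) : (s.set r v).mem = s.mem := rfl

/-- The state `s` with memory cell `a` set to `v`. -/
def State.put (s : State) (a v : ℕ) : State := { s with mem := Function.update s.mem a v }

theorem State.put_mem (s : State) (a v a' : ℕ) :
    (s.put a v).mem a' = if a' = a then v else s.mem a' := by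
  simp [State.put, Function.update_apply]

theorem Wp.mono {w : ℕ} {p : Program} {s : State} {Q Q' : ℕ → State → Prop} (h : Wp w p s Q)
    (hQ : ∀ t s', Q t s' → Q' t s') : Wp w p s Q' := by
  obtain ⟨t, s', he, hq⟩ := h
  exact ⟨t, s', he, hQ t s' hq⟩

theorem wp_skip {w : ℕ} {s : State} {Q : ℕ → State → Prop} : Wp w .skip s Q ↔ Q 1 s := by
  constructor
  · rintro ⟨t, s', he, hq⟩
    cases he
    exact hq
  · exact fun h => ⟨1, s, .skip s, h⟩

theorem wp_assign {w r : ℕ} {e : Expr} {s : State} {Q : ℕ → State → Prop} :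
    Wp w (.assign r e) s Q ↔ e.eval s < 2 ^ w ∧ Q 1 (s.set r (e.eval s)) := by
  constructor
  · rintro ⟨t, s', he, hq⟩
    cases he with
    | assign _ _ _ h => exact ⟨h, hq⟩
  · exact fun h => ⟨1, _, .assign s r e h.1, h.2⟩

theorem wp_store {w a b : ℕ} {s : State} {Q : ℕ → State → Prop} :
    Wp w (.store a b) s Q ↔ Q 1 (s.put (s.reg a) (s.reg b)) := by
  constructor
  · rintro ⟨t, s', he, hq⟩
    cases he
    exact hq
  · exact fun h => ⟨1, _, .store s a b, h⟩

theorem wp_seq {w : ℕ} {p q : Program} {s : State} {Q : ℕ → State → Prop} :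
    Wp w (.seq p q) s Q ↔ Wp w p s fun t s' => Wp w q s' fun t' s'' => Q (t + t') s'' := by
  constructor
  · rintro ⟨t, s', he, hq⟩
    cases he with
    | seq hp hq' => exact ⟨_, _, hp, _, _, hq', hq⟩
  · rintro ⟨t, s', hp, t', s'', hq, h⟩
    exact ⟨_, _, .seq hp hq, h⟩

theorem wp_branch {w a b : ℕ} {p q : Program} {s : State} {Q : ℕ → State → Prop} :
    Wp w (.branch a b p q) s Q ↔
      if s.reg a < s.reg b then Wp w p s fun t => Q (t + 1) else Wp w q s fun t => Q (t + 1) := by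
  constructor
  · rintro ⟨t, s', he, hq⟩
    cases he with
    | branch_true h hp => rw [if_pos h]; exact ⟨_, _, hp, hq⟩
    | branch_false h hp => rw [if_neg h]; exact ⟨_, _, hp, hq⟩
  · intro h
    split_ifs at h with hc
    · obtain ⟨t, s', hp, hq⟩ := h
      exact ⟨_, _, .branch_true hc hp, hq⟩
    · obtain ⟨t, s', hp, hq⟩ := h
      exact ⟨_, _, .branch_false hc hp, hq⟩

/-- Loop rule: `I s v` is an invariant in which `v` bounds the time that the loop still takes. -/
theorem wp_loop {w a b : ℕ} {p : Program} (I : State → ℕ → Prop)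
    (hI : ∀ s v, I s v → s.reg a < s.reg b →
      Wp w p s fun t s' => ∃ v', I s' v' ∧ t + 1 + v' ≤ v)
    {s : State} {v : ℕ} (h : I s v) :
    Wp w (.loop a b p) s fun t s' =>
      t ≤ v + 1 ∧ (∃ v', I s' v') ∧ ¬ s'.reg a < s'.reg b := by
  induction v using Nat.strong_induction_on generalizing s with
  | _ v ih =>
    by_cases hc : s.reg a < s.reg b
    · obtain ⟨t, s', he, v', hi, hv⟩ := hI s v h hc
      obtain ⟨t', s'', he', ht, hi', hc'⟩ := ih v' (by omega) hi
      exact ⟨_, _, .loop_true hc he he', by omega, hi', hc'⟩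
    · exact ⟨1, s, .loop_false hc, by omega, ⟨v, h⟩, hc⟩

/-- The programs of a list, one after the other. -/
def blk : List Program → Program
  | [] => .skip
  | p :: l => .seq p (blk l)

theorem wp_nil {w : ℕ} {s : State} {Q : ℕ → State → Prop} : Wp w (blk []) s Q ↔ Q 1 s := wp_skip

theorem wp_cons {w : ℕ} {p : Program} {l : List Program} {s : State} {Q : ℕ → State → Prop} :
    Wp w (blk (p :: l)) s Q ↔ Wp w p s fun t s' => Wp w (blk l) s' fun t' => Q (t + t') := wp_seq

/-- Copies register `a` to register `r ≠ a`. -/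
def mov (r a : ℕ) : Program := .seq (.assign r (.const 0)) (.assign r (.add r a))

theorem wp_mov {w r a : ℕ} {s : State} {Q : ℕ → State → Prop} (h : a ≠ r) :
    Wp w (mov r a) s Q ↔ s.reg a < 2 ^ w ∧ Q 2 (s.set r (s.reg a)) := by
  have e : (s.set r 0).set r (s.reg a) = s.set r (s.reg a) := by
    simp [State.set]
  simp [mov, wp_seq, wp_assign, Expr.eval, State.set_reg, h, e]

/-- The states `s` and `s'` agree in the memory and in all registers outside `[lo, 100)`. -/
def Agree (lo : ℕ) (s s' : State) : Prop :=
  s'.mem = s.mem ∧ ∀ r, r < lo ∨ 100 ≤ r → s'.reg r = s.reg r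

theorem Agree.refl (lo : ℕ) (s : State) : Agree lo s s := ⟨rfl, fun _ _ => rfl⟩

theorem Agree.trans {lo : ℕ} {s s' s'' : State} (h : Agree lo s s') (h' : Agree lo s' s'') :
    Agree lo s s'' :=
  ⟨h'.1.trans h.1, fun r hr => (h'.2 r hr).trans (h.2 r hr)⟩

theorem Agree.mono {lo lo' : ℕ} {s s' : State} (h : Agree lo s s') (hl : lo' ≤ lo) :
    Agree lo' s s' :=
  ⟨h.1, fun r hr => h.2 r (by omega)⟩

theorem Agree.set {lo : ℕ} {s s' : State} (h : Agree lo s s') {r v : ℕ} (h1 : lo ≤ r)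
    (h2 : r < 100) : Agree lo s (s'.set r v) :=
  ⟨h.1, fun r' hr => by rw [State.set_reg_of_ne _ _ (by omega), h.2 r' hr]⟩

theorem Agree.reg {lo : ℕ} {s s' : State} (h : Agree lo s s') {r : ℕ} (hr : r < lo) :
    s'.reg r = s.reg r := h.2 r (.inl hr)

/-! ## Searching for the next occurrence of a character -/

/-- Among the positions `st, st + step, …` up to `lim`, those before `q` do not carry `x`, and `q`
carries `x` if it does not exceed `lim`. -/
def IsNext (χ : ℕ → ℕ) (x st lim step q : ℕ) : Prop :=
  st ≤ q ∧ (∀ k, st ≤ k → k < q → k ≤ lim → step ∣ k - st → χ k ≠ x) ∧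
    (q ≤ lim → χ q = x ∧ step ∣ q - st)

/-- The program `N` finds next occurrences in the string `χ 1, …, χ n`; the context that it may use
is that of the state `s₀`. The arguments are in the registers `80, …, 83`, the result in register
`84`, and a search costs at most `A` steps plus `B` steps per position passed. -/
structure NextSpec (s₀ : State) (w n : ℕ) (χ : ℕ → ℕ) (N : Program) (A B : ℕ) : Prop where
  width : 64 * n + 256 < 2 ^ w
  pos : 1 ≤ A
  bool : ∀ i, χ i ≤ 1
  run : ∀ s x st lim step, Agree 0 s₀ s → s.reg 80 = x → s.reg 81 = st → s.reg 82 = lim →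
    s.reg 83 = step → x ≤ 1 → 1 ≤ st → st ≤ 4 * n + 16 → lim ≤ n → step = 1 ∨ step = 2 →
    Wp w N s fun t s' => Agree 80 s s' ∧ IsNext χ x st lim step (s'.reg 84) ∧
      s'.reg 84 ≤ max st (n + 2) ∧
      ∃ μ, t ≤ A + B * μ ∧ μ ≤ min (s'.reg 84) (lim + 2) - st

/-- Calls `N` for the arguments in the registers `x`, `st`, `lim` and the step `k`. -/
def callNext (N : Program) (x st lim k : ℕ) : Program :=
  blk [mov 80 x, mov 81 st, mov 82 lim, .assign 83 (.const k), N]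

theorem wp_callNext {s₀ : State} {w n : ℕ} {χ : ℕ → ℕ} {N : Program} {A B : ℕ}
    (H : NextSpec s₀ w n χ N A B) {s : State} (hs : Agree 0 s₀ s) {rx rs rl k : ℕ}
    (hrx : rx < 80) (hrs : rs < 80) (hrl : rl < 80) (hx : s.reg rx ≤ 1) (h1 : 1 ≤ s.reg rs)
    (h2 : s.reg rs ≤ 4 * n + 16) (hl : s.reg rl ≤ n) (hk : k = 1 ∨ k = 2) :
    Wp w (callNext N rx rs rl k) s fun t s' => Agree 80 s s' ∧
      IsNext χ (s.reg rx) (s.reg rs) (s.reg rl) k (s'.reg 84) ∧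
      s'.reg 84 ≤ max (s.reg rs) (n + 2) ∧
      ∃ μ, t ≤ 9 * A + B * μ ∧ μ ≤ min (s'.reg 84) (s.reg rl + 2) - s.reg rs := by
  have hw := H.width
  have hA := H.pos
  simp (disch := omega) only [callNext, wp_cons, wp_nil, wp_mov, wp_assign, Expr.eval,
    State.set_reg_of_ne]
  refine ⟨by omega, by omega, by omega, by omega, ?_⟩
  refine (H.run _ (s.reg rx) (s.reg rs) (s.reg rl) k ?_ ?_ ?_ ?_ ?_ hx h1 h2 hl hk).mono ?_
  · exact (((hs.set (by omega) (by omega)).set (by omega) (by omega)).set (by omega)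
      (by omega)).set (by omega) (by omega)
  all_goals try (simp [State.set_reg]; done)
  rintro t s' ⟨ha, hn, hm, μ, ht, hμ⟩
  refine ⟨?_, hn, hm, μ, by omega, hμ⟩
  refine Agree.trans ?_ ha
  exact ((((Agree.refl 80 s).set (by omega) (by omega)).set (by omega) (by omega)).set (by omega)
      (by omega)).set (by omega) (by omega)

/-! ## Searching pairs of arithmetic progressions of indices -/

/-- The positions `i, i + d, i + 2 d` carry the same character. -/
def Triple (χ : ℕ → ℕ) (i d : ℕ) : Prop := 0 < d ∧ χ (i + d) = χ i ∧ χ (i + 2 * d) = χ i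

/-- Registers `76, 77, 78` answer the search for a triple whose end points satisfy `P`. -/
def Outcome (χ : ℕ → ℕ) (P : ℕ → ℕ → Prop) (s : State) : Prop :=
  (s.reg 76 = 1 ∧ Triple χ (s.reg 77) (s.reg 78) ∧ P (s.reg 77) (s.reg 77 + 2 * s.reg 78)) ∨
    (s.reg 76 = 0 ∧ ∀ i d, Triple χ i d → ¬ P i (i + 2 * d))

theorem Outcome.congr {χ : ℕ → ℕ} {P P' : ℕ → ℕ → Prop} {s : State} (h : Outcome χ P s)
    (hP : ∀ i d, Triple χ i d → (P i (i + 2 * d) ↔ P' i (i + 2 * d))) : Outcome χ P' s := by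
  rcases h with ⟨h1, h2, h3⟩ | ⟨h1, h2⟩
  · exact .inl ⟨h1, h2, (hP _ _ h2).1 h3⟩
  · exact .inr ⟨h1, fun i d hi hp => h2 i d hi ((hP _ _ hi).2 hp)⟩

/-- `k` is one of `lo, lo + 2, …` and at most `hi`. -/
def In (lo hi k : ℕ) : Prop := lo ≤ k ∧ k ≤ hi ∧ k % 2 = lo % 2

/-! ### Two constant ranges -/

/-- Searches a triple with start in `lo, lo + 2, …, hi` (registers `60`, `61`) and end in
`s, s + 2, …, lim` (registers `63`, `64`) if all these positions carry the character in register
`62`. -/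
def ccSearch (N : Program) : Program :=
  blk [.assign 76 (.const 0), .assign 67 (.const 1),
    .assign 70 (.add 60 63), .assign 70 (.half 70),
    .assign 68 (.add 61 64), .assign 68 (.half 68),
    callNext N 62 70 68 1,
    .assign 65 (.add 68 67),
    .branch 84 65
      (blk [.assign 71 (.add 84 84), .assign 72 (.sub 71 64),
        .branch 60 72 (mov 77 72) (mov 77 60),
        .assign 78 (.sub 84 77), mov 76 67])
      .skip]

-- Both ranges have step 2 and the same parity, so the midpoints of their pairs are exactly the
-- integers from (lo + c) / 2 to (hi + lim) / 2. All ends carry x already, hence a triple exists iff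
-- x occurs in this interval, and a single search of step 1 settles it.
set_option maxHeartbeats 1600000 in
theorem wp_ccSearch {s₀ : State} {w n : ℕ} {χ : ℕ → ℕ} {N : Program} {A B : ℕ}
    (H : NextSpec s₀ w n χ N A B) {s : State} (hs : Agree 0 s₀ s) {lo hi x c lim : ℕ}
    (h60 : s.reg 60 = lo) (h61 : s.reg 61 = hi) (h62 : s.reg 62 = x) (h63 : s.reg 63 = c)
    (h64 : s.reg 64 = lim) (h1 : 1 ≤ lo) (h2 : lo ≤ hi) (h3 : hi < c) (h4 : c ≤ lim)
    (h5 : lim ≤ n) (p1 : hi % 2 = lo % 2) (p2 : c % 2 = lo % 2) (p3 : lim % 2 = lo % 2)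
    (hx : x ≤ 1) (c1 : ∀ k, In lo hi k → χ k = x) (c2 : ∀ k, In c lim k → χ k = x) :
    Wp w (ccSearch N) s fun t s' => Agree 60 s s' ∧
      Outcome χ (fun i j => In lo hi i ∧ In c lim j) s' ∧
      t ≤ 40 * A + B * (hi - lo + (lim - c) + 4) := by
  have hw := H.width
  have hA := H.pos
  simp (disch := omega) only [ccSearch, wp_cons, wp_nil, wp_assign, Expr.eval, State.set_reg,
    Nat.reduceEqDiff, if_true, if_false, h60, h61, h63, h64]
  refine ⟨by omega, by omega, by omega, by omega, by omega, by omega, ?_⟩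
  have ag : Agree 60 s ((((((s.set 76 0).set 67 1).set 70 (lo + c)).set 70 ((lo + c) / 2)).set 68
    (hi + lim)).set 68 ((hi + lim) / 2)) := by
    repeat refine Agree.set ?_ (by omega) (by omega)
    exact Agree.refl _ _
  generalize hs1 : ((((((s.set 76 0).set 67 1).set 70 (lo + c)).set 70 ((lo + c) / 2)).set 68
    (hi + lim)).set 68 ((hi + lim) / 2)) = s1 at ag ⊢
  have r60 : s1.reg 60 = lo := by simp [← hs1, State.set_reg, h60]
  have r62 : s1.reg 62 = x := by simp [← hs1, State.set_reg, h62]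
  have r64 : s1.reg 64 = lim := by simp [← hs1, State.set_reg, h64]
  have r67 : s1.reg 67 = 1 := by simp [← hs1, State.set_reg]
  have r68 : s1.reg 68 = (hi + lim) / 2 := by simp [← hs1, State.set_reg]
  have r70 : s1.reg 70 = (lo + c) / 2 := by simp [← hs1, State.set_reg]
  have r76 : s1.reg 76 = 0 := by simp [← hs1, State.set_reg]
  clear hs1
  refine (wp_callNext H (hs.trans (ag.mono (Nat.zero_le _))) (by omega) (by omega) (by omega)
    (by omega) (by omega) (by omega) (by omega) (.inl rfl)).mono ?_
  rintro t s2 ⟨ag2, ⟨n1, n2, n3⟩, hm, μ, ht, hμ⟩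
  rw [r62] at n2 n3
  rw [r70] at n1 n2 hμ hm
  rw [r68] at n2 n3 hμ
  have hag : Agree 60 s s2 := ag.trans (ag2.mono (by omega))
  generalize hq : s2.reg 84 = q at n1 n2 n3 hm hμ
  have hμ' : B * μ ≤ B * (hi - lo + (lim - c) + 4) := Nat.mul_le_mul_left _ (by omega)
  have hm' : q ≤ n + 2 := by omega
  clear hm hμ
  have one : ∀ k m : ℕ, 1 ∣ k - m := fun _ _ => one_dvd _
  simp (disch := omega) only [wp_branch, wp_cons, wp_nil, wp_assign, wp_mov, wp_skip, Expr.eval,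
    State.set_reg, Nat.reduceEqDiff, if_true, if_false, ag2.reg, r68, r67, r64, r60, hq]
  refine ⟨by omega, ?_⟩
  by_cases hc : q < (hi + lim) / 2 + 1
  · rw [if_pos hc]
    refine ⟨by omega, by omega, ?_⟩
    have hqx := (n3 (by omega)).1
    -- The ends of a triple with midpoint q add up to 2q. The last end `lim` belongs to the start 2q
    -- - lim; if this is not beyond `lo`, the start `lo` with the end 2q - lo is taken instead.
    by_cases hc' : lo < q + q - lim
    · rw [if_pos hc']
      refine ⟨by omega, by omega, by omega, ?_, ?_, by omega⟩
      · repeat refine Agree.set ?_ (by omega) (by omega)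
        exact hag
      · refine .inl ⟨by simp [State.set_reg], ?_⟩
        simp only [State.set_reg, Nat.reduceEqDiff, if_true, if_false]
        have e1 : q + q - lim + (q - (q + q - lim)) = q := by omega
        have e2 : q + q - lim + 2 * (q - (q + q - lim)) = lim := by omega
        have i1 : In lo hi (q + q - lim) := ⟨by omega, by omega, by omega⟩
        have i2 : In c lim lim := ⟨by omega, by omega, by omega⟩
        rw [Triple, e1, e2, c1 _ i1, c2 _ i2]
        exact ⟨⟨by omega, hqx, rfl⟩, i1, i2⟩
    · rw [if_neg hc']
      refine ⟨by omega, by omega, by omega, ?_, ?_, by omega⟩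
      · repeat refine Agree.set ?_ (by omega) (by omega)
        exact hag
      · refine .inl ⟨by simp [State.set_reg], ?_⟩
        simp only [State.set_reg, Nat.reduceEqDiff, if_true, if_false]
        have e1 : lo + (q - lo) = q := by omega
        have e2 : lo + 2 * (q - lo) = 2 * q - lo := by omega
        have i1 : In lo hi lo := ⟨by omega, by omega, by omega⟩
        have i2 : In c lim (2 * q - lo) := ⟨by omega, by omega, by omega⟩
        rw [Triple, e1, e2, c1 _ i1, c2 _ i2]
        exact ⟨⟨by omega, hqx, rfl⟩, i1, i2⟩
  · rw [if_neg hc]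
    refine ⟨?_, ?_, by omega⟩
    · repeat refine Agree.set ?_ (by omega) (by omega)
      exact hag
    · refine .inr ⟨by simp (disch := omega) [State.set_reg, ag2.reg, r76], ?_⟩
      rintro i d ⟨hd, t1, t2⟩ ⟨⟨i1, i2, i3⟩, j1, j2, j3⟩
      refine n2 (i + d) (by omega) (by omega) (by omega) (one _ _) ?_
      rw [t1, c1 i ⟨i1, i2, i3⟩]

/-! ### A constant block against an arbitrary range -/

/-- Data of a call of `blockSearch`. -/
structure BlockData (n : ℕ) (χ : ℕ → ℕ) (lo hi x c lim : ℕ) : Prop where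
  one_le_lo : 1 ≤ lo
  lo_le_hi : lo ≤ hi
  hi_le : hi ≤ n
  one_le_c : 1 ≤ c
  c_le : c ≤ n + 2
  lim_le : lim ≤ n
  par_hi : hi % 2 = lo % 2
  par_c : c % 2 = lo % 2
  disj : hi < c ∨ lim < lo
  bool : x ≤ 1
  const : ∀ k, In lo hi k → χ k = x

/-- One end of a pair is in the block, the other one in the range. -/
def Across (lo hi c lim i j : ℕ) : Prop := In lo hi i ∧ In c lim j ∨ In c lim i ∧ In lo hi j

/-- The registers during `blockSearch`. -/
structure BlockRegs (s : State) (lo hi x lim : ℕ) : Prop where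
  r60 : s.reg 60 = lo
  r61 : s.reg 61 = hi
  r62 : s.reg 62 = x
  r64 : s.reg 64 = lim
  r67 : s.reg 67 = 1
  r68 : s.reg 68 = (hi + lim) / 2

/-- The loop invariant of `blockSearch`; `v` bounds the remaining time. -/
def BlockInv (χ : ℕ → ℕ) (A B lo hi x c lim : ℕ) (sI s : State) (v : ℕ) : Prop :=
  Agree 60 sI s ∧ BlockRegs s lo hi x lim ∧
    ((s.reg 65 = 0 ∧ s.reg 76 = 1 ∧ Outcome χ (Across lo hi c lim) s) ∨
    (s.reg 65 = lim + 1 ∧ s.reg 76 = 0 ∧ c ≤ s.reg 66 ∧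
      (∀ j, In c lim j → j < s.reg 66 → χ j = x → ∀ i, In lo hi i → χ ((i + j) / 2) ≠ x) ∧
      (s.reg 66 ≤ lim → χ (s.reg 66) = x ∧ s.reg 66 % 2 = c % 2 ∧
        ((∃ k, lim < s.reg 66 + (k + 1) * (hi - lo + 2) ∧
          60 * A * (k + 2) + B * ((lim + 2 - s.reg 66) +
            ((hi + lim) / 2 + 2 - (lo + s.reg 66) / 2) + (hi - lo)) ≤ v) ∨
        ((∃ Q, (lo + s.reg 66) / 2 ≤ Q ∧ 2 * Q ≤ hi + s.reg 66 ∧ χ Q = x) ∧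
          60 * A + B * (hi - lo) ≤ v)))))

/-- The window of j consists of the integers from (lo + j) / 2 to (hi + j) / 2. A position q in it
determines the partner 2q - j, which has the parity of the block and lies in it, hence carries x.
Block and range may come in either order, so either of j and 2q - j can be the start. -/
theorem BlockData.found {n : ℕ} {χ : ℕ → ℕ} {lo hi x c lim j q : ℕ}
    (D : BlockData n χ lo hi x c lim) (hj : In c lim j) (hjx : χ j = x)
    (h1 : (lo + j) / 2 ≤ q) (h2 : 2 * q ≤ hi + j) (hq : χ q = x) :
    (j < 2 * q - j → Triple χ j (q - j) ∧ Across lo hi c lim j (j + 2 * (q - j))) ∧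
    (¬ j < 2 * q - j → Triple χ (2 * q - j) (q - (2 * q - j)) ∧
      Across lo hi c lim (2 * q - j) (2 * q - j + 2 * (q - (2 * q - j)))) := by
  obtain ⟨hl1, _, _, _, _, _, p1, p2, hd, _, hc⟩ := D
  have hi' : In lo hi (2 * q - j) := by
    obtain ⟨_, _, _⟩ := hj
    exact ⟨by omega, by omega, by omega⟩
  have hix := hc _ hi'
  have hne : j ≠ 2 * q - j := by
    intro h
    obtain ⟨_, _, _⟩ := hj
    obtain ⟨_, _, _⟩ := hi'
    omega
  constructor
  · intro h
    have e1 : j + (q - j) = q := by omega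
    have e2 : j + 2 * (q - j) = 2 * q - j := by omega
    rw [Triple, e1, e2, hjx, hq, hix]
    exact ⟨⟨by omega, rfl, rfl⟩, .inr ⟨hj, hi'⟩⟩
  · intro h
    have hl : lo + j ≤ 2 * q := by
      obtain ⟨_, _, _⟩ := hj
      omega
    have hl' : lo ≤ 2 * q - j := hi'.1
    have e1 : 2 * q - j + (q - (2 * q - j)) = q := by omega
    have e2 : 2 * q - j + 2 * (q - (2 * q - j)) = j := by omega
    rw [Triple, e1, e2, hix, hq, hjx]
    exact ⟨⟨by omega, rfl, rfl⟩, .inl ⟨hi', hj⟩⟩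

/-- Windows move to the right with j. If the first x from the left end of the window of j is q,
beyond that window, then every later window that ends before q is free of x as well. -/
theorem BlockData.skip {n : ℕ} {χ : ℕ → ℕ} {lo hi x c lim j q j' : ℕ}
    (D : BlockData n χ lo hi x c lim) (hj : In c lim j)
    (old : ∀ j₀, In c lim j₀ → j₀ < j → χ j₀ = x → ∀ i, In lo hi i → χ ((i + j₀) / 2) ≠ x)
    (hq : IsNext χ x ((lo + j) / 2) ((hi + lim) / 2) 1 q) (h2 : hi + j < 2 * q)
    (hj' : IsNext χ x (2 * q - hi) lim 2 j') :
    ∀ j₀, In c lim j₀ → j₀ < j' → χ j₀ = x → ∀ i, In lo hi i → χ ((i + j₀) / 2) ≠ x := by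
  intro j₀ h0 hlt hx i hi
  by_cases hl : j₀ < j
  · exact old j₀ h0 hl hx i hi
  · obtain ⟨_, _, _⟩ := h0
    obtain ⟨_, _, _⟩ := hj
    obtain ⟨_, _, _⟩ := hi
    have p1 := D.par_hi
    have p2 := D.par_c
    -- From 2q - hi on, nothing of this parity before j' carries x. Below 2q - hi, every midpoint
    -- with the block stays below q.
    have hlt' : j₀ < 2 * q - hi := by
      by_contra hge
      exact hj'.2.1 j₀ (by omega) hlt (by omega) (by omega) hx
    exact hq.2.1 _ (by omega) (by omega) (by omega) (one_dvd _)

/-- The potential after a failed round, according to the next candidate j': it has left the range;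
its window contains q, so that only one cheap successful round remains; or its window starts after
q, in which case j' ≥ j + (hi - lo + 2) and one of the k permitted jumps is used up. The B-part pays
for the positions that the two searches pass, and these only move to the right. -/
theorem block_cost {A B lo hi lim j q j' k v μ₁ μ₂ : ℕ} (h : lo ≤ hi) (hj' : j < j')
    (hl : j ≤ lim) (hw : (lo + j) / 2 ≤ q) (hq : hi + j + 2 ≤ 2 * q) (hjq : 2 * q - hi ≤ j')
    (hp : j' % 2 = lo % 2) (hjp : j % 2 = lo % 2) (hpi : hi % 2 = lo % 2)
    (hk : lim < j + (k + 1) * (hi - lo + 2))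
    (hv : 60 * A * (k + 2) + B * ((lim + 2 - j) +
            ((hi + lim) / 2 + 2 - (lo + j) / 2) + (hi - lo)) ≤ v)
    (hμ₁ : μ₁ ≤ min q ((hi + lim) / 2 + 2) - (lo + j) / 2)
    (hμ₂ : μ₂ ≤ min j' (lim + 2) - (2 * q - hi)) :
    (lim < j' → 60 * A + B * μ₁ + B * μ₂ ≤ v) ∧
    (j' ≤ lim → (lo + j') / 2 ≤ q → 60 * A + B * μ₁ + B * μ₂ + (60 * A + B * (hi - lo)) ≤ v) ∧
    (j' ≤ lim → q < (lo + j') / 2 → ∃ k', lim < j' + (k' + 1) * (hi - lo + 2) ∧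
        60 * A + B * μ₁ + B * μ₂ + (60 * A * (k' + 2) + B * ((lim + 2 - j') +
            ((hi + lim) / 2 + 2 - (lo + j') / 2) + (hi - lo))) ≤ v) := by
  have hk0 : 60 * A * 2 ≤ 60 * A * (k + 2) := Nat.mul_le_mul_left _ (by omega)
  refine ⟨fun h1 => ?_, fun h1 h2 => ?_, fun h1 h2 => ?_⟩
  · have := Nat.mul_le_mul_left B (show μ₁ + μ₂ ≤ (lim + 2 - j) +
            ((hi + lim) / 2 + 2 - (lo + j) / 2) + (hi - lo) by omega)
    rw [Nat.mul_add B μ₁ μ₂] at this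
    omega
  · have := Nat.mul_le_mul_left B (show μ₁ + μ₂ + (hi - lo) ≤ (lim + 2 - j) +
            ((hi + lim) / 2 + 2 - (lo + j) / 2) + (hi - lo) by omega)
    rw [Nat.mul_add B, Nat.mul_add B μ₁ μ₂] at this
    omega
  · have hjj : j + (hi - lo + 2) ≤ j' := by omega
    obtain _ | k' := k
    · omega
    · refine ⟨k', ?_, ?_⟩
      · rw [Nat.succ_mul] at hk
        omega
      · have := Nat.mul_le_mul_left B (show μ₁ + μ₂ + ((lim + 2 - j') +
            ((hi + lim) / 2 + 2 - (lo + j') / 2) + (hi - lo)) ≤ (lim + 2 - j) +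
            ((hi + lim) / 2 + 2 - (lo + j) / 2) + (hi - lo) by omega)
        rw [Nat.mul_add B, Nat.mul_add B μ₁ μ₂] at this
        have e : 60 * A * (k' + 1 + 2) = 60 * A * (k' + 2) + 60 * A := by ring
        omega

theorem BlockRegs.agree {s s' : State} {lo hi x lim : ℕ} (h : BlockRegs s lo hi x lim)
    (ha : Agree 80 s s') : BlockRegs s' lo hi x lim := by
  constructor <;> rw [ha.reg (by omega)]
  exacts [h.r60, h.r61, h.r62, h.r64, h.r67, h.r68]

theorem BlockRegs.set {s : State} {lo hi x lim : ℕ} (h : BlockRegs s lo hi x lim) {r v : ℕ}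
    (hr : r = 63 ∨ r = 65 ∨ r = 66 ∨ 69 ≤ r) : BlockRegs (s.set r v) lo hi x lim := by
  constructor <;> rw [State.set_reg_of_ne _ _ (by omega)]
  exacts [h.r60, h.r61, h.r62, h.r64, h.r67, h.r68]

/-- The body of the loop of `blockSearch`. -/
def blockBody (N : Program) : Program :=
  blk [
      .assign 70 (.add 60 66), .assign 70 (.half 70),
      callNext N 62 70 68 1,
      .assign 71 (.add 84 84), .assign 72 (.add 61 66), .assign 72 (.add 72 67),
      .branch 71 72
        (blk [.assign 73 (.sub 71 66),
          .branch 66 73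
            (blk [mov 77 66, .assign 78 (.sub 84 66)])
            (blk [mov 77 73, .assign 78 (.sub 84 73)]),
          mov 76 67, .assign 65 (.const 0)])
        (blk [.assign 63 (.sub 71 61), callNext N 62 63 64 2, mov 66 84])]

-- One round: look for x in the window of j; report a triple if it is there, otherwise proceed to
-- the first x at or after 2q - hi. Setting register `65` to 0 ends the loop after a success.
set_option maxHeartbeats 3200000 in
theorem wp_blockBody {s₀ : State} {w n : ℕ} {χ : ℕ → ℕ} {N : Program} {A B : ℕ}
    (H : NextSpec s₀ w n χ N A B) {sI : State} (hs : Agree 0 s₀ sI) {lo hi x c lim : ℕ}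
    (D : BlockData n χ lo hi x c lim) (s : State) (v : ℕ)
    (hI : BlockInv χ A B lo hi x c lim sI s v) (hlt : s.reg 66 < s.reg 65) :
    Wp w (blockBody N) s fun t s' =>
      ∃ v', BlockInv χ A B lo hi x c lim sI s' v' ∧ t + 1 + v' ≤ v := by
  obtain ⟨hag, hr, hI⟩ := hI
  have hw := H.width
  have hA := H.pos
  obtain ⟨h65, h76, hcj, old, hact⟩ : s.reg 65 = lim + 1 ∧ s.reg 76 = 0 ∧ c ≤ s.reg 66 ∧
      (∀ j, In c lim j → j < s.reg 66 → χ j = x → ∀ i, In lo hi i → χ ((i + j) / 2) ≠ x) ∧ _ :=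
    hI.resolve_left (by omega)
  generalize hj : s.reg 66 = j at hlt hcj old hact
  obtain ⟨hjx, hjp, hv⟩ := hact (by omega)
  have hjl : j ≤ lim := by omega
  have hjI : In c lim j := ⟨hcj, hjl, hjp⟩
  have D' := D
  obtain ⟨d1, d2, d3, d4, d5, d6, p1, p2, d7, d8, d9⟩ := D
  simp (disch := omega) only [blockBody, wp_cons, wp_nil, wp_assign, Expr.eval, State.set_reg,
    Nat.reduceEqDiff, if_true, if_false, hr.r60, hj]
  refine ⟨by omega, by omega, ?_⟩
  have hr1 : BlockRegs ((s.set 70 (lo + j)).set 70 ((lo + j) / 2)) lo hi x lim :=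
    (hr.set (by omega)).set (by omega)
  have ag1 : Agree 60 sI ((s.set 70 (lo + j)).set 70 ((lo + j) / 2)) :=
    (hag.set (by omega) (by omega)).set (by omega) (by omega)
  have r66 : ((s.set 70 (lo + j)).set 70 ((lo + j) / 2)).reg 66 = j := by
    simp [State.set_reg, hj]
  have r65 : ((s.set 70 (lo + j)).set 70 ((lo + j) / 2)).reg 65 = lim + 1 := by
    simp [State.set_reg, h65]
  have r76 : ((s.set 70 (lo + j)).set 70 ((lo + j) / 2)).reg 76 = 0 := by
    simp [State.set_reg, h76]
  have r70 : ((s.set 70 (lo + j)).set 70 ((lo + j) / 2)).reg 70 = (lo + j) / 2 := by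
    simp [State.set_reg]
  generalize ((s.set 70 (lo + j)).set 70 ((lo + j) / 2)) = s1 at hr1 ag1 r66 r65 r76 r70 ⊢
  clear hI hr hag hact h65 h76 hj
  have hr62 := hr1.r62
  have hr68 := hr1.r68
  refine (wp_callNext H (hs.trans (ag1.mono (Nat.zero_le _))) (by omega) (by omega) (by omega)
    (by omega) (by omega) (by omega) (by omega) (.inl rfl)).mono ?_
  rintro t s2 ⟨ag2, hn, hm, μ₁, ht, hμ⟩
  rw [r70] at hn hμ hm
  rw [hr62, hr68] at hn
  rw [hr68] at hμ
  generalize hq : s2.reg 84 = q at hn hm hμ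
  have hr2 := hr1.agree ag2
  have r66' : s2.reg 66 = j := by rw [ag2.reg (by omega), r66]
  have r65' : s2.reg 65 = lim + 1 := by rw [ag2.reg (by omega), r65]
  have r76' : s2.reg 76 = 0 := by rw [ag2.reg (by omega), r76]
  have ag3 : Agree 60 sI s2 := ag1.trans (ag2.mono (by omega))
  have hm' : q ≤ n + 2 := by omega
  clear hm ag2 ag1 hr1 r66 r65 r76 r70 hr62 hr68
  clear! s1
  simp only [wp_branch, wp_cons, wp_nil, wp_assign, Expr.eval,
    State.set_reg, Nat.reduceEqDiff, if_true, if_false, r66', hr2.r61, hr2.r67]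
  refine ⟨by omega, by omega, by omega, ?_⟩
  have hn1 := hn.1
  by_cases hc : q + q < hi + j + 1
  · rw [if_pos hc]
    have hqx : χ q = x := (hn.2.2 (by omega)).1
    have hf := D'.found hjI hjx hn1 (by omega) hqx
    have ht' : t + 30 ≤ v := by
      have hb : B * μ₁ ≤ B * ((lim + 2 - j) + ((hi + lim) / 2 + 2 - (lo + j) / 2) + (hi - lo)) :=
        Nat.mul_le_mul_left _ (by omega)
      rcases hv with ⟨k, -, hv⟩ | ⟨⟨Q, Q1, Q2, Q3⟩, hv⟩
      · have hk0 : 60 * A * 2 ≤ 60 * A * (k + 2) := Nat.mul_le_mul_left _ (by omega)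
        omega
      -- An occurrence Q in the window is known from the previous round, so the search stops at Q at
      -- the latest and costs no more than the width of the window.
      · have hqQ : q ≤ Q := by
          by_contra hcon
          exact hn.2.1 Q Q1 (by omega) (by omega) (one_dvd _) Q3
        have hb' : B * μ₁ ≤ B * (hi - lo) := Nat.mul_le_mul_left _ (by omega)
        omega
    rw [show 2 * q = q + q by omega] at hf
    refine ⟨by omega, ?_⟩
    by_cases hc' : j < q + q - j
    · rw [if_pos hc']
      simp (disch := omega) only [wp_mov, State.set_reg, Nat.reduceEqDiff, if_false,
        hr2.r67, r66', hq]
      refine ⟨by omega, by omega, by omega, by omega, 0, ⟨?_, ?_, ?_⟩, by omega⟩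
      · repeat refine Agree.set ?_ (by omega) (by omega)
        exact ag3
      · repeat refine BlockRegs.set ?_ (by omega)
        exact hr2
      · have := hf.1 hc'
        exact .inl ⟨by simp [State.set_reg], by simp [State.set_reg],
          .inl ⟨by simp [State.set_reg], by simpa [State.set_reg] using this⟩⟩
    · rw [if_neg hc']
      simp (disch := omega) only [wp_mov, State.set_reg, Nat.reduceEqDiff, if_true, if_false,
        hr2.r67, hq]
      refine ⟨by omega, by omega, by omega, by omega, 0, ⟨?_, ?_, ?_⟩, by omega⟩
      · repeat refine Agree.set ?_ (by omega) (by omega)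
        exact ag3
      · repeat refine BlockRegs.set ?_ (by omega)
        exact hr2
      · have := hf.2 hc'
        exact .inl ⟨by simp [State.set_reg], by simp [State.set_reg],
          .inl ⟨by simp [State.set_reg], by simpa [State.set_reg] using this⟩⟩
  · rw [if_neg hc]
    refine ⟨by omega, ?_⟩
    have hr3 : BlockRegs ((((s2.set 71 (q + q)).set 72 (hi + j)).set 72 (hi + j + 1)).set 63
        (q + q - hi)) lo hi x lim := by
      repeat refine BlockRegs.set ?_ (by omega)
      exact hr2
    have ag4 : Agree 60 sI ((((s2.set 71 (q + q)).set 72 (hi + j)).set 72 (hi + j + 1)).set 63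
        (q + q - hi)) := by
      repeat refine Agree.set ?_ (by omega) (by omega)
      exact ag3
    have r63 : ((((s2.set 71 (q + q)).set 72 (hi + j)).set 72 (hi + j + 1)).set 63
        (q + q - hi)).reg 63 = 2 * q - hi := by simp [State.set_reg]; omega
    have r65 : ((((s2.set 71 (q + q)).set 72 (hi + j)).set 72 (hi + j + 1)).set 63
        (q + q - hi)).reg 65 = lim + 1 := by simp [State.set_reg, r65']
    have r76 : ((((s2.set 71 (q + q)).set 72 (hi + j)).set 72 (hi + j + 1)).set 63
        (q + q - hi)).reg 76 = 0 := by simp [State.set_reg, r76']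
    generalize ((((s2.set 71 (q + q)).set 72 (hi + j)).set 72 (hi + j + 1)).set 63
        (q + q - hi)) = s3 at hr3 ag4 r63 r65 r76 ⊢
    clear r66' r65' r76' hq ag3 hr2
    clear! s2
    have hr62 := hr3.r62
    have hr64 := hr3.r64
    refine (wp_callNext H (hs.trans (ag4.mono (Nat.zero_le _))) (by omega) (by omega) (by omega)
      (by omega) (by omega) (by omega) (by omega) (.inr rfl)).mono ?_
    rintro t' s4 ⟨ag5, hn', hm, μ₂, ht', hμ'⟩
    rw [r63, hr62, hr64] at hn'
    rw [r63] at hm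
    rw [r63, hr64] at hμ'
    have r65' : s4.reg 65 = lim + 1 := by rw [ag5.reg (by omega), r65]
    have r76' : s4.reg 76 = 0 := by rw [ag5.reg (by omega), r76]
    have ag6 : Agree 60 sI s4 := ag4.trans (ag5.mono (by omega))
    have hr4 := hr3.agree ag5
    generalize hj' : s4.reg 84 = j' at hn' hm hμ'
    have hm2 : j' ≤ 2 * n + 4 := by omega
    clear hm ag5 ag4 hr3 r63 r65 r76 hr62 hr64
    clear! s3
    simp (disch := omega) only [wp_mov, hj']
    refine ⟨by omega, ?_⟩
    have hn1' := hn'.1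
    have hI' : ∀ v', (j' ≤ lim → χ j' = x ∧ j' % 2 = c % 2 ∧
        ((∃ k, lim < j' + (k + 1) * (hi - lo + 2) ∧
          60 * A * (k + 2) + B * ((lim + 2 - j') +
            ((hi + lim) / 2 + 2 - (lo + j') / 2) + (hi - lo)) ≤ v') ∨
        ((∃ Q, (lo + j') / 2 ≤ Q ∧ 2 * Q ≤ hi + j' ∧ χ Q = x) ∧
          60 * A + B * (hi - lo) ≤ v'))) →
        BlockInv χ A B lo hi x c lim sI (s4.set 66 j') v' := by
      intro v' h'
      refine ⟨ag6.set (by omega) (by omega), hr4.set (by omega), .inr ⟨?_, ?_, ?_, ?_, ?_⟩⟩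
      · simp [State.set_reg, r65']
      · simp [State.set_reg, r76']
      · simp only [State.set_reg, if_true]; omega
      · simpa [State.set_reg] using D'.skip hjI old hn (by omega) hn'
      · simpa [State.set_reg] using h'
    have hcost : t + t' ≤ 30 * A + B * μ₁ + B * μ₂ := by omega
    rcases hv with ⟨k, hk, hv⟩ | ⟨⟨Q, Q1, Q2, Q3⟩, hv⟩
    · by_cases hl' : j' ≤ lim
      · obtain ⟨hx', hd⟩ := hn'.2.2 hl'
        have hpj : j' % 2 = c % 2 := by omega
        have hqj : 2 * q ≤ hi + j' := by omega
        have hc0 := block_cost (j' := j') d2 (by omega) hjl hn1 (by omega) hn1' (by omega)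
          (by omega) p1 hk hv hμ hμ'
        by_cases hw' : (lo + j') / 2 ≤ q
        · have := hc0.2.1 hl' hw'
          have hqx := (hn.2.2 (by omega)).1
          exact ⟨60 * A + B * (hi - lo), hI' _ fun _ => ⟨hx', hpj,
            .inr ⟨⟨q, hw', hqj, hqx⟩, le_rfl⟩⟩, by omega⟩
        · obtain ⟨k', hk', hv'⟩ := hc0.2.2 hl' (by omega)
          exact ⟨_, hI' _ fun _ => ⟨hx', hpj, .inl ⟨k', hk', le_rfl⟩⟩, by omega⟩
      · refine ⟨0, hI' 0 fun h => absurd h hl', ?_⟩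
        have hb := Nat.mul_le_mul_left B (show μ₁ + μ₂ ≤ (lim + 2 - j) +
            ((hi + lim) / 2 + 2 - (lo + j) / 2) + (hi - lo) by omega)
        rw [Nat.mul_add B μ₁ μ₂] at hb
        have hk0 : 60 * A * 2 ≤ 60 * A * (k + 2) := Nat.mul_le_mul_left _ (by omega)
        omega
    -- A window known to contain an occurrence cannot fail.
    · exfalso
      exact hn.2.1 Q Q1 (by omega) (by omega) (one_dvd _) Q3

/-- Searches a triple with one end in `lo, lo + 2, …, hi` (registers `60`, `61`), where all
positions carry the character in register `62`, and the other one in the disjoint range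
`c, c + 2, …, lim` (registers `63`, `64`). -/
def blockSearch (N : Program) : Program :=
  blk [.assign 76 (.const 0), .assign 67 (.const 1),
    .assign 65 (.add 64 67),
    .assign 68 (.add 61 64), .assign 68 (.half 68),
    callNext N 62 63 64 2, mov 66 84,
    .loop 66 65 (blockBody N)]

-- The number k of jumps of length hi - lo + 2 that fit into the range bounds the number of
-- expensive rounds. This is where the ratio of the two lengths enters the running time; the part
-- charged per position is linear.
set_option maxHeartbeats 1600000 in
theorem wp_blockSearch {s₀ : State} {w n : ℕ} {χ : ℕ → ℕ} {N : Program} {A B : ℕ}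
    (H : NextSpec s₀ w n χ N A B) {s : State} (hs : Agree 0 s₀ s) {lo hi x c lim : ℕ}
    (h60 : s.reg 60 = lo) (h61 : s.reg 61 = hi) (h62 : s.reg 62 = x) (h63 : s.reg 63 = c)
    (h64 : s.reg 64 = lim) (D : BlockData n χ lo hi x c lim) :
    Wp w (blockSearch N) s fun t s' => Agree 60 s s' ∧ Outcome χ (Across lo hi c lim) s' ∧
      ∃ k, k * (hi - lo + 2) ≤ lim - c ∧
        t ≤ 60 * A * (k + 3) + B * (3 * (hi - lo) + 3 * (lim - c) + 12) := by
  have hw := H.width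
  have hA := H.pos
  have D' := D
  obtain ⟨d1, d2, d3, d4, d5, d6, p1, p2, d7, d8, d9⟩ := D
  simp (disch := omega) only [blockSearch, wp_cons, wp_nil, wp_assign, Expr.eval, State.set_reg,
    Nat.reduceEqDiff, if_true, if_false, h61, h64]
  refine ⟨by omega, by omega, by omega, by omega, by omega, ?_⟩
  have ag : Agree 60 s (((((s.set 76 0).set 67 1).set 65 (lim + 1)).set 68
    (hi + lim)).set 68 ((hi + lim) / 2)) := by
    repeat refine Agree.set ?_ (by omega) (by omega)
    exact Agree.refl _ _
  generalize hs1 : (((((s.set 76 0).set 67 1).set 65 (lim + 1)).set 68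
    (hi + lim)).set 68 ((hi + lim) / 2)) = s1 at ag ⊢
  have hr : BlockRegs s1 lo hi x lim := by
    constructor <;> simp [← hs1, State.set_reg, h60, h61, h62, h64]
  have r63 : s1.reg 63 = c := by simp [← hs1, State.set_reg, h63]
  have r65 : s1.reg 65 = lim + 1 := by simp [← hs1, State.set_reg]
  have r76 : s1.reg 76 = 0 := by simp [← hs1, State.set_reg]
  clear hs1 h60 h61 h62 h63 h64
  have r62 := hr.r62
  have r64 := hr.r64
  refine (wp_callNext H (hs.trans (ag.mono (Nat.zero_le _))) (by omega) (by omega) (by omega)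
    (by omega) (by omega) (by omega) (by omega) (.inr rfl)).mono ?_
  rintro t s2 ⟨ag2, hn, hm, μ, ht, hμ⟩
  have hr2 := hr.agree ag2
  rw [r62, r63, r64] at hn
  rw [r63] at hm
  rw [r63, r64] at hμ
  have r65' : s2.reg 65 = lim + 1 := by rw [ag2.reg (by omega), r65]
  have r76' : s2.reg 76 = 0 := by rw [ag2.reg (by omega), r76]
  have ag3 : Agree 60 s s2 := ag.trans (ag2.mono (by omega))
  generalize hj : s2.reg 84 = j at hn hm hμ
  have hm' : j ≤ n + 2 := by omega
  clear hm ag ag2 hr r62 r63 r64 r65 r76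
  clear! s1
  simp (disch := omega) only [wp_mov, hj]
  refine ⟨by omega, ?_⟩
  have hcj := hn.1
  -- Division with remainder gives both the bound on k in the conclusion and the strict inequality
  -- that the loop invariant needs.
  have hk := Nat.div_mul_le_self (lim - c) (hi - lo + 2)
  have hk' := Nat.lt_div_mul_add (a := lim - c) (b := hi - lo + 2) (by omega)
  generalize (lim - c) / (hi - lo + 2) = k at hk hk'
  have hinv : BlockInv χ A B lo hi x c lim s (s2.set 66 j) (60 * A * (k + 2) + B *
      ((lim + 2 - j) + ((hi + lim) / 2 + 2 - (lo + j) / 2) + (hi - lo))) := by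
    refine ⟨ag3.set (by omega) (by omega), hr2.set (by omega), .inr ⟨?_, ?_, ?_, ?_, ?_⟩⟩
    · simp [State.set_reg, r65']
    · simp [State.set_reg, r76']
    · simpa [State.set_reg] using hcj
    · simp only [State.set_reg, if_true]
      rintro j₀ ⟨e1, e2, e3⟩ hlt hx
      exact absurd hx (hn.2.1 j₀ e1 hlt e2 (by omega))
    · simp only [State.set_reg, if_true]
      intro hl
      obtain ⟨hx, hd⟩ := hn.2.2 hl
      have hp : j % 2 = c % 2 := by omega
      refine ⟨hx, hp, .inl ⟨k, ?_, le_rfl⟩⟩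
      rw [Nat.succ_mul]
      omega
  refine (wp_loop _ (fun s v => wp_blockBody H hs D' s v) hinv).mono ?_
  rintro t' s3 ⟨ht', ⟨v', ag4, hr4, hI⟩, hex⟩
  refine ⟨ag4, ?_, k, hk, ?_⟩
  · rcases hI with ⟨-, -, hI⟩ | ⟨e1, e2, e3, e4, -⟩
    · exact hI
    · refine .inr ⟨e2, ?_⟩
      rintro i d ⟨t0, t1, t2⟩ (⟨hi, hj⟩ | ⟨hi, hj⟩)
      · have hix := d9 _ hi
        refine e4 _ hj (by have := hj.2.1; omega) (by rw [t2, hix]) _ hi ?_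
        rw [show (i + (i + 2 * d)) / 2 = i + d by omega, t1, hix]
      · have hix := d9 _ hj
        refine e4 _ hi (by have := hi.2.1; omega) (by rw [← t2, hix]) _ hj ?_
        rw [show (i + 2 * d + i) / 2 = i + d by omega, t1, ← t2, hix]
  · clear hI
    have hb := Nat.mul_le_mul_left B (show μ + ((lim + 2 - j) +
      ((hi + lim) / 2 + 2 - (lo + j) / 2) + (hi - lo)) ≤
      3 * (hi - lo) + 3 * (lim - c) + 12 by omega)
    rw [Nat.mul_add B μ] at hb
    have e : 60 * A * (k + 3) = 60 * A * (k + 2) + 60 * A := by ring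
    omega

/-- Writes the character at the position in register `p` to register `r`; register `one` holds
`1`. -/
def charAt (N : Program) (one r p : ℕ) : Program :=
  blk [callNext N one p p 1, .branch p 84 (.assign r (.const 0)) (.assign r (.const 1))]

/-- A search for 1 whose start and limit coincide reads a single character: it stays at p if p
carries 1 and moves past p if p carries 0. -/
theorem wp_charAt {s₀ : State} {w n : ℕ} {χ : ℕ → ℕ} {N : Program} {A B : ℕ}
    (H : NextSpec s₀ w n χ N A B) {s : State} (hs : Agree 0 s₀ s) {one r p : ℕ} (ho : one < 80)
    (hp : p < 80) (h1 : s.reg one = 1) (hp1 : 1 ≤ s.reg p) (hpn : s.reg p ≤ n) :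
    Wp w (charAt N one r p) s fun t s' => ∃ s1, Agree 80 s s1 ∧ s' = s1.set r (χ (s.reg p)) ∧
      t ≤ 12 * A + B * 2 := by
  have hw := H.width
  have hA := H.pos
  simp only [charAt, wp_cons, wp_nil]
  refine (wp_callNext H hs ho hp hp (by omega) hp1 (by omega) hpn (.inl rfl)).mono ?_
  rintro t s1 ⟨ag, ⟨n1, n2, n3⟩, -, μ, ht, hμ⟩
  have hb := H.bool (s.reg p)
  have hB : B * μ ≤ B * 2 := Nat.mul_le_mul_left _ (by omega)
  simp only [wp_branch, wp_assign, Expr.eval, ag.reg hp]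
  by_cases hc : s.reg p < s1.reg 84
  · have := n2 _ le_rfl hc le_rfl (one_dvd _)
    rw [if_pos hc]
    exact ⟨by omega, s1, ag, by rw [show χ (s.reg p) = 0 by omega], by omega⟩
  · have := (n3 (by omega)).1
    rw [show s1.reg 84 = s.reg p by omega] at this
    rw [if_neg hc]
    exact ⟨by omega, s1, ag, by rw [show χ (s.reg p) = 1 by omega], by omega⟩

/-- Calls `blockSearch` with arguments from the given registers. -/
def callBlock (N : Program) (lo hi x c lim : ℕ) : Program :=
  blk [mov 60 lo, mov 61 hi, mov 62 x, mov 63 c, mov 64 lim, blockSearch N]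

theorem wp_callBlock {s₀ : State} {w n : ℕ} {χ : ℕ → ℕ} {N : Program} {A B : ℕ}
    (H : NextSpec s₀ w n χ N A B) {s : State} (hs : Agree 0 s₀ s) {rlo rhi rx rc rlim : ℕ}
    (h1 : rlo < 60) (h2 : rhi < 60) (h3 : rx < 60) (h4 : rc < 60) (h5 : rlim < 60)
    {lo hi x c lim : ℕ}
    (h60 : s.reg rlo = lo) (h61 : s.reg rhi = hi) (h62 : s.reg rx = x) (h63 : s.reg rc = c)
    (h64 : s.reg rlim = lim) (D : BlockData n χ lo hi x c lim) :
    Wp w (callBlock N rlo rhi rx rc rlim) s fun t s' => Agree 60 s s' ∧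
      Outcome χ (Across lo hi c lim) s' ∧
      ∃ k, k * (hi - lo + 2) ≤ lim - c ∧
        t ≤ 60 * A * (k + 4) + B * (3 * (hi - lo) + 3 * (lim - c) + 12) := by
  have hw := H.width
  have hA := H.pos
  obtain ⟨d1, d2, d3, d4, d5, d6, -, -, -, d8, -⟩ := id D
  simp (disch := omega) only [callBlock, wp_cons, wp_nil, wp_mov, State.set_reg_of_ne,
    h60, h61, h62, h63, h64]
  refine ⟨by omega, by omega, by omega, by omega, by omega, ?_⟩
  have ag : Agree 60 s (((((s.set 60 lo).set 61 hi).set 62 x).set 63 c).set 64 lim) := by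
    repeat refine Agree.set ?_ (by omega) (by omega)
    exact Agree.refl _ _
  refine (wp_blockSearch H (hs.trans (ag.mono (Nat.zero_le _))) (by simp [State.set_reg])
    (by simp [State.set_reg]) (by simp [State.set_reg]) (by simp [State.set_reg])
    (by simp [State.set_reg]) D).mono ?_
  rintro t s' ⟨ag', ho, k, hk, ht⟩
  refine ⟨ag.trans ag', ho, k, hk, ?_⟩
  have e : 60 * A * (k + 4) = 60 * A * (k + 3) + 60 * A := by ring
  omega

/-- Data of a call of `ccSearch`. -/
structure CcData (n : ℕ) (χ : ℕ → ℕ) (lo hi x c lim : ℕ) : Prop where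
  one_le_lo : 1 ≤ lo
  lo_le_hi : lo ≤ hi
  hi_lt : hi < c
  c_le : c ≤ lim
  lim_le : lim ≤ n
  par_hi : hi % 2 = lo % 2
  par_c : c % 2 = lo % 2
  par_lim : lim % 2 = lo % 2
  bool : x ≤ 1
  const : ∀ k, In lo hi k → χ k = x
  const' : ∀ k, In c lim k → χ k = x

/-- Calls `ccSearch` with arguments from the given registers. -/
def callCc (N : Program) (lo hi x c lim : ℕ) : Program :=
  blk [mov 60 lo, mov 61 hi, mov 62 x, mov 63 c, mov 64 lim, ccSearch N]

theorem wp_callCc {s₀ : State} {w n : ℕ} {χ : ℕ → ℕ} {N : Program} {A B : ℕ}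
    (H : NextSpec s₀ w n χ N A B) {s : State} (hs : Agree 0 s₀ s) {rlo rhi rx rc rlim : ℕ}
    (h1 : rlo < 60) (h2 : rhi < 60) (h3 : rx < 60) (h4 : rc < 60) (h5 : rlim < 60)
    {lo hi x c lim M : ℕ}
    (h60 : s.reg rlo = lo) (h61 : s.reg rhi = hi) (h62 : s.reg rx = x) (h63 : s.reg rc = c)
    (h64 : s.reg rlim = lim) (D : CcData n χ lo hi x c lim) (hM : hi - lo + (lim - c) ≤ M) :
    Wp w (callCc N rlo rhi rx rc rlim) s fun t s' => Agree 60 s s' ∧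
      Outcome χ (fun i j => In lo hi i ∧ In c lim j) s' ∧ t ≤ 52 * A + B * (M + 4) := by
  have hw := H.width
  have hA := H.pos
  obtain ⟨d1, d2, d3, d4, d5, d6, d7, d8, d9, d10, d11⟩ := D
  simp (disch := omega) only [callCc, wp_cons, wp_nil, wp_mov, State.set_reg_of_ne,
    h60, h61, h62, h63, h64]
  refine ⟨by omega, by omega, by omega, by omega, by omega, ?_⟩
  have ag : Agree 60 s (((((s.set 60 lo).set 61 hi).set 62 x).set 63 c).set 64 lim) := by
    repeat refine Agree.set ?_ (by omega) (by omega)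
    exact Agree.refl _ _
  refine (wp_ccSearch H (hs.trans (ag.mono (Nat.zero_le _))) (by simp [State.set_reg])
    (by simp [State.set_reg]) (by simp [State.set_reg]) (by simp [State.set_reg])
    (by simp [State.set_reg]) d1 d2 d3 d4 d5 d6 d7 d8 d9 d10 d11).mono ?_
  rintro t s' ⟨ag', ho, ht⟩
  have hB : B * (hi - lo + (lim - c) + 4) ≤ B * (M + 4) := Nat.mul_le_mul_left _ (by omega)
  exact ⟨ag.trans ag', ho, by omega⟩

/-! ### Combining two searches -/

theorem Outcome.or_left {χ : ℕ → ℕ} {P P' : ℕ → ℕ → Prop} {s : State} (h : Outcome χ P s)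
    (h1 : s.reg 76 = 1) : Outcome χ (fun i j => P i j ∨ P' i j) s := by
  rcases h with ⟨_, h2, h3⟩ | ⟨h2, _⟩
  · exact .inl ⟨h1, h2, .inl h3⟩
  · omega

theorem Outcome.or_right {χ : ℕ → ℕ} {P P' : ℕ → ℕ → Prop} {s s' : State} (h : Outcome χ P s)
    (h1 : s.reg 76 ≠ 1) (h' : Outcome χ P' s') : Outcome χ (fun i j => P i j ∨ P' i j) s' := by
  rcases h with ⟨h2, _⟩ | ⟨_, h3⟩
  · exact absurd h2 h1
  rcases h' with ⟨h4, h5, h6⟩ | ⟨h4, h5⟩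
  · exact .inl ⟨h4, h5, .inr h6⟩
  · exact .inr ⟨h4, fun i d ht hp => hp.elim (h3 i d ht) (h5 i d ht)⟩

theorem Outcome.flag {χ : ℕ → ℕ} {P : ℕ → ℕ → Prop} {s : State} (h : Outcome χ P s) :
    s.reg 76 = 1 ∨ s.reg 76 = 0 := h.imp And.left And.left

/-- Runs `q` unless `p` was successful; register `one` holds `1`. -/
def orElse (one : ℕ) (p q : Program) : Program := blk [p, .branch 76 one q .skip]

/-- The second search runs only after the first one has failed, and `hq` may use this failure. For
overlapping intervals it provides the bound on the length of the overlap. -/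
theorem wp_orElse {w one : ℕ} {χ : ℕ → ℕ} {P P' : ℕ → ℕ → Prop} {p q : Program} {s : State}
    {lo lo' T T' : ℕ} (ho : one < lo') (hl : lo ≤ lo') (h1 : s.reg one = 1)
    (hp : Wp w p s fun t s' => Agree lo' s s' ∧ Outcome χ P s' ∧ t ≤ T)
    (hq : ∀ s1, Agree lo' s s1 → (∀ i d, Triple χ i d → ¬ P i (i + 2 * d)) →
      Wp w q s1 fun t s' => Agree lo s1 s' ∧ Outcome χ P' s' ∧ t ≤ T') :
    Wp w (orElse one p q) s fun t s' => Agree lo s s' ∧ Outcome χ (fun i j => P i j ∨ P' i j) s' ∧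
      t ≤ T + T' + 3 := by
  simp only [orElse, wp_cons, wp_nil]
  refine hp.mono ?_
  rintro t s1 ⟨ag, hO, ht⟩
  rw [wp_branch, ag.reg ho, h1]
  split_ifs with hc
  · have hn : ∀ i d, Triple χ i d → ¬ P i (i + 2 * d) := by
      rcases hO with ⟨h, _⟩ | ⟨_, h⟩
      · omega
      · exact h
    refine (hq s1 ag hn).mono ?_
    rintro t' s2 ⟨ag', hO', ht'⟩
    exact ⟨(ag.mono hl).trans ag', hO.or_right (by omega) hO', by omega⟩
  · rw [wp_skip]
    have := hO.flag
    exact ⟨ag.mono hl, hO.or_left (by omega), by omega⟩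

/-- Each case of the analysis of changes below ends with two pairs of constant ranges, possibly
single positions, so all of them share this form. -/
theorem wp_cc2 {s₀ : State} {w n : ℕ} {χ : ℕ → ℕ} {N : Program} {A B : ℕ}
    (H : NextSpec s₀ w n χ N A B) {s : State} (hs : Agree 0 s₀ s) {rlo rhi rx rc rlim : ℕ}
    (h1 : rlo < 60) (h2 : rhi < 60) (h3 : rx < 60) (h4 : rc < 60) (h5 : rlim < 60)
    {lo hi x c lim M : ℕ}
    (h60 : s.reg rlo = lo) (h61 : s.reg rhi = hi) (h62 : s.reg rx = x) (h63 : s.reg rc = c)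
    (h64 : s.reg rlim = lim) (D : CcData n χ lo hi x c lim) (hM : hi - lo + (lim - c) ≤ M)
    {rlo' rhi' rx' rc' rlim' : ℕ}
    (h1' : rlo' < 60) (h2' : rhi' < 60) (h3' : rx' < 60) (h4' : rc' < 60) (h5' : rlim' < 60)
    {lo' hi' x' c' lim' : ℕ}
    (h60' : s.reg rlo' = lo') (h61' : s.reg rhi' = hi') (h62' : s.reg rx' = x')
    (h63' : s.reg rc' = c') (h64' : s.reg rlim' = lim') (D' : CcData n χ lo' hi' x' c' lim')
    (hM' : hi' - lo' + (lim' - c') ≤ M) (h58 : s.reg 58 = 1) :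
    Wp w (orElse 58 (callCc N rlo rhi rx rc rlim) (callCc N rlo' rhi' rx' rc' rlim')) s
      fun t s' => Agree 60 s s' ∧
      Outcome χ (fun i j => In lo hi i ∧ In c lim j ∨ In lo' hi' i ∧ In c' lim' j) s' ∧
      t ≤ 110 * A + B * (2 * M + 8) := by
  have hA := H.pos
  refine (wp_orElse (by decide) le_rfl h58
    (wp_callCc H hs h1 h2 h3 h4 h5 h60 h61 h62 h63 h64 D hM)
    (fun s1 ag _ => wp_callCc H (hs.trans (ag.mono (Nat.zero_le _))) h1' h2' h3' h4' h5'
      (by rw [ag.reg h1', h60']) (by rw [ag.reg h2', h61']) (by rw [ag.reg h3', h62'])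
      (by rw [ag.reg h4', h63']) (by rw [ag.reg h5', h64']) D' hM')).mono ?_
  rintro t s' ⟨ag, hO, ht⟩
  have e : B * (2 * M + 8) = B * (M + 4) + B * (M + 4) := by ring
  exact ⟨ag, hO, by omega⟩

/-! ### Two nonconstant ranges: changes of characters -/

theorem IsNext.before {χ : ℕ → ℕ} (hχ : ∀ i, χ i ≤ 1) {x a b p : ℕ} (hx : x ≤ 1)
    (h : IsNext χ (1 - x) a b 2 p) {k : ℕ} (hk : In a b k) (hkp : k < p) : χ k = x := by
  obtain ⟨h1, h2, h3⟩ := hk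
  have := h.2.1 k h1 hkp h2 (by omega)
  have := hχ k
  omega

theorem IsNext.at {χ : ℕ → ℕ} {x a b p : ℕ}
    (h : IsNext χ x a b 2 p) (hp : p ≤ b) : χ p = x ∧ In a b p := by
  have h1 := h.1
  obtain ⟨h2, h3⟩ := h.2.2 hp
  exact ⟨h2, h1, hp, by omega⟩

/-- A change of characters in one range and the opposite change in a later one give a triple. -/
theorem conflict {n : ℕ} {χ : ℕ → ℕ} (hχ : ∀ i, χ i ≤ 1) {a b c e i j y z : ℕ} (ha : 1 ≤ a)
    (hbc : b < c) (he : e ≤ n) (hac : a % 2 = c % 2) (hi : In a b i) (hi' : In a b (i - 2))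
    (hi2 : 2 < i) (hj : In c e j) (hj' : In c e (j - 2)) (hj2 : 2 < j) (hyz : y + z = 1)
    (c1 : χ (i - 2) = y)
    (c2 : χ i = z) (c3 : χ (j - 2) = z) (c4 : χ j = y) :
    CcData n χ (i - 2) (i - 2) y j j ∧ CcData n χ i i z (j - 2) (j - 2) ∧
    ∀ s, Outcome χ (fun i' j' => In (i - 2) (i - 2) i' ∧ In j j j' ∨
        In i i i' ∧ In (j - 2) (j - 2) j') s →
      Outcome χ (fun i j => In a b i ∧ In c e j) s := by
  have eq : ∀ m k, In m m k → k = m := fun m k h => by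
    obtain ⟨_, _, _⟩ := h
    omega
  have self : ∀ m, In m m m := fun m => ⟨le_rfl, le_rfl, rfl⟩
  obtain ⟨i1, i2, i3⟩ := id hi
  obtain ⟨i4, i5, i6⟩ := id hi'
  obtain ⟨j1, j2, j3⟩ := id hj
  obtain ⟨j4, j5, j6⟩ := id hj'
  refine ⟨⟨by omega, le_rfl, by omega, le_rfl, by omega, rfl, by omega, by omega, by omega,
    fun k hk => by rw [eq _ _ hk, c1], fun k hk => by rw [eq _ _ hk, c4]⟩,
    ⟨by omega, le_rfl, by omega, le_rfl, by omega, rfl, by omega, by omega, by omega,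
    fun k hk => by rw [eq _ _ hk, c2], fun k hk => by rw [eq _ _ hk, c3]⟩, ?_⟩
  rintro s (⟨h1, h2, h3⟩ | ⟨h1, h2⟩)
  · refine .inl ⟨h1, h2, ?_⟩
    rcases h3 with ⟨h3, h4⟩ | ⟨h3, h4⟩ <;> rw [eq _ _ h4, eq _ _ h3]
    · exact ⟨hi', hj⟩
    · exact ⟨hi, hj'⟩
  · exfalso
    -- The pairs (i - 2, j) and (i, j - 2) have this common midpoint. Their characters are y and z,
    -- which exhaust the alphabet, so one of the two singleton searches cannot have failed.
    have hm := hχ ((i + (j - 2)) / 2)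
    rcases (show χ ((i + (j - 2)) / 2) = y ∨ χ ((i + (j - 2)) / 2) = z by omega) with hm | hm
    · have e1 : i - 2 + ((i + (j - 2)) / 2 - (i - 2)) = (i + (j - 2)) / 2 := by omega
      have e2 : i - 2 + 2 * ((i + (j - 2)) / 2 - (i - 2)) = j := by omega
      refine h2 (i - 2) ((i + (j - 2)) / 2 - (i - 2)) ?_ (.inl ?_)
      · rw [Triple, e1, e2, hm, c1, c4]
        exact ⟨by omega, rfl, rfl⟩
      · rw [e2]
        exact ⟨self _, self _⟩
    · have e1 : i + ((i + (j - 2)) / 2 - i) = (i + (j - 2)) / 2 := by omega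
      have e2 : i + 2 * ((i + (j - 2)) / 2 - i) = j - 2 := by omega
      refine h2 i ((i + (j - 2)) / 2 - i) ?_ (.inr ?_)
      · rw [Triple, e1, e2, hm, c2, c3]
        exact ⟨by omega, rfl, rfl⟩
      · rw [e2]
        exact ⟨self _, self _⟩

/-- Data of a call of `parityStage` for two nonempty ranges. -/
structure RangeData (n a b c e : ℕ) : Prop where
  one_le : 1 ≤ a
  le : a ≤ b
  lt : b < c
  le' : c ≤ e
  e_le : e ≤ n
  par_b : b % 2 = a % 2
  par_c : c % 2 = a % 2
  par_e : e % 2 = a % 2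

/-- The registers of `parityStage` after the first changes of characters have been found. -/
structure FirstRegs (s : State) (a b c e x z p q : ℕ) : Prop where
  r40 : s.reg 40 = a
  r41 : s.reg 41 = b
  r42 : s.reg 42 = c
  r43 : s.reg 43 = e
  r44 : s.reg 44 = x
  r45 : s.reg 45 = z
  r46 : s.reg 46 = 1 - x
  r47 : s.reg 47 = p
  r49 : s.reg 49 = q
  r58 : s.reg 58 = 1

theorem FirstRegs.agree {s s' : State} {a b c e x z p q : ℕ} (h : FirstRegs s a b c e x z p q)
    (ha : Agree 60 s s') : FirstRegs s' a b c e x z p q := by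
  constructor <;> rw [ha.reg (by omega)]
  exacts [h.r40, h.r41, h.r42, h.r43, h.r44, h.r45, h.r46, h.r47, h.r49, h.r58]

theorem FirstRegs.set {s : State} {a b c e x z p q : ℕ} (h : FirstRegs s a b c e x z p q)
    {r v : ℕ} (hr : r = 48 ∨ 50 ≤ r ∧ r < 58 ∨ 58 < r) :
    FirstRegs (s.set r v) a b c e x z p q := by
  constructor <;> rw [State.set_reg_of_ne _ _ (by omega)]
  exacts [h.r40, h.r41, h.r42, h.r43, h.r44, h.r45, h.r46, h.r47, h.r49, h.r58]

/-- Searches a triple between two nonconstant ranges whose changes of characters are known. -/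
def pairSearch (N : Program) : Program :=
  .branch 44 45
    (orElse 58 (callCc N 51 51 44 49 49) (callCc N 47 47 46 52 52))
    (.branch 45 44
      (orElse 58 (callCc N 51 51 44 49 49) (callCc N 47 47 46 52 52))
      (.branch 41 48
        (.branch 43 50
          (orElse 58 (callCc N 40 51 44 42 52) (callCc N 47 41 46 49 43))
          (orElse 58 (callCc N 51 51 44 50 50) (callCc N 47 47 46 54 54)))
        (orElse 58 (callCc N 53 53 46 49 49) (callCc N 48 48 44 52 52))))

/-- First changes of characters in two ranges. -/
structure FirstData (χ : ℕ → ℕ) (a b c e x z p q : ℕ) : Prop where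
  hx : χ a = x
  hz : χ c = z
  hp : IsNext χ (1 - x) a b 2 p
  hq : IsNext χ (1 - z) c e 2 q
  p_le : p ≤ b
  q_le : q ≤ e

theorem change_ge {χ : ℕ → ℕ} {x a b p : ℕ} (ha : χ a = x) (hx : x ≤ 1)
    (h : IsNext χ (1 - x) a b 2 p) (hp : p ≤ b) : In a b p ∧ In a b (p - 2) ∧ a + 2 ≤ p := by
  obtain ⟨h1, h2, h3, h4⟩ := h.at hp
  have : p ≠ a := by
    rintro rfl
    omega
  exact ⟨⟨h2, h3, h4⟩, ⟨by omega, by omega, by omega⟩, by omega⟩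

/-- A second change is a first change in the range that starts at p with the other character, so
`change_ge` applies to this shorter range. -/
theorem change_ge' {χ : ℕ → ℕ} {x a b p p' : ℕ} (hχ : ∀ i, χ i ≤ 1) (hx : x ≤ 1)
    (hp : χ p = 1 - x) (hI : In a b p)
    (h : IsNext χ x p b 2 p') (hp' : p' ≤ b) :
    χ p' = x ∧ χ (p' - 2) = 1 - x ∧ In a b p' ∧ In a b (p' - 2) ∧ a + 2 ≤ p' := by
  have h' : IsNext χ (1 - (1 - x)) p b 2 p' := by rwa [show 1 - (1 - x) = x by omega]
  obtain ⟨⟨h1, h2, h3⟩, h4, h5⟩ := change_ge hp (by omega) h' hp'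
  obtain ⟨h6, h7, h8⟩ := hI
  have h9 := h4.1
  exact ⟨(h.at hp').1, h'.before hχ (by omega) h4 (by omega), ⟨by omega, by omega, by omega⟩,
    ⟨by omega, by omega, by omega⟩, by omega⟩

theorem In.split {a b p k : ℕ} (hp : In a b p) (h : a + 2 ≤ p) :
    In a b k ↔ In a (p - 2) k ∨ In p b k := by
  obtain ⟨_, _, _⟩ := hp
  constructor
  · rintro ⟨_, _, _⟩
    by_cases hk : k < p
    · exact .inl ⟨by omega, by omega, by omega⟩
    · exact .inr ⟨by omega, by omega, by omega⟩
  · rintro (⟨_, _, _⟩ | ⟨_, _, _⟩)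
    · exact ⟨by omega, by omega, by omega⟩
    · exact ⟨by omega, by omega, by omega⟩

/-- If both ranges change characters exactly once, in the same direction, then two pairs of
constant ranges remain. -/
theorem parallel {n : ℕ} {χ : ℕ → ℕ} {a b c e x y p q : ℕ} (D : RangeData n a b c e)
    (hxy : x + y = 1) (Ip : In a b p) (hp : a + 2 ≤ p) (Iq : In c e q) (hq : c + 2 ≤ q)
    (u1 : ∀ k, In a (p - 2) k → χ k = x) (v1 : ∀ k, In c (q - 2) k → χ k = x)
    (u2 : ∀ k, In p b k → χ k = y) (v2 : ∀ k, In q e k → χ k = y) :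
    CcData n χ a (p - 2) x c (q - 2) ∧ CcData n χ p b y q e ∧
    ∀ s, Outcome χ (fun i j => In a (p - 2) i ∧ In c (q - 2) j ∨ In p b i ∧ In q e j) s →
      Outcome χ (fun i j => In a b i ∧ In c e j) s := by
  obtain ⟨d1, d2, d3, d4, d5, d6, d7, d8⟩ := D
  refine ⟨?_, ?_, fun s hO => hO.congr ?_⟩
  · obtain ⟨_, _, _⟩ := Ip
    obtain ⟨_, _, _⟩ := Iq
    exact ⟨d1, by omega, by omega, by omega, by omega, by omega, by omega, by omega, by omega,
      u1, v1⟩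
  · obtain ⟨_, _, _⟩ := Ip
    obtain ⟨_, _, _⟩ := Iq
    exact ⟨by omega, by omega, by omega, by omega, by omega, by omega, by omega, by omega,
      by omega, u2, v2⟩
  · rintro i d ⟨_, -, t2⟩
    rw [Ip.split hp, Iq.split hq]
    constructor
    · tauto
    -- The mixed pairs have different characters at their ends, so they contribute no triple.
    · rintro ⟨hi | hi, hj | hj⟩
      · exact .inl ⟨hi, hj⟩
      · have := u1 _ hi
        have := v2 _ hj
        omega
      · have := u2 _ hi
        have := v1 _ hj
        omega
      · exact .inr ⟨hi, hj⟩

-- Among the first two changes of each range there is either an opposite pair, to which `conflict`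
-- applies, or none; in the latter case each range changes exactly once and `parallel` applies.
-- Later changes never matter.
set_option maxHeartbeats 1600000 in
theorem wp_pairSearch {s₀ : State} {w n : ℕ} {χ : ℕ → ℕ} {N : Program} {A B : ℕ}
    (H : NextSpec s₀ w n χ N A B) {s : State} (hs : Agree 0 s₀ s) {a b c e x z p q p' q' : ℕ}
    (D : RangeData n a b c e) (hr : FirstRegs s a b c e x z p q) (F : FirstData χ a b c e x z p q)
    (hp' : IsNext χ x p b 2 p') (hq' : IsNext χ z q e 2 q')
    (r48 : s.reg 48 = p') (r50 : s.reg 50 = q') (r51 : s.reg 51 = p - 2) (r52 : s.reg 52 = q - 2)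
    (r53 : s.reg 53 = p' - 2) (r54 : s.reg 54 = q' - 2) :
    Wp w (pairSearch N) s fun t s' => Agree 60 s s' ∧
      Outcome χ (fun i j => In a b i ∧ In c e j) s' ∧
      t ≤ 114 * A + B * (2 * (b - a + (e - c)) + 8) := by
  have hχ := H.bool
  have hA := H.pos
  obtain ⟨d1, d2, d3, d4, d5, d6, d7, d8⟩ := id D
  obtain ⟨r40, r41, r42, r43, r44, r45, r46, r47, r49, r58⟩ := hr
  obtain ⟨hx, hz, hp, hq, pb, qe⟩ := F
  have x1 : x ≤ 1 := hx ▸ hχ a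
  have z1 : z ≤ 1 := hz ▸ hχ c
  obtain ⟨Ip, Ip2, p2⟩ := change_ge hx x1 hp pb
  obtain ⟨Iq, Iq2, q2⟩ := change_ge hz z1 hq qe
  have cp := (hp.at pb).1
  have cq := (hq.at qe).1
  have cp2 := hp.before hχ x1 Ip2 (by omega)
  have cq2 := hq.before hχ z1 Iq2 (by omega)
  -- If the ranges begin with different characters, their first changes have opposite directions.
  have key : x ≠ z →
      Wp w (orElse 58 (callCc N 51 51 44 49 49) (callCc N 47 47 46 52 52)) s fun t s' =>
      Agree 60 s s' ∧ Outcome χ (fun i j => In a b i ∧ In c e j) s' ∧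
      t ≤ 110 * A + B * (2 * (b - a + (e - c)) + 8) := by
    intro hxz
    obtain ⟨D1, D2, hO⟩ := conflict hχ d1 d3 d5 (by omega) Ip Ip2 (by omega) Iq Iq2 (by omega)
      (show x + (1 - x) = 1 by omega) cp2 cp (by omega) (by omega)
    refine (wp_cc2 H hs (by decide) (by decide) (by decide) (by decide) (by decide) r51 r51 r44 r49
      r49 D1 (M := b - a + (e - c)) (by omega) (by decide) (by decide) (by decide) (by decide)
      (by decide) r47 r47 r46 r52 r52 D2 (by omega) r58).mono ?_
    exact fun t s' h => ⟨h.1, hO s' h.2.1, h.2.2⟩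
  have time : ∀ {t k : ℕ}, t ≤ 110 * A + k → t + 4 ≤ 114 * A + k := fun h => by omega
  simp only [pairSearch, wp_branch, r44, r45, r41, r43, r48, r50]
  by_cases h1 : x < z
  · rw [if_pos h1]
    exact (key (by omega)).mono fun t s' h => ⟨h.1, h.2.1, (by omega : _ ≤ t + 4).trans (time h.2.2)⟩
  rw [if_neg h1]
  by_cases h2 : z < x
  · rw [if_pos h2]
    exact (key (by omega)).mono fun t s' h => ⟨h.1, h.2.1, (by omega : _ ≤ t + 4).trans (time h.2.2)⟩
  rw [if_neg h2]
  clear key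
  -- From here on the first changes are parallel, and a second change in one range is opposite to
  -- the first change in the other.
  obtain rfl : x = z := by omega
  by_cases h3 : b < p'
  · rw [if_pos h3]
    by_cases h4 : e < q'
    · rw [if_pos h4]
      have hp'' : IsNext χ (1 - (1 - x)) p b 2 p' := by rwa [show 1 - (1 - x) = x by omega]
      have hq'' : IsNext χ (1 - (1 - x)) q e 2 q' := by rwa [show 1 - (1 - x) = x by omega]
      have y1 : 1 - x ≤ 1 := by omega
      have hpq : p - 2 < p ∧ q - 2 < q := by omega
      obtain ⟨D1, D2, hO⟩ := parallel D (show x + (1 - x) = 1 by omega) Ip p2 Iq q2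
        (fun k hk => hp.before hχ x1 ((Ip.split p2).2 (.inl hk)) (hk.2.1.trans_lt hpq.1))
        (fun k hk => hq.before hχ x1 ((Iq.split q2).2 (.inl hk)) (hk.2.1.trans_lt hpq.2))
        (fun k hk => hp''.before hχ y1 hk (hk.2.1.trans_lt h3))
        (fun k hk => hq''.before hχ y1 hk (hk.2.1.trans_lt h4))
      have hM : p - 2 - a + (q - 2 - c) ≤ b - a + (e - c) := by
        have := Ip.2.1
        have := Iq.2.1
        omega
      have hM' : b - p + (e - q) ≤ b - a + (e - c) := by omega
      refine (wp_cc2 H hs (by decide) (by decide) (by decide) (by decide) (by decide) r40 r51 r44 r42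
        r52 D1 hM (by decide) (by decide) (by decide) (by decide) (by decide)
        r47 r41 r46 r49 r43 D2 hM' r58).mono ?_
      exact fun t s' h => ⟨h.1, hO s' h.2.1, (by omega : _ ≤ t + 4).trans (time h.2.2)⟩
    · rw [if_neg h4]
      obtain ⟨c1, c2, c3, c4, c5⟩ := change_ge' hχ x1 cq Iq hq' (by omega)
      obtain ⟨D1, D2, hO⟩ := conflict hχ d1 d3 d5 (by omega) Ip Ip2 (by omega) c3 c4 (by omega)
        (show x + (1 - x) = 1 by omega) cp2 cp c2 c1
      refine (wp_cc2 H hs (by decide) (by decide) (by decide) (by decide) (by decide) r51 r51 r44 r50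
        r50 D1 (M := b - a + (e - c)) (by omega) (by decide) (by decide) (by decide) (by decide)
        (by decide) r47 r47 r46 r54 r54 D2 (by omega) r58).mono ?_
      exact fun t s' h => ⟨h.1, hO s' h.2.1, (by omega : _ ≤ t + 4).trans (time h.2.2)⟩
  · rw [if_neg h3]
    obtain ⟨c1, c2, c3, c4, c5⟩ := change_ge' hχ x1 cp Ip hp' (by omega)
    obtain ⟨D1, D2, hO⟩ := conflict hχ d1 d3 d5 (by omega) c3 c4 (by omega) Iq Iq2 (by omega)
      (show 1 - x + x = 1 by omega) c2 c1 cq2 cq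
    refine (wp_cc2 H hs (by decide) (by decide) (by decide) (by decide) (by decide) r53 r53 r46 r49
      r49 D1 (M := b - a + (e - c)) (by omega) (by decide) (by decide) (by decide) (by decide)
      (by decide) r48 r48 r44 r52 r52 D2 (by omega) r58).mono ?_
    exact fun t s' h => ⟨h.1, hO s' h.2.1, (by omega : _ ≤ t + 4).trans (time h.2.2)⟩

/-- Finds the second changes of characters and searches a triple. -/
def changeSearch (N : Program) : Program :=
  blk [callNext N 44 47 41 2, mov 48 84, callNext N 45 49 43 2, mov 50 84, .assign 57 (.const 2),
    .assign 51 (.sub 47 57), .assign 52 (.sub 49 57), .assign 53 (.sub 48 57),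
    .assign 54 (.sub 50 57), pairSearch N]

set_option maxHeartbeats 1600000 in
theorem wp_changeSearch {s₀ : State} {w n : ℕ} {χ : ℕ → ℕ} {N : Program} {A B : ℕ}
    (H : NextSpec s₀ w n χ N A B) {s : State} (hs : Agree 0 s₀ s) {a b c e x z p q : ℕ}
    (D : RangeData n a b c e) (hr : FirstRegs s a b c e x z p q)
    (F : FirstData χ a b c e x z p q) :
    Wp w (changeSearch N) s fun t s' => Agree 40 s s' ∧
      Outcome χ (fun i j => In a b i ∧ In c e j) s' ∧
      t ≤ 150 * A + B * (4 * (b - a + (e - c)) + 16) := by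
  have hw := H.width
  have hA := H.pos
  obtain ⟨d1, d2, d3, d4, d5, d6, d7, d8⟩ := id D
  obtain ⟨f1, f2, f3, f4, f5, f6⟩ := id F
  have x1 : x ≤ 1 := f1 ▸ H.bool a
  have z1 : z ≤ 1 := f2 ▸ H.bool c
  have g3 := f3.1
  have g4 := f4.1
  simp only [changeSearch, wp_cons, wp_nil]
  have e41 := hr.r41
  have e44 := hr.r44
  have e47 := hr.r47
  refine (wp_callNext H hs (by omega) (by omega) (by omega)
    (by omega) (by omega) (by omega) (by omega) (.inr rfl)).mono ?_
  rintro t s1 ⟨ag, hp', hm, μ, ht, hμ⟩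
  rw [e41, e44, e47] at hp'
  rw [e47] at hm
  rw [e41, e47] at hμ
  generalize hp1 : s1.reg 84 = p' at hp' hm hμ
  have hr1 := (hr.agree (ag.mono (by omega))).set (r := 48) (v := p') (by omega)
  have ag1 : Agree 40 s (s1.set 48 p') := (ag.mono (by omega)).set (by omega) (by omega)
  have r48 : (s1.set 48 p').reg 48 = p' := by simp [State.set_reg]
  simp (disch := omega) only [wp_mov, hp1]
  refine ⟨by omega, ?_⟩
  clear e41 e44 e47 ag
  generalize s1.set 48 p' = s2 at hr1 ag1 r48 ⊢
  have e43 := hr1.r43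
  have e45 := hr1.r45
  have e49 := hr1.r49
  refine (wp_callNext H (hs.trans (ag1.mono (Nat.zero_le _))) (by omega) (by omega) (by omega)
    (by omega) (by omega) (by omega) (by omega) (.inr rfl)).mono ?_
  rintro t' s3 ⟨ag, hq', hm', μ', ht', hμ'⟩
  rw [e43, e45, e49] at hq'
  rw [e49] at hm'
  rw [e43, e49] at hμ'
  generalize hq1 : s3.reg 84 = q' at hq' hm' hμ'
  have hr3 := hr1.agree (ag.mono (by omega))
  have ag3 : Agree 40 s s3 := ag1.trans (ag.mono (by omega))
  have r48' : s3.reg 48 = p' := by rw [ag.reg (by omega), r48]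
  clear e43 e45 e49 ag hr1 r48
  simp (disch := omega) only [wp_assign, Expr.eval, State.set_reg, Nat.reduceEqDiff,
    if_true, if_false, hr3.r47, hr3.r49, r48']
  refine ⟨by omega, by omega, by omega, by omega, by omega, by omega, ?_⟩
  have ag4 : Agree 40 s ((((((s3.set 50 q').set 57 2).set 51 (p - 2)).set 52 (q - 2)).set 53
      (p' - 2)).set 54 (q' - 2)) := by
    repeat refine Agree.set ?_ (by omega) (by omega)
    exact ag3
  refine (wp_pairSearch H (hs.trans (ag4.mono (Nat.zero_le _))) D
    (((((((hr3.set (by omega)).set (by omega)).set (by omega)).set (by omega)).set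
      (by omega)).set (by omega))) F hp' hq' (by simp [State.set_reg, r48'])
      (by simp [State.set_reg]) (by simp [State.set_reg]) (by simp [State.set_reg])
      (by simp [State.set_reg]) (by simp [State.set_reg])).mono ?_
  rintro t'' s5 ⟨ag5, hO, ht''⟩
  refine ⟨ag4.trans (ag5.mono (by omega)), hO, ?_⟩
  have hB : B * (μ + μ' + (2 * (b - a + (e - c)) + 8)) ≤ B * (4 * (b - a + (e - c)) + 16) :=
    Nat.mul_le_mul_left _ (by omega)
  rw [Nat.mul_add B, Nat.mul_add B μ] at hB
  omega

/-! ### Two arbitrary ranges of the same parity -/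

/-- Searches a triple between two nonempty ranges of the same parity. -/
def rangeSearch (N : Program) : Program :=
  blk [charAt N 58 44 40, charAt N 58 45 42, .assign 46 (.sub 58 44), .assign 59 (.sub 58 45),
    callNext N 46 40 41 2, mov 47 84, callNext N 59 42 43 2, mov 49 84,
    .branch 41 47 (callBlock N 40 41 44 42 43)
      (.branch 43 49 (callBlock N 42 43 45 40 41) (changeSearch N))]

theorem mul_le_of_ratio {k l m r ρ : ℕ} (hl : 0 < l) (h : k * l ≤ m) (h' : m ≤ ρ * r)
    (hr : r ≤ l) : k ≤ ρ :=
  Nat.le_of_mul_le_mul_right ((h.trans h').trans (Nat.mul_le_mul_left _ hr)) hl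

theorem moves_le {μ q lim st : ℕ} (h : μ ≤ min q (lim + 2) - st) (h' : st ≤ lim) :
    μ ≤ lim - st + 2 := by
  have := h.trans (Nat.sub_le_sub_right (min_le_right _ _) _)
  omega

theorem range_time {A B m m' ρ t1 t2 t3 t4 μ μ' t : ℕ} (hA : 1 ≤ A) (h1 : t1 ≤ 12 * A + B * 2)
    (h2 : t2 ≤ 12 * A + B * 2) (h3 : t3 ≤ 9 * A + B * μ) (h4 : t4 ≤ 9 * A + B * μ')
    (hμ : μ ≤ m + 2) (hμ' : μ' ≤ m' + 2)
    (ht : t ≤ A * (60 * ρ + 240) + B * (4 * (m + m') + 16)) :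
    t1 + (t2 + (t3 + t4)) + t + 30 ≤ A * (60 * ρ + 320) + B * (6 * (m + m') + 40) := by
  have hB : B * (2 + 2 + μ + μ' + (4 * (m + m') + 16)) ≤ B * (6 * (m + m') + 40) :=
    Nat.mul_le_mul_left _ (by omega)
  rw [Nat.mul_add B, Nat.mul_add B, Nat.mul_add B, Nat.mul_add B] at hB
  have e1 : A * (60 * ρ + 320) = A * (60 * ρ + 240) + 80 * A := by ring
  omega

theorem block_time {A B m m' ρ k t : ℕ} (hk : k ≤ ρ)
    (ht : t ≤ 60 * A * (k + 4) + B * (3 * m + 3 * m' + 12)) :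
    t ≤ A * (60 * ρ + 240) + B * (4 * (m + m') + 16) := by
  have e1 : A * (60 * k + 240) ≤ A * (60 * ρ + 240) := Nat.mul_le_mul_left _ (by omega)
  have e2 : 60 * A * (k + 4) = A * (60 * k + 240) := by ring
  have e3 : B * (3 * m + 3 * m' + 12) ≤ B * (4 * (m + m') + 16) :=
    Nat.mul_le_mul_left _ (by omega)
  omega

-- A range without a first change is constant and serves as the block; since `Across` is symmetric,
-- the right range can play this role too. The two ratio hypotheses bound the number of jumps by ρ
-- in either case. If both ranges change, no ratio is needed.
set_option maxHeartbeats 1600000 in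
theorem wp_rangeSearch {s₀ : State} {w n : ℕ} {χ : ℕ → ℕ} {N : Program} {A B : ℕ}
    (H : NextSpec s₀ w n χ N A B) {s : State} (hs : Agree 0 s₀ s) {a b c e ρ : ℕ}
    (h40 : s.reg 40 = a) (h41 : s.reg 41 = b) (h42 : s.reg 42 = c) (h43 : s.reg 43 = e)
    (h58 : s.reg 58 = 1) (D : RangeData n a b c e) (hρ : e - c ≤ ρ * (b - a + 2))
    (hρ' : b - a ≤ ρ * (e - c + 2)) :
    Wp w (rangeSearch N) s fun t s' => Agree 40 s s' ∧
      Outcome χ (fun i j => In a b i ∧ In c e j) s' ∧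
      t ≤ A * (60 * ρ + 320) + B * (6 * (b - a + (e - c)) + 40) := by
  have hw := H.width
  have hA := H.pos
  obtain ⟨d1, d2, d3, d4, d5, d6, d7, d8⟩ := id D
  have hbn : b ≤ n + 2 := by omega
  have hen : e ≤ n + 2 := by omega
  have hχ := H.bool
  have hχa := hχ a
  have hχc := hχ c
  simp only [rangeSearch, wp_cons, wp_nil]
  refine (wp_charAt H hs (by decide) (by decide) h58 (by omega) (by omega)).mono ?_
  rintro t1 s1' ⟨s1, ag1, rfl, ht1⟩
  rw [h40]
  have ag1' : Agree 40 s (s1.set 44 (χ a)) := (ag1.mono (by decide)).set (by decide) (by decide)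
  have r58 : (s1.set 44 (χ a)).reg 58 = 1 := by
    simp (disch := omega) [State.set_reg, ag1.reg, h58]
  have r42 : (s1.set 44 (χ a)).reg 42 = c := by
    simp (disch := omega) [State.set_reg, ag1.reg, h42]
  refine (wp_charAt H (hs.trans (ag1'.mono (Nat.zero_le _))) (by decide) (by decide) r58
    (by omega) (by omega)).mono ?_
  rintro t2 s2' ⟨s2, ag2, rfl, ht2⟩
  rw [r42]
  simp (disch := omega) only [wp_assign, Expr.eval, State.set_reg, Nat.reduceEqDiff, if_true,
    if_false, ag1.reg, ag2.reg, h58]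
  refine ⟨by omega, by omega, ?_⟩
  have ag3 : Agree 40 s (((s2.set 45 (χ c)).set 46 (1 - χ a)).set 59 (1 - χ c)) := by
    repeat refine Agree.set ?_ (by decide) (by decide)
    exact ag1'.trans (ag2.mono (by decide))
  have q40 : (((s2.set 45 (χ c)).set 46 (1 - χ a)).set 59 (1 - χ c)).reg 40 = a := by
    simp (disch := omega) [State.set_reg, ag1.reg, ag2.reg, h40]
  have q41 : (((s2.set 45 (χ c)).set 46 (1 - χ a)).set 59 (1 - χ c)).reg 41 = b := by
    simp (disch := omega) [State.set_reg, ag1.reg, ag2.reg, h41]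
  have q42 : (((s2.set 45 (χ c)).set 46 (1 - χ a)).set 59 (1 - χ c)).reg 42 = c := by
    simp (disch := omega) [State.set_reg, ag1.reg, ag2.reg, h42]
  have q43 : (((s2.set 45 (χ c)).set 46 (1 - χ a)).set 59 (1 - χ c)).reg 43 = e := by
    simp (disch := omega) [State.set_reg, ag1.reg, ag2.reg, h43]
  have q44 : (((s2.set 45 (χ c)).set 46 (1 - χ a)).set 59 (1 - χ c)).reg 44 = χ a := by
    simp (disch := omega) [State.set_reg, ag2.reg]
  have q45 : (((s2.set 45 (χ c)).set 46 (1 - χ a)).set 59 (1 - χ c)).reg 45 = χ c := by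
    simp [State.set_reg]
  have q46 : (((s2.set 45 (χ c)).set 46 (1 - χ a)).set 59 (1 - χ c)).reg 46 = 1 - χ a := by
    simp [State.set_reg]
  have q59 : (((s2.set 45 (χ c)).set 46 (1 - χ a)).set 59 (1 - χ c)).reg 59 = 1 - χ c := by
    simp [State.set_reg]
  have q58 : (((s2.set 45 (χ c)).set 46 (1 - χ a)).set 59 (1 - χ c)).reg 58 = 1 := by
    simp (disch := omega) [State.set_reg, ag1.reg, ag2.reg, h58]
  generalize (((s2.set 45 (χ c)).set 46 (1 - χ a)).set 59 (1 - χ c)) = s3 at *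
  clear h40 h41 h42 h43 h58 ag1' r58 r42 ag1 ag2
  clear! s1 s2
  refine (wp_callNext H (hs.trans (ag3.mono (Nat.zero_le _))) (by decide) (by decide) (by decide)
    (by omega) (by omega) (by omega) (by omega) (.inr rfl)).mono ?_
  rintro t3 s4 ⟨ag4, hp, hm, μ, ht3, hμ⟩
  rw [q40, q41, q46] at hp
  rw [q40] at hm
  rw [q40, q41] at hμ
  generalize hp0 : s4.reg 84 = p at *
  have hp1 := hp.1
  have hμ1 : μ ≤ b - a + 2 :=
    moves_le hμ ‹_›
  have hm1 : p ≤ n + 2 := hm.trans (max_le (d2.trans hbn) le_rfl)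
  clear hμ hm
  rw [wp_mov (by decide), hp0]
  refine ⟨by omega, ?_⟩
  have ag5 : Agree 47 s3 (s4.set 47 p) := (ag4.mono (by decide)).set (by decide) (by decide)
  have v47 : (s4.set 47 p).reg 47 = p := by simp [State.set_reg]
  have v58 : (s4.set 47 p).reg 58 = 1 := by simp (disch := omega) [State.set_reg, ag4.reg, q58]
  have v59 : (s4.set 47 p).reg 59 = 1 - χ c := by
    simp (disch := omega) [State.set_reg, ag4.reg, q59]
  clear ag4 q58 q59
  generalize s4.set 47 p = s5 at *
  clear hp0
  have v42 : s5.reg 42 = c := by rw [ag5.reg (by decide), q42]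
  have v43 : s5.reg 43 = e := by rw [ag5.reg (by decide), q43]
  have ag6 : Agree 40 s s5 := ag3.trans (ag5.mono (by decide))
  refine (wp_callNext H (hs.trans (ag6.mono (Nat.zero_le _))) (by decide) (by decide) (by decide)
    (by omega) (by omega) (by omega) (by omega) (.inr rfl)).mono ?_
  rintro t4 s6 ⟨ag7, hq, hm, μ', ht4, hμ⟩
  rw [v42, v43, v59] at hq
  rw [v42] at hm
  rw [v42, v43] at hμ
  generalize hq0 : s6.reg 84 = q at *
  have hq1 := hq.1
  have hμ2 : μ' ≤ e - c + 2 :=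
    moves_le hμ ‹_›
  have hm2 : q ≤ n + 2 := hm.trans (max_le (d4.trans hen) le_rfl)
  clear hμ hm
  rw [wp_mov (by decide), hq0]
  refine ⟨by omega, ?_⟩
  have ag8 : Agree 40 s (s6.set 49 q) :=
    (ag6.trans (ag7.mono (by decide))).set (by decide) (by decide)
  have F : FirstRegs (s6.set 49 q) a b c e (χ a) (χ c) p q := by
    constructor <;> simp (disch := omega) [State.set_reg, ag7.reg, ag5.reg, q40, q41, q42, q43,
      q44, q45, q46, v47, v58]
  clear ag7 ag6 v47 v42 v43 v58 v59 q40 q41 q42 q43 q44 q45 q46 ag5 ag3 hq0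
  generalize s6.set 49 q = s7 at *
  clear! s3 s5 s6
  have hs7 := hs.trans (ag8.mono (Nat.zero_le _))
  have htime := fun t ht => range_time (ρ := ρ) (t := t) hA ht1 ht2 ht3 ht4 hμ1 hμ2 ht
  have hblock := fun k t hk ht => block_time (A := A) (B := B) (m := b - a) (m' := e - c)
    (ρ := ρ) (k := k) (t := t) hk ht
  clear ht1 ht2 ht3 ht4 hμ1 hμ2
  simp only [wp_branch, F.r41, F.r43, F.r47, F.r49]
  by_cases hpb : b < p
  · rw [if_pos hpb]
    have hD : BlockData n χ a b (χ a) c e := ⟨d1, d2, by omega, by omega, by omega, d5, d6, d7,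
      .inl d3, hχ a, fun k hk => hp.before hχ (hχ a) hk (by have := hk.2.1; omega)⟩
    refine (wp_callBlock H hs7 (by decide) (by decide) (by decide) (by decide) (by decide)
      F.r40 F.r41 F.r44 F.r42 F.r43 hD).mono ?_
    rintro t s8 ⟨ag9, hO, k, hk, ht⟩
    refine ⟨ag8.trans (ag9.mono (by decide)), hO.congr ?_, ?_⟩
    · rintro i d ⟨hd, -, -⟩
      refine ⟨?_, .inl⟩
      rintro (h | ⟨⟨_, _, _⟩, _, _, _⟩)
      · exact h
      · omega
    · have := htime t (hblock k t (mul_le_of_ratio (by omega) hk hρ le_rfl) ht)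
      omega
  rw [if_neg hpb]
  by_cases hqe : e < q
  · rw [if_pos hqe]
    have hD : BlockData n χ c e (χ c) a b := ⟨by omega, d4, by omega, by omega, by omega,
      by omega, by omega, by omega, .inr d3, hχ c,
      fun k hk => hq.before hχ (hχ c) hk (by have := hk.2.1; omega)⟩
    refine (wp_callBlock H hs7 (by decide) (by decide) (by decide) (by decide) (by decide)
      F.r42 F.r43 F.r45 F.r40 F.r41 hD).mono ?_
    rintro t s8 ⟨ag9, hO, k, hk, ht⟩
    refine ⟨ag8.trans (ag9.mono (by decide)), hO.congr ?_, ?_⟩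
    · rintro i d ⟨hd, -, -⟩
      refine ⟨?_, .inr⟩
      rintro (⟨⟨_, _, _⟩, _, _, _⟩ | h)
      · omega
      · exact h
    · rw [Nat.add_comm (3 * (e - c))] at ht
      have := htime t (hblock k t (mul_le_of_ratio (by omega) hk hρ' le_rfl) ht)
      omega
  · rw [if_neg hqe]
    refine (wp_changeSearch H hs7 D F ⟨rfl, rfl, hp, hq, by omega, by omega⟩).mono ?_
    rintro t s8 ⟨ag9, hO, ht⟩
    refine ⟨ag8.trans ag9, hO, ?_⟩
    have e1 : A * (60 * ρ + 240) = 60 * (A * ρ) + 240 * A := by ring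
    have := htime t (by omega)
    omega

/-! ### Disjoint intervals, split by parity -/

/-- Searches a triple from `a, a + 2, …` to the indices of its parity in `c, …, e`, for the intervals
with the end points in registers `20, …, 23`; register `8` holds `1`. -/
def halfSearch (N : Program) : Program :=
  blk [.assign 76 (.const 0), mov 58 8, mov 40 20,
    .assign 24 (.add 20 21), .assign 25 (.half 24), .assign 25 (.add 25 25),
    .assign 24 (.sub 24 25), .assign 41 (.sub 21 24),
    .assign 24 (.add 20 22), .assign 25 (.half 24), .assign 25 (.add 25 25),
    .assign 24 (.sub 24 25), .assign 42 (.add 22 24),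
    .assign 24 (.add 20 23), .assign 25 (.half 24), .assign 25 (.add 25 25),
    .assign 24 (.sub 24 25), .assign 43 (.sub 23 24),
    .branch 41 40 .skip (.branch 43 42 .skip (rangeSearch N))]

/-- Data of a call of `halfSearch`. -/
structure HalfData (n a b c e ρ : ℕ) : Prop where
  one_le : 1 ≤ a
  le : a ≤ b + 1
  lt : b < c
  le' : c ≤ e
  e_le : e ≤ n
  ratio : a ≤ b → e - c ≤ ρ * (b + 1 - a)
  ratio' : b - a ≤ ρ * (e - c + 1)

/-- Moving the end points to the parity of a shortens an interval by at most one position at each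
end. The factor 2 in the ratio and the summand 2 absorb this loss. -/
theorem HalfData.range {n a b c e ρ : ℕ} (D : HalfData n a b c e ρ)
    (h1 : a ≤ b - (a + b) % 2) (h2 : c + (a + c) % 2 ≤ e - (a + e) % 2) :
    RangeData n a (b - (a + b) % 2) (c + (a + c) % 2) (e - (a + e) % 2) ∧
    e - (a + e) % 2 - (c + (a + c) % 2) ≤ 2 * ρ * (b - (a + b) % 2 - a + 2) ∧
    b - (a + b) % 2 - a ≤ 2 * ρ * (e - (a + e) % 2 - (c + (a + c) % 2) + 2) := by
  obtain ⟨d1, d2, d3, d4, d5, d6, d7⟩ := D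
  have d6 := d6 (h1.trans (Nat.sub_le _ _))
  refine ⟨⟨d1, h1, by omega, h2, by omega, by omega, by omega, by omega⟩, ?_, ?_⟩
  · have := Nat.mul_le_mul_left ρ (show b + 1 - a ≤ 2 * (b - (a + b) % 2 - a + 2) by omega)
    rw [show 2 * ρ * (b - (a + b) % 2 - a + 2) = ρ * (2 * (b - (a + b) % 2 - a + 2)) by ring]
    omega
  · have := Nat.mul_le_mul_left ρ
      (show e - c + 1 ≤ 2 * (e - (a + e) % 2 - (c + (a + c) % 2) + 2) by omega)
    rw [show 2 * ρ * (e - (a + e) % 2 - (c + (a + c) % 2) + 2) =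
      ρ * (2 * (e - (a + e) % 2 - (c + (a + c) % 2) + 2)) by ring]
    omega

theorem In.snap {a b k : ℕ} : In a (b - (a + b) % 2) k ↔ a ≤ k ∧ k ≤ b ∧ k % 2 = a % 2 := by
  constructor <;> rintro ⟨_, _, _⟩ <;> exact ⟨by omega, by omega, by omega⟩

theorem In.snap_both {a c e k : ℕ} (hk : k % 2 = a % 2) :
    In (c + (a + c) % 2) (e - (a + e) % 2) k ↔ c ≤ k ∧ k ≤ e := by
  constructor
  · rintro ⟨_, _, _⟩
    exact ⟨by omega, by omega⟩
  · rintro ⟨_, _⟩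
    exact ⟨by omega, by omega, by omega⟩

theorem outcome_of_empty {χ : ℕ → ℕ} {P : ℕ → ℕ → Prop} {s : State} (h : s.reg 76 = 0)
    (hP : ∀ i d, ¬ P i (i + 2 * d)) : Outcome χ P s := .inr ⟨h, fun i d _ => hP i d⟩

set_option maxHeartbeats 1600000 in
theorem wp_halfSearch {s₀ : State} {w n : ℕ} {χ : ℕ → ℕ} {N : Program} {A B : ℕ}
    (H : NextSpec s₀ w n χ N A B) {s : State} (hs : Agree 0 s₀ s) {a b c e ρ : ℕ}
    (h20 : s.reg 20 = a) (h21 : s.reg 21 = b) (h22 : s.reg 22 = c) (h23 : s.reg 23 = e)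
    (h8 : s.reg 8 = 1) (D : HalfData n a b c e ρ) :
    Wp w (halfSearch N) s fun t s' => Agree 24 s s' ∧
      Outcome χ (fun i j => (a ≤ i ∧ i ≤ b ∧ i % 2 = a % 2) ∧ c ≤ j ∧ j ≤ e) s' ∧
      t ≤ A * (120 * ρ + 350) + B * (6 * (b - a + (e - c)) + 40) := by
  have hw := H.width
  have hA := H.pos
  obtain ⟨d1, d2, d3, d4, d5, -, -⟩ := id D
  have par : ∀ x, x - (x / 2 + x / 2) = x % 2 := fun x => by omega
  simp (disch := decide) only [halfSearch, wp_cons, wp_nil, wp_assign, wp_mov, Expr.eval,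
    State.set_reg, Nat.reduceEqDiff, if_true, if_false, h20, h21, h22, h23, h8, par]
  refine ⟨by omega, by omega, by omega, by omega, by omega, by omega, by omega, by omega, by omega,
    by omega, by omega, by omega, by omega, by omega, by omega, by omega, by omega, by omega, ?_⟩
  generalize hs1 : State.set _ 43 _ = s1
  have ag : Agree 24 s s1 := by
    rw [← hs1]
    repeat refine Agree.set ?_ (by decide) (by decide)
    exact Agree.refl _ _
  have r40 : s1.reg 40 = a := by simp [← hs1, State.set_reg]
  have r41 : s1.reg 41 = b - (a + b) % 2 := by simp [← hs1, State.set_reg]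
  have r42 : s1.reg 42 = c + (a + c) % 2 := by simp [← hs1, State.set_reg]
  have r43 : s1.reg 43 = e - (a + e) % 2 := by simp [← hs1, State.set_reg]
  have r58 : s1.reg 58 = 1 := by simp [← hs1, State.set_reg]
  have r76 : s1.reg 76 = 0 := by simp [← hs1, State.set_reg]
  clear hs1 h20 h21 h22 h23 h8
  have e1 : A * (120 * ρ + 350) = 120 * (A * ρ) + 350 * A := by ring
  simp only [wp_branch, wp_skip, r40, r41, r42, r43]
  by_cases hc1 : b - (a + b) % 2 < a
  · rw [if_pos hc1]
    refine ⟨ag, outcome_of_empty r76 ?_, by omega⟩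
    rintro i d ⟨h, -⟩
    have := In.snap.2 h
    exact absurd hc1 (not_lt.2 (this.1.trans this.2.1))
  rw [if_neg hc1]
  rw [not_lt] at hc1
  by_cases hc2 : e - (a + e) % 2 < c + (a + c) % 2
  · rw [if_pos hc2]
    refine ⟨ag, outcome_of_empty r76 ?_, by omega⟩
    rintro i d ⟨h, h'⟩
    have := (In.snap_both (a := a) (k := i + 2 * d) (by rw [Nat.add_mul_mod_self_left, h.2.2])).2 h'
    exact absurd hc2 (not_lt.2 (this.1.trans this.2.1))
  rw [if_neg hc2]
  rw [not_lt] at hc2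
  obtain ⟨D', g1, g2⟩ := D.range hc1 hc2
  refine (wp_rangeSearch H (hs.trans (ag.mono (Nat.zero_le _))) r40 r41 r42 r43 r58 D' g1
    g2).mono ?_
  rintro t s2 ⟨ag2, hO, ht⟩
  refine ⟨ag.trans (ag2.mono (by decide)), hO.congr ?_, ?_⟩
  · rintro i d -
    rw [In.snap]
    refine and_congr_right fun h => ?_
    rw [In.snap_both (by rw [Nat.add_mul_mod_self_left, h.2.2])]
  · have hB : B * (6 * (b - (a + b) % 2 - a + (e - (a + e) % 2 - (c + (a + c) % 2))) + 40) ≤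
        B * (6 * (b - a + (e - c)) + 40) := by
      have f1 : b - (a + b) % 2 - a ≤ b - a := Nat.sub_le_sub_right (Nat.sub_le _ _) _
      have f2 : e - (a + e) % 2 - (c + (a + c) % 2) ≤ e - c :=
        tsub_le_tsub (Nat.sub_le _ _) (Nat.le_add_right _ _)
      exact Nat.mul_le_mul_left _
        (Nat.add_le_add_right (Nat.mul_le_mul_left _ (Nat.add_le_add f1 f2)) _)
    have e2 : A * (60 * (2 * ρ) + 320) = 120 * (A * ρ) + 320 * A := by ring
    have := ht.trans (Nat.add_le_add_left hB _)
    linarith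

/-- Searches a triple between two disjoint intervals with end points in registers `20, …, 23`. -/
def disjSearch (N : Program) : Program :=
  orElse 8 (halfSearch N) (blk [.assign 20 (.add 20 8), halfSearch N])

/-- Data of a call of `disjSearch`. -/
structure DisjData (n a b c e ρ : ℕ) : Prop where
  one_le : 1 ≤ a
  le : a ≤ b
  lt : b < c
  le' : c ≤ e
  e_le : e ≤ n
  ratio : e - c ≤ ρ * (b - a + 1)
  ratio' : b - a ≤ ρ * (e - c + 1)
  pos : 1 ≤ ρ

theorem wp_disjSearch {s₀ : State} {w n : ℕ} {χ : ℕ → ℕ} {N : Program} {A B : ℕ}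
    (H : NextSpec s₀ w n χ N A B) {s : State} (hs : Agree 0 s₀ s) {a b c e ρ : ℕ}
    (h20 : s.reg 20 = a) (h21 : s.reg 21 = b) (h22 : s.reg 22 = c) (h23 : s.reg 23 = e)
    (h8 : s.reg 8 = 1) (D : DisjData n a b c e ρ) :
    Wp w (disjSearch N) s fun t s' => Agree 20 s s' ∧
      Outcome χ (fun i j => (a ≤ i ∧ i ≤ b) ∧ c ≤ j ∧ j ≤ e) s' ∧
      t ≤ A * (360 * ρ + 720) + B * (12 * (b - a + (e - c)) + 80) := by
  have hw := H.width
  obtain ⟨d1, d2, d3, d4, d5, d6, d7, d8⟩ := D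
  have D1 : HalfData n a b c e ρ := ⟨d1, by omega, d3, d4, d5,
    fun _ => by rwa [show b + 1 - a = b - a + 1 by omega], d7⟩
  -- Dropping the position a at most halves an interval of two or more positions, hence the factor
  -- 2. A single position leaves the empty interval, which `HalfData` admits.
  have D2 : HalfData n (a + 1) b c e (2 * ρ) := by
    refine ⟨by omega, by omega, d3, d4, d5, ?_, ?_⟩
    · intro h
      have := Nat.mul_le_mul_left ρ (show b - a + 1 ≤ 2 * (b + 1 - (a + 1)) by omega)
      rw [show 2 * ρ * (b + 1 - (a + 1)) = ρ * (2 * (b + 1 - (a + 1))) by ring]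
      omega
    · have : ρ * (e - c + 1) ≤ 2 * ρ * (e - c + 1) := Nat.mul_le_mul_right _ (by omega)
      omega
  refine (wp_orElse (lo := 20) (lo' := 24) (by decide) (by decide) h8
    (wp_halfSearch H hs h20 h21 h22 h23 h8 D1)
    (P' := fun i j => (a + 1 ≤ i ∧ i ≤ b ∧ i % 2 = (a + 1) % 2) ∧ c ≤ j ∧ j ≤ e)
    (T' := A * (120 * (2 * ρ) + 350) + B * (6 * (b - (a + 1) + (e - c)) + 40) + 3)
    fun s1 ag _ => ?_).mono ?_
  · simp (disch := decide) only [wp_cons, wp_nil, wp_assign, Expr.eval, ag.reg, h20, h8]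
    refine ⟨by omega, ?_⟩
    have ag' : Agree 20 s (s1.set 20 (a + 1)) := (ag.mono (by decide)).set (by decide) (by decide)
    refine (wp_halfSearch H (hs.trans (ag'.mono (Nat.zero_le _))) (a := a + 1)
      (by simp [State.set_reg]) (by simp (disch := decide) [State.set_reg, ag.reg, h21])
      (by simp (disch := decide) [State.set_reg, ag.reg, h22])
      (by simp (disch := decide) [State.set_reg, ag.reg, h23])
      (by simp (disch := decide) [State.set_reg, ag.reg, h8]) D2).mono ?_
    rintro t s' ⟨ag2, hO, ht⟩
    exact ⟨(Agree.set (Agree.refl 20 s1) (by decide) (by decide)).trans (ag2.mono (by decide)), hO,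
      by linarith⟩
  · rintro t s' ⟨ag, hO, ht⟩
    refine ⟨ag, hO.congr ?_, ?_⟩
    · rintro i d -
      constructor
      · rintro (⟨⟨_, _, _⟩, _, _⟩ | ⟨⟨_, _, _⟩, _, _⟩) <;>
          exact ⟨⟨by omega, by omega⟩, by omega, by omega⟩
      · rintro ⟨⟨_, _⟩, _, _⟩
        by_cases hp : i % 2 = a % 2
        · exact .inl ⟨⟨by omega, by omega, by omega⟩, by omega, by omega⟩
        · exact .inr ⟨⟨by omega, by omega, by omega⟩, by omega, by omega⟩
    · have hA := H.pos
      have e1 : A * (360 * ρ + 720) =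
        A * (120 * ρ + 350) + A * (120 * (2 * ρ) + 350) + 20 * A := by ring
      clear d6 d7
      have hB : B * (6 * (b - a + (e - c)) + 40 + (6 * (b - (a + 1) + (e - c)) + 40)) ≤
        B * (12 * (b - a + (e - c)) + 80) := Nat.mul_le_mul_left _ (by omega)
      rw [Nat.mul_add B] at hB
      linarith

/-! ### The overlap of the two intervals -/

/-- Among nine consecutive positions of a binary string there is a triple. -/
theorem exists_triple {χ : ℕ → ℕ} (hχ : ∀ i, χ i ≤ 1) (o : ℕ) :
    ∃ i d, Triple χ i d ∧ o ≤ i ∧ i + 2 * d ≤ o + 8 := by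
  -- The disjuncts are the sixteen three-term progressions in {0, …, 8}; all 512 strings are
  -- checked. This is the upper bound in the van der Waerden number W(2; 3) = 9.
  have key : ∀ b0 b1 b2 b3 b4 b5 b6 b7 b8 : Bool,
      (b0 == b1 && b0 == b2 || b1 == b2 && b1 == b3 || b2 == b3 && b2 == b4 ||
      b3 == b4 && b3 == b5 || b4 == b5 && b4 == b6 || b5 == b6 && b5 == b7 ||
      b6 == b7 && b6 == b8 || b0 == b2 && b0 == b4 || b1 == b3 && b1 == b5 ||
      b2 == b4 && b2 == b6 || b3 == b5 && b3 == b7 || b4 == b6 && b4 == b8 ||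
      b0 == b3 && b0 == b6 || b1 == b4 && b1 == b7 || b2 == b5 && b2 == b8 ||
      b0 == b4 && b0 == b8) = true := by decide
  by_contra! hcon
  have h2 : ∀ i d, 0 < d → o ≤ i → i + 2 * d ≤ o + 8 →
      ((χ i == 1) == (χ (i + d) == 1) && (χ i == 1) == (χ (i + 2 * d) == 1)) = false := by
    intro i d hd h1 h2
    by_contra hne
    have := hcon i d
    simp only [Bool.not_eq_false, Bool.and_eq_true, beq_iff_eq] at hne
    have a0 := hχ i
    have a1 := hχ (i + d)
    have a2 := hχ (i + 2 * d)
    have e1 : χ (i + d) = χ i := by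
      have := hne.1
      rw [Bool.eq_iff_iff] at this
      simp only [beq_iff_eq] at this
      omega
    have e2 : χ (i + 2 * d) = χ i := by
      have := hne.2
      rw [Bool.eq_iff_iff] at this
      simp only [beq_iff_eq] at this
      omega
    have := hcon i d ⟨hd, e1, e2⟩ h1
    omega
  have k := key (χ o == 1) (χ (o + 1) == 1) (χ (o + 2) == 1) (χ (o + 3) == 1) (χ (o + 4) == 1)
    (χ (o + 5) == 1) (χ (o + 6) == 1) (χ (o + 7) == 1) (χ (o + 8) == 1)
  have l : ∀ i d, 0 < d → i + 2 * d ≤ 8 →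
      ((χ (o + i) == 1) == (χ (o + (i + d)) == 1) && (χ (o + i) == 1) == (χ (o + (i + 2 * d)) == 1))
        = false := fun i d hd hi => by
    have := h2 (o + i) d hd (by omega) (by omega)
    simpa only [Nat.add_assoc] using this
  have l0 := l 0
  simp only [Nat.add_zero, Nat.zero_add] at l0
  have a1 := l0 1 (by decide) (by decide)
  have a2 := l0 2 (by decide) (by decide)
  have a3 := l0 3 (by decide) (by decide)
  have a4 := l0 4 (by decide) (by decide)
  have b1 := l 1 1 (by decide) (by decide)
  have b2 := l 1 2 (by decide) (by decide)
  have b3 := l 1 3 (by decide) (by decide)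
  have c1 := l 2 1 (by decide) (by decide)
  have c2 := l 2 2 (by decide) (by decide)
  have c3 := l 2 3 (by decide) (by decide)
  have d1 := l 3 1 (by decide) (by decide)
  have d2 := l 3 2 (by decide) (by decide)
  have e1 := l 4 1 (by decide) (by decide)
  have e2 := l 4 2 (by decide) (by decide)
  have f1 := l 5 1 (by decide) (by decide)
  have g1 := l 6 1 (by decide) (by decide)
  simp only [Nat.reduceAdd, Nat.reduceMul] at a1 a2 a3 a4 b1 b2 b3 c1 c2 c3 d1 d2 e1 e2 f1 g1
  rw [a1, a2, a3, a4, b1, b2, b3, c1, c2, c3, d1, d2, e1, e2, f1, g1] at k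
  exact absurd k (by decide)

/-- The registers during the search in the intersection of the intervals. -/
structure MainRegs (s : State) (a b c e : ℕ) : Prop where
  r4 : s.reg 4 = a
  r5 : s.reg 5 = b
  r6 : s.reg 6 = c
  r7 : s.reg 7 = e
  r8 : s.reg 8 = 1

theorem MainRegs.agree {s s' : State} {a b c e : ℕ} (h : MainRegs s a b c e)
    (ha : Agree 10 s s') : MainRegs s' a b c e := by
  constructor <;> rw [ha.reg (by decide)]
  exacts [h.r4, h.r5, h.r6, h.r7, h.r8]

theorem MainRegs.set {s : State} {a b c e : ℕ} (h : MainRegs s a b c e) {r v : ℕ}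
    (hr : 8 < r) : MainRegs (s.set r v) a b c e := by
  constructor <;> rw [State.set_reg_of_ne _ _ (by omega)]
  exacts [h.r4, h.r5, h.r6, h.r7, h.r8]

/-- Searches a triple that starts at the position in register `14` and ends at the position in
register `15` or before. -/
def overlapBody (N : Program) : Program :=
  blk [charAt N 8 17 14, .assign 16 (.const 2), .assign 16 (.add 14 16),
    callBlock N 14 14 17 16 15,
    .branch 76 8 (.assign 14 (.add 14 8)) (.assign 15 (.const 0))]

/-- The invariant of the search in the intersection of the intervals. -/
def OverlapInv (χ : ℕ → ℕ) (T o h a b c e : ℕ) (sI s : State) (v : ℕ) : Prop :=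
  Agree 10 sI s ∧ MainRegs s a b c e ∧
    ((s.reg 14 = o ∨ o < s.reg 14) ∧ s.reg 15 = h ∧ s.reg 76 = 0 ∧
      (∀ i d, Triple χ i d → o ≤ i → i < s.reg 14 → h < i + 2 * d) ∧ (h - s.reg 14) * T ≤ v ∨
    s.reg 15 = 0 ∧ s.reg 76 = 1 ∧ Outcome χ (fun i j => o ≤ i ∧ j ≤ h) s)

-- The start i alone is a constant block of one position, so `blockSearch` applies to it and the
-- possible ends i + 2, i + 4, … up to h. At most eight such rounds of constant cost are needed.
set_option maxHeartbeats 800000 in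
theorem wp_overlapBody {s₀ : State} {w n : ℕ} {χ : ℕ → ℕ} {N : Program} {A B : ℕ}
    (H : NextSpec s₀ w n χ N A B) {sI : State} (hs : Agree 0 s₀ sI) {o h a b c e : ℕ}
    (ho : 1 ≤ o) (hh : h ≤ o + 8) (hn : h ≤ n) (s : State) (v : ℕ)
    (hI : OverlapInv χ (480 * A + B * 40) o h a b c e sI s v) (hlt : s.reg 14 < s.reg 15) :
    Wp w (overlapBody N) s fun t s' =>
      ∃ v', OverlapInv χ (480 * A + B * 40) o h a b c e sI s' v' ∧ t + 1 + v' ≤ v := by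
  have hw := H.width
  have hA := H.pos
  obtain ⟨ag, hr, hI⟩ := hI
  obtain ⟨h14, h15, h76, old, hv⟩ := hI.resolve_right (by omega)
  generalize hi : s.reg 14 = i at *
  have hoi : o ≤ i := by omega
  have hih : i < h := by omega
  clear hI h14
  simp only [overlapBody, wp_cons, wp_nil]
  refine (wp_charAt H (hs.trans (ag.mono (Nat.zero_le _))) (by decide) (by decide) hr.r8
    (by omega) (by omega)).mono ?_
  rintro t1 s1' ⟨s1, ag1, rfl, ht1⟩
  have hr1 : MainRegs s1 a b c e := hr.agree (ag1.mono (by decide))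
  rw [hi]
  simp (disch := decide) only [wp_assign, Expr.eval, State.set_reg, Nat.reduceEqDiff, if_true,
    if_false, ag1.reg, hi]
  refine ⟨by omega, by omega, ?_⟩
  have ag2 : Agree 10 sI (((s1.set 17 (χ i)).set 16 2).set 16 (i + 2)) := by
    repeat refine Agree.set ?_ (by decide) (by decide)
    exact ag.trans (ag1.mono (by decide))
  have hr2 : MainRegs (((s1.set 17 (χ i)).set 16 2).set 16 (i + 2)) a b c e :=
    ((hr1.set (by decide)).set (by decide)).set (by decide)
  have r14 : (((s1.set 17 (χ i)).set 16 2).set 16 (i + 2)).reg 14 = i := by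
    simp (disch := decide) [State.set_reg, ag1.reg, hi]
  have r15 : (((s1.set 17 (χ i)).set 16 2).set 16 (i + 2)).reg 15 = h := by
    simp (disch := decide) [State.set_reg, ag1.reg, h15]
  have r16 : (((s1.set 17 (χ i)).set 16 2).set 16 (i + 2)).reg 16 = i + 2 := by
    simp [State.set_reg]
  have r17 : (((s1.set 17 (χ i)).set 16 2).set 16 (i + 2)).reg 17 = χ i := by
    simp [State.set_reg]
  generalize (((s1.set 17 (χ i)).set 16 2).set 16 (i + 2)) = s2 at *
  have self : ∀ k, In i i k → k = i := fun k hk => le_antisymm hk.2.1 hk.1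
  -- The range of ends is empty if i + 1 = h; `BlockData` allows this.
  have hD : BlockData n χ i i (χ i) (i + 2) h := ⟨by omega, le_rfl, by omega, by omega, by omega,
    hn, rfl, by omega, .inl (by omega), H.bool i, fun k hk => by rw [self k hk]⟩
  refine (wp_callBlock H (hs.trans (ag2.mono (Nat.zero_le _))) (by decide) (by decide) (by decide)
    (by decide) (by decide) r14 r14 r17 r16 r15 hD).mono ?_
  rintro t2 s3 ⟨ag3, hO, k, hk, ht2⟩
  have ag4 : Agree 10 sI s3 := ag2.trans (ag3.mono (by decide))
  have hr3 := hr2.agree (ag3.mono (by decide))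
  have q14 : s3.reg 14 = i := by rw [ag3.reg (by decide), r14]
  have q15 : s3.reg 15 = h := by rw [ag3.reg (by decide), r15]
  have e1 : (h - i) * (480 * A + B * 40) =
      (h - (i + 1)) * (480 * A + B * 40) + (480 * A + B * 40) := by
    rw [show h - i = h - (i + 1) + 1 by omega, Nat.succ_mul]
  -- A block of one position has jumps of length 2, and i + 2, …, h spans at most 6.
  have hk3 : k ≤ 3 := by
    rw [Nat.sub_self] at hk
    omega
  have ht2' : t2 ≤ 420 * A + B * 30 := by
    have f1 : B * (3 * (i - i) + 3 * (h - (i + 2)) + 12) ≤ B * 30 :=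
      Nat.mul_le_mul_left _ (by omega)
    have f2 : 60 * A * (k + 4) ≤ 60 * A * 7 := Nat.mul_le_mul_left _ (by omega)
    omega
  clear ht2 hk
  simp only [wp_branch, wp_assign, Expr.eval, hr3.r8, q14]
  by_cases hc : s3.reg 76 < 1
  · rw [if_pos hc]
    refine ⟨by omega, (h - (i + 1)) * (480 * A + B * 40), ⟨ag4.set (by decide) (by decide),
      hr3.set (by decide), .inl ?_⟩, by omega⟩
    simp only [State.set_reg, Nat.reduceEqDiff, if_true, if_false]
    refine ⟨by omega, q15, by omega, ?_, le_rfl⟩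
    intro i' d ht h1 h2
    rcases (show i' < i ∨ i' = i by omega) with h3 | rfl
    · exact old i' d ht h1 h3
    · rcases hO with ⟨h4, _⟩ | ⟨_, h4⟩
      · omega
      · by_contra h5
        have := ht.1
        exact h4 i' d ht (.inl ⟨⟨le_rfl, le_rfl, rfl⟩, by omega, by omega, by omega⟩)
  · rw [if_neg hc]
    refine ⟨by omega, 0, ⟨ag4.set (by decide) (by decide), hr3.set (by decide), .inr ?_⟩,
      by omega⟩
    rcases hO with ⟨h1, h2, h3⟩ | ⟨h1, _⟩
    · simp only [Outcome, State.set_reg, Nat.reduceEqDiff, if_true, if_false]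
      refine ⟨trivial, h1, .inl ⟨h1, h2, ?_⟩⟩
      rcases h3 with ⟨⟨_, _, _⟩, _, _, _⟩ | ⟨⟨_, _, _⟩, _, _, _⟩
      · exact ⟨by omega, by omega⟩
      · exact ⟨by omega, by omega⟩
    · omega

theorem wp_overlap {s₀ : State} {w n : ℕ} {χ : ℕ → ℕ} {N : Program} {A B : ℕ}
    (H : NextSpec s₀ w n χ N A B) {s : State} (hs : Agree 0 s₀ s) {o h a b c e : ℕ}
    (ho : 1 ≤ o) (hh : h ≤ o + 8) (hn : h ≤ n) (hr : MainRegs s a b c e)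
    (h14 : s.reg 14 = o) (h15 : s.reg 15 = h) :
    Wp w (blk [.assign 76 (.const 0), .loop 14 15 (overlapBody N)]) s fun t s' =>
      Agree 10 s s' ∧ Outcome χ (fun i j => o ≤ i ∧ j ≤ h) s' ∧
        t ≤ 3850 * A + B * 320 := by
  have hA := H.pos
  simp only [wp_cons, wp_nil, wp_assign, Expr.eval]
  refine ⟨by positivity, ?_⟩
  have hI : OverlapInv χ (480 * A + B * 40) o h a b c e s (s.set 76 0)
      (8 * (480 * A + B * 40)) := by
    refine ⟨(Agree.refl _ _).set (by decide) (by decide), hr.set (by decide), .inl ?_⟩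
    simp only [State.set_reg, Nat.reduceEqDiff, if_true, if_false, h14, h15]
    refine ⟨.inl trivial, trivial, trivial, ?_, Nat.mul_le_mul_right _ (by omega)⟩
    intros
    omega
  refine (wp_loop _ (fun s' v => wp_overlapBody H hs ho hh hn s' v) hI).mono ?_
  rintro t s' ⟨ht, ⟨v, ag, hr', hI'⟩, hc⟩
  refine ⟨ag, ?_, by omega⟩
  rcases hI' with ⟨h1, h2, h3, h4, -⟩ | ⟨-, -, h1⟩
  · refine .inr ⟨h3, ?_⟩
    rintro i d ht ⟨hi, hd⟩
    have := ht.1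
    have := h4 i d ht hi (by omega)
    omega
  · exact h1

/-! ### The parts outside the overlap -/

/-- Searches a triple from the part of the first interval before the second one. -/
def leftSearch (N : Program) : Program :=
  .branch 4 6
    (blk [mov 20 4, mov 22 6, mov 23 7, .assign 21 (.sub 6 8), .branch 5 21 (mov 21 5) .skip,
      disjSearch N])
    (.assign 76 (.const 0))

/-- Searches a triple to the part of the second interval after the first one. -/
def rightSearch (N : Program) : Program :=
  .branch 5 7
    (blk [mov 20 4, mov 21 5, mov 23 7, .assign 22 (.add 5 8), .branch 22 6 (mov 22 6) .skip,
      disjSearch N])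
    (.assign 76 (.const 0))

/-- Data of the main program: the intervals `{a, …, b}` and `{c, …, e}`. -/
structure MainData (n a b c e ρ : ℕ) : Prop where
  one_le : 1 ≤ a
  le : a ≤ b
  le_n : b ≤ n
  one_le' : 1 ≤ c
  le' : c ≤ e
  le_n' : e ≤ n
  ratio : e - c + 1 ≤ ρ * (b - a + 1)
  ratio' : b - a + 1 ≤ ρ * (e - c + 1)

theorem MainData.pos {n a b c e ρ : ℕ} (D : MainData n a b c e ρ) : 1 ≤ ρ := by
  by_contra h
  have h0 : ρ = 0 := by omega
  have := D.ratio
  rw [h0, Nat.zero_mul] at this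
  omega

/-- The hypothesis `hO` says that the overlap has at most eight positions. If b ≤ e, cutting off the
overlap removes at most eight positions from the first interval and leaves at least one, so its
length shrinks by a factor of at most nine. If e ≤ b, the second interval lies inside the overlap
and itself has at most eight positions. -/
theorem MainData.left {n a b c e ρ : ℕ} (D : MainData n a b c e ρ)
    (hO : min b e < max a c + 8) (hac : a < c) : DisjData n a (min b (c - 1)) c e (9 * ρ) := by
  have hρ := D.pos
  obtain ⟨d1, d2, d3, d4, d5, d6, d7, d8⟩ := D
  have hb : b = b - a + a := by omega
  have hm : min b (c - 1) ≤ b := min_le_left _ _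
  have hm' : min b (c - 1) ≤ c - 1 := min_le_right _ _
  have hm1 : a ≤ min b (c - 1) := le_min d2 (by omega)
  refine ⟨d1, hm1, by omega, d5, d6, ?_, ?_, by omega⟩
  · rw [Nat.mul_assoc, Nat.mul_left_comm]
    rcases le_total b e with hbe | hbe
    · have := Nat.mul_le_mul_left ρ
        (show b - a + 1 ≤ 9 * (min b (c - 1) - a + 1) by
          rw [min_eq_left hbe, max_eq_right hac.le] at hO
          omega)
      omega
    · have := Nat.mul_le_mul hρ
        (show e - c + 1 ≤ 9 * (min b (c - 1) - a + 1) by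
          rw [min_eq_right hbe, max_eq_right hac.le] at hO
          omega)
      omega
  · have : ρ * (e - c + 1) ≤ 9 * ρ * (e - c + 1) := Nat.mul_le_mul_right _ (by omega)
    omega

/-- The mirror image of `MainData.left`: the second interval loses at most eight positions, or the
first one lies inside the overlap and is that short. -/
theorem MainData.right {n a b c e ρ : ℕ} (D : MainData n a b c e ρ)
    (hO : min b e < max a c + 8) (hbe : b < e) : DisjData n a b (max c (b + 1)) e (9 * ρ) := by
  have hρ := D.pos
  obtain ⟨d1, d2, d3, d4, d5, d6, d7, d8⟩ := D
  have hm : c ≤ max c (b + 1) := le_max_left _ _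
  have hm' : b + 1 ≤ max c (b + 1) := le_max_right _ _
  have hm1 : max c (b + 1) ≤ e := max_le d5 hbe
  rw [min_eq_left hbe.le] at hO
  refine ⟨d1, d2, by omega, hm1, d6, ?_, ?_, by omega⟩
  · have : ρ * (b - a + 1) ≤ 9 * ρ * (b - a + 1) := Nat.mul_le_mul_right _ (by omega)
    omega
  · rw [Nat.mul_assoc, Nat.mul_left_comm]
    rcases le_total a c with hac | hac
    · have := Nat.mul_le_mul_left ρ
        (show e - c + 1 ≤ 9 * (e - max c (b + 1) + 1) by
          rw [max_eq_right hac] at hO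
          omega)
      omega
    · have := Nat.mul_le_mul hρ
        (show b - a + 1 ≤ 9 * (e - max c (b + 1) + 1) by
          rw [max_eq_left hac] at hO
          omega)
      omega

theorem disj_time {A B ρ m M t u : ℕ} (hm : m ≤ M)
    (ht : t ≤ A * (360 * (9 * ρ) + 720) + B * (12 * m + 80)) (hA : 1 ≤ A) (hu : u ≤ 20) :
    t + u ≤ A * (3240 * ρ + 740) + B * (12 * M + 80) := by
  have hB : B * (12 * m + 80) ≤ B * (12 * M + 80) := Nat.mul_le_mul_left _ (by omega)
  have e1 : A * (3240 * ρ + 740) = A * (360 * (9 * ρ) + 720) + 20 * A := by ring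
  linarith

theorem wp_leftSearch {s₀ : State} {w n : ℕ} {χ : ℕ → ℕ} {N : Program} {A B : ℕ}
    (H : NextSpec s₀ w n χ N A B) {s : State} (hs : Agree 0 s₀ s) {a b c e ρ : ℕ}
    (hr : MainRegs s a b c e) (D : MainData n a b c e ρ) (hO : min b e < max a c + 8) :
    Wp w (leftSearch N) s fun t s' => Agree 10 s s' ∧
      Outcome χ (fun i j => (a ≤ i ∧ i ≤ b ∧ i < c) ∧ c ≤ j ∧ j ≤ e) s' ∧
      t ≤ A * (3240 * ρ + 740) + B * (12 * (b - a + (e - c)) + 80) := by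
  have hw := H.width
  have hA := H.pos
  obtain ⟨d1, d2, d3, d4, d5, d6, -, -⟩ := id D
  rw [leftSearch, wp_branch, hr.r4, hr.r6]
  by_cases hac : a < c
  · rw [if_pos hac]
    have D' := D.left hO hac
    simp (disch := decide) only [wp_cons, wp_nil, wp_assign, wp_mov, wp_branch, wp_skip, Expr.eval,
      State.set_reg, Nat.reduceEqDiff, if_true, if_false, hr.r4, hr.r5, hr.r6, hr.r7, hr.r8]
    refine ⟨by omega, by omega, by omega, by omega, ?_⟩
    have fin : ∀ s1, Agree 10 s s1 → s1.reg 20 = a → s1.reg 21 = min b (c - 1) → s1.reg 22 = c →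
        s1.reg 23 = e → s1.reg 8 = 1 → ∀ u, u ≤ 20 →
        Wp w (disjSearch N) s1 fun t s' => Agree 10 s s' ∧
          Outcome χ (fun i j => (a ≤ i ∧ i ≤ b ∧ i < c) ∧ c ≤ j ∧ j ≤ e) s' ∧
          t + u ≤ A * (3240 * ρ + 740) + B * (12 * (b - a + (e - c)) + 80) := by
      intro s1 ag h20 h21 h22 h23 h8 u hu
      refine (wp_disjSearch H (hs.trans (ag.mono (Nat.zero_le _))) h20 h21 h22 h23 h8 D').mono ?_
      rintro t s' ⟨ag', hO', ht⟩
      refine ⟨ag.trans (ag'.mono (by decide)), hO'.congr ?_, disj_time ?_ ht hA hu⟩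
      · rintro i d -
        rw [le_min_iff]
        omega
      · have := min_le_left b (c - 1)
        omega
    by_cases hbc : b < c - 1
    · rw [if_pos hbc]
      refine ⟨by omega, ?_⟩
      refine (fin _ ?_ ?_ ?_ ?_ ?_ ?_ 12 (by decide)).mono
        fun t s' h => ⟨h.1, h.2.1, by have := h.2.2; linarith⟩
      · repeat refine Agree.set ?_ (by decide) (by decide)
        exact Agree.refl _ _
      · simp [State.set_reg]
      · simp [State.set_reg, min_eq_left hbc.le]
      · simp [State.set_reg]
      · simp [State.set_reg]
      · simp [State.set_reg, hr.r8]
    · rw [if_neg hbc]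
      refine (fin _ ?_ ?_ ?_ ?_ ?_ ?_ 12 (by decide)).mono
        fun t s' h => ⟨h.1, h.2.1, by have := h.2.2; linarith⟩
      · repeat refine Agree.set ?_ (by decide) (by decide)
        exact Agree.refl _ _
      · simp [State.set_reg]
      · simp [State.set_reg, min_eq_right (not_lt.1 hbc)]
      · simp [State.set_reg]
      · simp [State.set_reg]
      · simp [State.set_reg, hr.r8]
  · rw [if_neg hac]
    simp only [wp_assign, Expr.eval]
    refine ⟨by omega, (Agree.refl _ _).set (by decide) (by decide),
      outcome_of_empty (by simp [State.set_reg]) ?_, ?_⟩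
    · rintro i d ⟨_, _⟩
      omega
    · have e1 : A * (3240 * ρ + 740) = 3240 * (A * ρ) + 740 * A := by ring
      linarith [Nat.zero_le (A * ρ), Nat.zero_le (B * (12 * (b - a + (e - c)) + 80))]

theorem wp_rightSearch {s₀ : State} {w n : ℕ} {χ : ℕ → ℕ} {N : Program} {A B : ℕ}
    (H : NextSpec s₀ w n χ N A B) {s : State} (hs : Agree 0 s₀ s) {a b c e ρ : ℕ}
    (hr : MainRegs s a b c e) (D : MainData n a b c e ρ) (hO : min b e < max a c + 8) :
    Wp w (rightSearch N) s fun t s' => Agree 10 s s' ∧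
      Outcome χ (fun i j => (a ≤ i ∧ i ≤ b) ∧ c ≤ j ∧ b < j ∧ j ≤ e) s' ∧
      t ≤ A * (3240 * ρ + 740) + B * (12 * (b - a + (e - c)) + 80) := by
  have hw := H.width
  have hA := H.pos
  obtain ⟨d1, d2, d3, d4, d5, d6, -, -⟩ := id D
  rw [rightSearch, wp_branch, hr.r5, hr.r7]
  by_cases hbe : b < e
  · rw [if_pos hbe]
    have D' := D.right hO hbe
    simp (disch := decide) only [wp_cons, wp_nil, wp_assign, wp_mov, wp_branch, wp_skip, Expr.eval,
      State.set_reg, Nat.reduceEqDiff, if_true, if_false, hr.r4, hr.r5, hr.r6, hr.r7, hr.r8]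
    refine ⟨by omega, by omega, by omega, by omega, ?_⟩
    have fin : ∀ s1, Agree 10 s s1 → s1.reg 20 = a → s1.reg 21 = b → s1.reg 22 = max c (b + 1) →
        s1.reg 23 = e → s1.reg 8 = 1 → ∀ u, u ≤ 20 →
        Wp w (disjSearch N) s1 fun t s' => Agree 10 s s' ∧
          Outcome χ (fun i j => (a ≤ i ∧ i ≤ b) ∧ c ≤ j ∧ b < j ∧ j ≤ e) s' ∧
          t + u ≤ A * (3240 * ρ + 740) + B * (12 * (b - a + (e - c)) + 80) := by
      intro s1 ag h20 h21 h22 h23 h8 u hu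
      refine (wp_disjSearch H (hs.trans (ag.mono (Nat.zero_le _))) h20 h21 h22 h23 h8 D').mono ?_
      rintro t s' ⟨ag', hO', ht⟩
      refine ⟨ag.trans (ag'.mono (by decide)), hO'.congr ?_, disj_time ?_ ht hA hu⟩
      · rintro i d -
        rw [max_le_iff]
        omega
      · have := le_max_left c (b + 1)
        omega
    by_cases hbc : b + 1 < c
    · rw [if_pos hbc]
      refine ⟨by omega, ?_⟩
      refine (fin _ ?_ ?_ ?_ ?_ ?_ ?_ 12 (by decide)).mono
        fun t s' h => ⟨h.1, h.2.1, by have := h.2.2; linarith⟩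
      · repeat refine Agree.set ?_ (by decide) (by decide)
        exact Agree.refl _ _
      · simp [State.set_reg]
      · simp [State.set_reg]
      · simp [State.set_reg, max_eq_left hbc.le]
      · simp [State.set_reg]
      · simp [State.set_reg, hr.r8]
    · rw [if_neg hbc]
      refine (fin _ ?_ ?_ ?_ ?_ ?_ ?_ 12 (by decide)).mono
        fun t s' h => ⟨h.1, h.2.1, by have := h.2.2; linarith⟩
      · repeat refine Agree.set ?_ (by decide) (by decide)
        exact Agree.refl _ _
      · simp [State.set_reg]
      · simp [State.set_reg]
      · simp [State.set_reg, max_eq_right (not_lt.1 hbc)]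
      · simp [State.set_reg]
      · simp [State.set_reg, hr.r8]
  · rw [if_neg hbe]
    simp only [wp_assign, Expr.eval]
    refine ⟨by omega, (Agree.refl _ _).set (by decide) (by decide),
      outcome_of_empty (by simp [State.set_reg]) ?_, ?_⟩
    · rintro i d ⟨_, _⟩
      omega
    · have e1 : A * (3240 * ρ + 740) = 3240 * (A * ρ) + 740 * A := by ring
      linarith [Nat.zero_le (A * ρ), Nat.zero_le (B * (12 * (b - a + (e - c)) + 80))]

/-! ### The complete search -/

/-- Writes the maximum of the registers `x` and `y` to register `r`. -/
def movMax (r x y : ℕ) : Program := .branch x y (mov r y) (mov r x)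

/-- Writes the minimum of the registers `x` and `y` to register `r`. -/
def movMin (r x y : ℕ) : Program := .branch x y (mov r x) (mov r y)

theorem wp_movMax {w r x y : ℕ} {s : State} {Q : ℕ → State → Prop} (hx : x ≠ r) (hy : y ≠ r) :
    Wp w (movMax r x y) s Q ↔
      max (s.reg x) (s.reg y) < 2 ^ w ∧ Q 3 (s.set r (max (s.reg x) (s.reg y))) := by
  rw [movMax, wp_branch, wp_mov hx, wp_mov hy]
  split_ifs with h
  · rw [max_eq_right h.le]
  · rw [max_eq_left (not_lt.1 h)]

theorem wp_movMin {w r x y : ℕ} {s : State} {Q : ℕ → State → Prop} (hx : x ≠ r) (hy : y ≠ r) :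
    Wp w (movMin r x y) s Q ↔
      min (s.reg x) (s.reg y) < 2 ^ w ∧ Q 3 (s.set r (min (s.reg x) (s.reg y))) := by
  rw [movMin, wp_branch, wp_mov hx, wp_mov hy]
  split_ifs with h
  · rw [min_eq_left h.le]
  · rw [min_eq_right (not_lt.1 h)]

/-- The preparation of the main program. -/
def mainSetup : Program :=
  blk [mov 4 0, mov 5 1, mov 6 2, mov 7 3, .assign 8 (.const 1),
    movMax 14 4 6, movMin 17 5 7, .assign 16 (.const 8), .assign 16 (.add 14 16),
    movMin 15 17 16]

theorem wp_mainSetup {w n : ℕ} {s : State} {a b c e ρ : ℕ} (hw : 64 * n + 256 < 2 ^ w)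
    (h0 : s.reg 0 = a) (h1 : s.reg 1 = b) (h2 : s.reg 2 = c) (h3 : s.reg 3 = e)
    (D : MainData n a b c e ρ) :
    Wp w mainSetup s fun t s1 => Agree 0 s s1 ∧ MainRegs s1 a b c e ∧ s1.reg 14 = max a c ∧
      s1.reg 15 = min (min b e) (max a c + 8) ∧ t ≤ 40 := by
  obtain ⟨d1, d2, d3, d4, d5, d6, -, -⟩ := D
  have m1 : max a c ≤ n := max_le (d2.trans d3) (d5.trans d6)
  have m2 : min b e ≤ n := (min_le_left _ _).trans d3
  have m3 : min (min b e) (max a c + 8) ≤ n := (min_le_left _ _).trans m2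
  simp (disch := decide) only [mainSetup, wp_cons, wp_nil, wp_assign, wp_mov, wp_movMax, wp_movMin,
    Expr.eval, State.set_reg, Nat.reduceEqDiff, if_true, if_false, h0, h1, h2, h3]
  generalize max a c = o at *
  generalize min b e = h at *
  generalize min h (o + 8) = h' at *
  refine ⟨by omega, by omega, by omega, by omega, by omega, by omega, by omega, by omega,
    by omega, by omega, ?_, ?_, trivial, trivial, by decide⟩
  · repeat refine Agree.set ?_ (by decide) (by decide)
    exact Agree.refl _ _
  · constructor <;> simp [State.set_reg]

/-- The search and the output of the main program. -/
def mainBody (N : Program) : Program :=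
  blk [orElse 8 (blk [.assign 76 (.const 0), .loop 14 15 (overlapBody N)])
      (orElse 8 (leftSearch N) (rightSearch N)),
    .branch 76 8 (.assign 0 (.const 0)) (blk [.assign 0 (.const 1), mov 1 77, mov 2 78])]

/-- The main program: the end points of the intervals are in the registers `0, …, 3`. -/
def mainSearch (N : Program) : Program := .seq mainSetup (mainBody N)

/-- Only the first nine positions of the overlap are searched. If this fails, the overlap has fewer
than nine positions, so it has been searched completely and cutting it off hardly affects the ratio.
-/
theorem wp_core {s₀ : State} {w n : ℕ} {χ : ℕ → ℕ} {N : Program} {A B : ℕ}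
    (H : NextSpec s₀ w n χ N A B) {s : State} (hs : Agree 0 s₀ s) {a b c e ρ : ℕ}
    (hr : MainRegs s a b c e) (D : MainData n a b c e ρ) (h14 : s.reg 14 = max a c)
    (h15 : s.reg 15 = min (min b e) (max a c + 8)) :
    Wp w (orElse 8 (blk [.assign 76 (.const 0), .loop 14 15 (overlapBody N)])
      (orElse 8 (leftSearch N) (rightSearch N))) s fun t s' => Agree 10 s s' ∧
      Outcome χ (fun i j => (a ≤ i ∧ i ≤ b) ∧ c ≤ j ∧ j ≤ e) s' ∧
      t ≤ A * (6480 * ρ + 5400) + B * (24 * (b - a + (e - c)) + 480) := by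
  have hA := H.pos
  obtain ⟨d1, d2, d3, d4, d5, d6, -, -⟩ := id D
  -- Contraposition of `exists_triple`: an overlap with nine or more positions contains a triple
  -- among its first nine.
  have hlt : (∀ i d, Triple χ i d →
      ¬ (max a c ≤ i ∧ i + 2 * d ≤ min (min b e) (max a c + 8))) → min b e < max a c + 8 := by
    intro hn
    by_contra hcon
    obtain ⟨i, d, ht, hi, hd⟩ := exists_triple H.bool (max a c)
    exact hn i d ht ⟨hi, le_min (hd.trans (not_lt.1 hcon)) hd⟩
  refine (wp_orElse (lo := 10) (by decide) le_rfl hr.r8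
    (wp_overlap H hs (by omega) (min_le_right _ _)
      ((min_le_left _ _).trans ((min_le_left _ _).trans d3)) hr h14 h15)
    (fun s1 ag1 hn => wp_orElse (lo := 10) (by decide) le_rfl (hr.agree ag1).r8
      (wp_leftSearch H (hs.trans (ag1.mono (Nat.zero_le _))) (hr.agree ag1) D (hlt hn))
      (fun s2 ag2 _ => wp_rightSearch H
        (hs.trans ((ag1.trans ag2).mono (Nat.zero_le _))) (hr.agree (ag1.trans ag2)) D
        (hlt hn)))).mono ?_
  rintro t s' ⟨ag, hO, ht⟩
  refine ⟨ag, ?_, ?_⟩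
  · rcases hO with ⟨h1, h2, h3⟩ | ⟨h1, h2⟩
    · refine .inl ⟨h1, h2, ?_⟩
      rcases h3 with ⟨h3, h4⟩ | ⟨h3, h4⟩ | ⟨h3, h4⟩
      · rw [max_le_iff] at h3
        rw [le_min_iff, le_min_iff] at h4
        omega
      · exact ⟨⟨h3.1, h3.2.1⟩, h4⟩
      · exact ⟨h3, h4.1, h4.2.2⟩
    · refine .inr ⟨h1, fun i d ht hP => ?_⟩
      -- A triple starts before c, ends after b, or has both ends in the overlap. The three searches
      -- cover these cases; in the last one `hm` ensures that the truncation to nine positions loses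
      -- nothing.
      have hm := hlt fun i d ht hP => h2 i d ht (.inl hP)
      refine h2 i d ht ?_
      by_cases hi : i < c
      · exact .inr (.inl ⟨⟨hP.1.1, hP.1.2, hi⟩, hP.2⟩)
      by_cases hj : b < i + 2 * d
      · exact .inr (.inr ⟨hP.1, hP.2.1, hj, hP.2.2⟩)
      · have := ht.1
        have hmin := le_min (show i + 2 * d ≤ b by omega) hP.2.2
        exact .inl ⟨max_le hP.1.1 (by omega), le_min hmin (hmin.trans hm.le)⟩
  · have e1 : A * (6480 * ρ + 5400) = 2 * (A * (3240 * ρ + 740)) + 3920 * A := by ring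
    have e2 : B * (24 * (b - a + (e - c)) + 480) =
      2 * (B * (12 * (b - a + (e - c)) + 80)) + B * 320 := by ring
    linarith

theorem wp_mainSearch {s₀ : State} {w n : ℕ} {χ : ℕ → ℕ} {N : Program} {A B : ℕ}
    (H : NextSpec s₀ w n χ N A B) {s : State} (hs : Agree 0 s₀ s) {a b c e ρ : ℕ}
    (h0 : s.reg 0 = a) (h1 : s.reg 1 = b) (h2 : s.reg 2 = c) (h3 : s.reg 3 = e)
    (D : MainData n a b c e ρ) :
    Wp w (mainSearch N) s fun t s' =>
      ((s'.reg 0 = 1 ∧ Triple χ (s'.reg 1) (s'.reg 2) ∧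
          (a ≤ s'.reg 1 ∧ s'.reg 1 ≤ b) ∧ c ≤ s'.reg 1 + 2 * s'.reg 2 ∧
          s'.reg 1 + 2 * s'.reg 2 ≤ e) ∨
        (s'.reg 0 = 0 ∧ ∀ i d, Triple χ i d →
          ¬ ((a ≤ i ∧ i ≤ b) ∧ c ≤ i + 2 * d ∧ i + 2 * d ≤ e))) ∧
      t ≤ A * (6480 * ρ + 5450) + B * (24 * (b - a + (e - c)) + 480) := by
  have hw := H.width
  have hA := H.pos
  obtain ⟨d1, d2, d3, d4, d5, d6, -, -⟩ := id D
  rw [mainSearch, wp_seq]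
  refine (wp_mainSetup hw h0 h1 h2 h3 D).mono ?_
  rintro u s1 ⟨ag, hr, h14, h15, hu⟩
  simp only [mainBody, wp_cons, wp_nil]
  refine (wp_core H (hs.trans ag) hr D h14 h15).mono ?_
  rintro t s2 ⟨ag2, hO, ht⟩
  have e1 : A * (6480 * ρ + 5450) = A * (6480 * ρ + 5400) + 50 * A := by ring
  rw [wp_branch, (hr.agree ag2).r8]
  rcases hO with ⟨g1, g2, g3⟩ | ⟨g1, g2⟩
  · rw [if_neg (by omega)]
    simp (disch := decide) only [wp_cons, wp_nil, wp_assign, wp_mov, Expr.eval, State.set_reg,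
      Nat.reduceEqDiff, if_true, if_false]
    refine ⟨by omega, by omega, by omega, .inl ⟨trivial, g2, g3⟩, by linarith⟩
  · rw [if_pos (by omega)]
    simp only [wp_assign, Expr.eval, State.set_reg, if_true]
    exact ⟨by omega, .inr ⟨trivial, g2⟩, by linarith⟩

/-! ## Uncompressed strings -/

/-- The result is the least position of the progression that carries x or exceeds the limit. The
last clause identifies it with the position at which a scan runs out of the range. -/
theorem exists_isNext (χ : ℕ → ℕ) (x st lim : ℕ) {step : ℕ} (h : step = 1 ∨ step = 2) :
    ∃ q, IsNext χ x st lim step q ∧ q ≤ max st (lim + 2) ∧ step ∣ q - st ∧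
      ∀ k, st ≤ k → lim < k → step ∣ k - st → q ≤ k := by
  classical
  have hex : ∃ q, st ≤ q ∧ step ∣ q - st ∧ (lim < q ∨ χ q = x) := by
    rcases h with rfl | rfl
    · exact ⟨max st (lim + 1), le_max_left _ _, one_dvd _, .inl (by omega)⟩
    · exact ⟨st + 2 * (lim + 1), by omega, by omega, .inl (by omega)⟩
  obtain ⟨h1, h2, h3⟩ := Nat.find_spec hex
  refine ⟨Nat.find hex, ⟨h1, fun k k1 k2 k3 k4 hk => Nat.find_min hex k2 ⟨k1, k4, .inr hk⟩,
    fun hq => ⟨h3.resolve_left (by omega), h2⟩⟩, ?_, h2,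
    fun k k1 k2 k3 => Nat.find_min' hex ⟨k1, k3, .inl k2⟩⟩
  generalize hf : Nat.find hex = f at *
  -- If q exceeded the bound, q - step would still be at least st and beyond the limit, against the
  -- minimality of q.
  by_contra! hcon
  rw [max_lt_iff] at hcon
  refine Nat.find_min hex (m := f - step) (by omega) ⟨?_, ?_, .inl (by omega)⟩
  · rcases h with rfl | rfl <;> omega
  · rw [Nat.sub_right_comm]
    exact Nat.dvd_sub h2 dvd_rfl

/-- One step of `scanNext`. -/
def scanBody : Program :=
  blk [.assign 86 (.load 84),
    .branch 86 80 (.assign 84 (.add 84 83))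
      (.branch 80 86 (.assign 84 (.add 84 83)) (.assign 85 (.const 0)))]

/-- Finds the next occurrence in a string that is stored in the memory. -/
def scanNext : Program :=
  blk [.assign 98 (.const 1), mov 84 81, .assign 85 (.add 82 98), .loop 84 85 scanBody]

/-- The loop invariant of `scanNext`, where `q` is the result. -/
def ScanInv (x st lim step q : ℕ) (sI s : State) (v : ℕ) : Prop :=
  Agree 80 sI s ∧ s.reg 80 = x ∧ s.reg 83 = step ∧ st ≤ s.reg 84 ∧ s.reg 84 ≤ q ∧
    step ∣ s.reg 84 - st ∧
    (s.reg 85 = lim + 1 ∧ 8 * (q - s.reg 84) + 8 ≤ v ∨ s.reg 85 = 0 ∧ s.reg 84 = q)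

/-- The result q is fixed in advance, so the invariant only states that the scan approaches it:
within the limit, the current position is q iff it carries x. Equality of characters is tested by
two strict comparisons. -/
theorem wp_scanBody {w x st lim step q : ℕ} {sI : State} (hw : ∀ i, sI.mem i < 2 ^ w)
    (hs : step = 1 ∨ step = 2) (hn : IsNext sI.mem x st lim step q) (hq : step ∣ q - st)
    (hqw : q < 2 ^ w) (s : State) (v : ℕ)
    (hI : ScanInv x st lim step q sI s v) (hlt : s.reg 84 < s.reg 85) :
    Wp w scanBody s fun t s' => ∃ v', ScanInv x st lim step q sI s' v' ∧ t + 1 + v' ≤ v := by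
  obtain ⟨ag, h80, h83, h1, h2, h3, h4⟩ := hI
  obtain ⟨h85, hv⟩ := h4.resolve_right (by omega)
  have hlim : s.reg 84 ≤ lim := by omega
  have hmem : s.mem (s.reg 84) = sI.mem (s.reg 84) := by rw [ag.1]
  generalize hp : s.reg 84 = p at *
  have hx : p = q ↔ sI.mem p = x := by
    constructor
    · intro h
      rw [h]
      exact (hn.2.2 (by omega)).1
    · intro h
      by_contra hne
      exact hn.2.1 p h1 (by omega) hlim h3 h
  have adv : p ≠ q → step ∣ p + step - st ∧ p + step ≤ q := by
    intro hne
    rcases hs with rfl | rfl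
    · exact ⟨one_dvd _, by omega⟩
    · exact ⟨by omega, by omega⟩
  have hwp := hw p
  simp (disch := decide) only [scanBody, wp_cons, wp_nil, wp_assign, wp_branch, Expr.eval,
    State.set_reg, Nat.reduceEqDiff, if_true, if_false, hp, hmem, h80, h83]
  refine ⟨hwp, ?_⟩
  have next : p ≠ q → p + step < 2 ^ w ∧ ∃ v', ScanInv x st lim step q sI
      ((s.set 86 (sI.mem p)).set 84 (p + step)) v' ∧ 7 + v' ≤ v := by
    intro hne
    obtain ⟨a1, a2⟩ := adv hne
    refine ⟨by omega, 8 * (q - (p + step)) + 8,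
      ⟨(ag.set (by decide) (by decide)).set (by decide) (by decide), ?_⟩, by omega⟩
    simp only [State.set_reg, Nat.reduceEqDiff, if_true, if_false]
    exact ⟨h80, h83, by omega, a2, a1, .inl ⟨h85, le_rfl⟩⟩
  by_cases c1 : sI.mem p < x
  · rw [if_pos c1]
    obtain ⟨a1, v', a2, a3⟩ := next fun h => by
      have := hx.1 h
      omega
    exact ⟨a1, v', a2, by omega⟩
  rw [if_neg c1]
  by_cases c2 : x < sI.mem p
  · rw [if_pos c2]
    obtain ⟨a1, v', a2, a3⟩ := next fun h => by
      have := hx.1 h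
      omega
    exact ⟨a1, v', a2, by omega⟩
  rw [if_neg c2]
  refine ⟨by omega, 0, ⟨(ag.set (by decide) (by decide)).set (by decide) (by decide), ?_⟩, by omega⟩
  simp only [State.set_reg, Nat.reduceEqDiff, if_true, if_false, hp]
  exact ⟨h80, h83, h1, h2, h3, .inr ⟨trivial, hx.2 (by omega)⟩⟩

theorem nextSpec_scan {s₀ : State} {w n : ℕ} (hw : 64 * n + 256 < 2 ^ w)
    (hb : ∀ i, s₀.mem i ≤ 1) : NextSpec s₀ w n s₀.mem scanNext 20 8 := by
  refine ⟨hw, by decide, hb, ?_⟩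
  intro s x st lim step ag h80 h81 h82 h83 hx h1 h2 h3 hs
  obtain ⟨q, hq, hq', hd, hmin⟩ := exists_isNext s₀.mem x st lim hs
  have hqn : q ≤ max st (n + 2) := hq'.trans (max_le_max le_rfl (by omega))
  have hq0 := hq.1
  simp (disch := decide) only [scanNext, wp_cons, wp_nil, wp_assign, wp_mov, Expr.eval,
    State.set_reg, Nat.reduceEqDiff, if_true, if_false, h81, h82]
  refine ⟨by omega, by omega, by omega, ?_⟩
  have ag1 : Agree 80 s (((s.set 98 1).set 84 st).set 85 (lim + 1)) := by
    repeat refine Agree.set ?_ (by decide) (by decide)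
    exact Agree.refl _ _
  have hI : ScanInv x st lim step q (((s.set 98 1).set 84 st).set 85 (lim + 1))
      (((s.set 98 1).set 84 st).set 85 (lim + 1)) (8 * (q - st) + 8) := by
    refine ⟨Agree.refl _ _, ?_⟩
    simp only [State.set_reg, Nat.reduceEqDiff, if_true, if_false]
    exact ⟨h80, h83, le_rfl, hq0, by simp, .inl ⟨trivial, le_rfl⟩⟩
  have hmem : (((s.set 98 1).set 84 st).set 85 (lim + 1)).mem = s₀.mem := ag.1
  generalize ((s.set 98 1).set 84 st).set 85 (lim + 1) = s1 at *
  refine (wp_loop _ (fun s' v => wp_scanBody (fun i => ?_) hs (by rwa [hmem]) hd (by omega) s' v)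
    hI).mono ?_
  · rw [hmem]
    have := hb i
    omega
  rintro t s' ⟨ht, ⟨v, ag2, i1, i2, i3, i4, i5, i6⟩, hc⟩
  have hres : s'.reg 84 = q := by
    rcases i6 with ⟨i6, -⟩ | ⟨-, i6⟩
    · exact le_antisymm i4 (hmin _ i3 (by omega) i5)
    · exact i6
  rw [hres]
  refine ⟨ag1.trans ag2, hq, hqn, q - st, by omega, by omega⟩

/-! ### Cadences as triples -/

/-- The `a`-th character of a binary string as a number. -/
def chr (S : List Bool) (a : ℕ) : ℕ := if a = 0 then 0 else (S[a - 1]?.getD false).toNat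

theorem chr_le (S : List Bool) (a : ℕ) : chr S a ≤ 1 := by
  rw [chr]
  split_ifs
  · exact Nat.zero_le _
  · exact Bool.toNat_le _

theorem chr_eq {S : List Bool} {p : ℕ} (h1 : 1 ≤ p) (h2 : p ≤ S.length) (b : Bool) :
    S[p - 1]? = some b ↔ chr S p = b.toNat := by
  have hp : p - 1 < S.length := by omega
  rw [chr, if_neg (by omega), List.getElem?_eq_getElem hp]
  generalize S[p - 1] = c
  cases b <;> cases c <;> simp

/-- Since i ≥ 1 and i + 2d ≤ R.hi ≤ |S|, all three positions are indices of S, so default values of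
`chr` never occur in a triple with such ends. -/
theorem isLRCadence_iff {S : List Bool} {L R : IndexInterval S.length} {i d : ℕ} :
    IsLRCadence S L R i d 3 ↔ Triple (chr S) i d ∧
      (L.lo ≤ i ∧ i ≤ L.hi) ∧ R.lo ≤ i + 2 * d ∧ i + 2 * d ≤ R.hi := by
  have hL := L.one_le_lo
  have hR := R.hi_le
  simp only [IsLRCadence, IsSubCadence, IndexInterval.toFinset, Finset.mem_Icc, Triple]
  rw [show (3 - 1) * d = 2 * d by omega]
  constructor
  · rintro ⟨⟨hd, hi, a, ha⟩, h1, h2⟩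
    have h := ha 0 (by decide)
    have h' := ha 1 (by decide)
    have h'' := ha 2 (by decide)
    rw [Nat.zero_mul, Nat.add_zero, chr_eq hi (by omega)] at h
    rw [Nat.one_mul, chr_eq (by omega) (by omega)] at h'
    rw [chr_eq (by omega) (by omega)] at h''
    exact ⟨⟨hd, by rw [h, h'], by rw [h, h'']⟩, h1, h2⟩
  · rintro ⟨⟨hd, h, h'⟩, h1, h2⟩
    refine ⟨⟨hd, by omega, S[i - 1]'(by omega), ?_⟩, h1, h2⟩
    have h0 := (chr_eq (S := S) (p := i) (by omega) (by omega) (S[i - 1]'(by omega))).1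
      (List.getElem?_eq_getElem _)
    intro j hj
    rcases (show j = 0 ∨ j = 1 ∨ j = 2 by omega) with rfl | rfl | rfl
    · rw [chr_eq (by omega) (by omega), Nat.zero_mul, Nat.add_zero, h0]
    · rw [chr_eq (by omega) (by omega), Nat.one_mul, h, h0]
    · rw [chr_eq (by omega) (by omega), h', h0]

theorem answers_of_search {S : List Bool} {L R : IndexInterval S.length} {s : State}
    (h : (s.reg 0 = 1 ∧ Triple (chr S) (s.reg 1) (s.reg 2) ∧
          (L.lo ≤ s.reg 1 ∧ s.reg 1 ≤ L.hi) ∧ R.lo ≤ s.reg 1 + 2 * s.reg 2 ∧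
          s.reg 1 + 2 * s.reg 2 ≤ R.hi) ∨
        (s.reg 0 = 0 ∧ ∀ i d, Triple (chr S) i d →
          ¬ ((L.lo ≤ i ∧ i ≤ L.hi) ∧ R.lo ≤ i + 2 * d ∧ i + 2 * d ≤ R.hi))) :
    Answers 3 S L R s := by
  rcases h with ⟨h1, h2⟩ | ⟨h1, h2⟩
  · exact .inl ⟨h1, isLRCadence_iff.2 h2⟩
  · refine .inr ⟨h1, ?_⟩
    rintro ⟨i, d, h⟩
    have := isLRCadence_iff.1 h
    exact h2 i d this.1 this.2

theorem IndexInterval.length_eq {n : ℕ} (I : IndexInterval n) :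
    I.length = I.hi - I.lo + 1 := by
  have := I.lo_le_hi
  rw [IndexInterval.length, IndexInterval.toFinset, Nat.card_Icc]
  omega

theorem mainData {n : ℕ} (L R : IndexInterval n) {ρ : ℕ} (h : R.length ≤ ρ * L.length)
    (h' : L.length ≤ ρ * R.length) : MainData n L.lo L.hi R.lo R.hi ρ := by
  rw [IndexInterval.length_eq, IndexInterval.length_eq] at h h'
  exact ⟨L.one_le_lo, L.lo_le_hi, L.hi_le, R.one_le_lo, R.lo_le_hi, R.hi_le, h, h'⟩

/-- One constant C serves for both the word length and the time, so the width factor is far larger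
than needed. -/
theorem width_log (n : ℕ) (hn : 1 ≤ n) : 64 * n + 256 < 2 ^ (500000 * (Nat.log 2 n + 1)) := by
  have h1 : n < 2 ^ (Nat.log 2 n + 1) := Nat.lt_pow_succ_log_self (by decide) n
  have h2 : 2 ^ (Nat.log 2 n + 1 + 9) ≤ 2 ^ (500000 * (Nat.log 2 n + 1)) :=
    Nat.pow_le_pow_right (by decide) (by omega)
  rw [pow_add] at h2
  omega

theorem uncompressed : ∃ (P : Program) (C : ℕ), ∀ (S : List Bool) (L R : IndexInterval S.length),
      ∃ (t : ℕ) (s : State),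
        Runs (C * (Nat.log 2 S.length + 1)) P (inputString S L R) t s ∧
        Answers 3 S L R s ∧
        t ≤ C * (L.length + R.length) := by
  refine ⟨mainSearch scanNext, 500000, fun S L R => ?_⟩
  have l1 := L.one_le_lo
  have l2 := L.lo_le_hi
  have l3 := L.hi_le
  have l4 := R.one_le_lo
  have l5 := R.lo_le_hi
  have l6 := R.hi_le
  have hw := width_log S.length (by omega)
  have hL := IndexInterval.length_eq L
  have hR := IndexInterval.length_eq R
  -- With constant A the term A · ρ is allowed to be linear, so the crude ratio |L| + |R| suffices.
  have D := mainData L R (ρ := L.length + R.length) (by nlinarith) (by nlinarith)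
  have H := nextSpec_scan (s₀ := inputString S L R) (width_log S.length (by omega))
    (fun i => chr_le S i)
  obtain ⟨t, s, he, ha, ht⟩ := wp_mainSearch H (Agree.refl 0 _) (s := inputString S L R)
    (a := L.lo) (b := L.hi) (c := R.lo) (e := R.hi) rfl rfl rfl rfl D
  refine ⟨t, s, ⟨⟨fun r => ?_, fun a => ?_⟩, he⟩, answers_of_search ha, ?_⟩
  · rcases r with _ | _ | _ | _ | _ | r <;> simp only [inputString, inputReg] <;> omega
  · have := chr_le S a
    exact lt_of_le_of_lt this (by omega)
  · clear hw H D he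
    rw [hL, hR] at *
    linarith

/-! ## Grammar-compressed strings -/

/-- The least `o` such that `u` carries `x` at offset `o` and `o` has the parity of `p`, or the length
of `u` if there is none. -/
def first (x : ℕ) : ℕ → List Bool → ℕ
  | _, [] => 0
  | p, b :: u => if b.toNat = x ∧ p % 2 = 0 then 0 else first x (p + 1) u + 1

theorem first_le (x p : ℕ) (u : List Bool) : first x p u ≤ u.length := by
  induction u generalizing p with
  | nil => exact le_rfl
  | cons b u ih =>
    rw [first]
    split_ifs
    · exact Nat.zero_le _
    · exact Nat.succ_le_succ (ih _)

/-- An offset in v is shifted by |u| in the concatenation, which changes the required parity to p +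
|u|. -/
theorem first_append (x p : ℕ) (u v : List Bool) :
    first x p (u ++ v) = if first x p u < u.length then first x p u
      else u.length + first x (p + u.length) v := by
  induction u generalizing p with
  | nil => simp [first]
  | cons b u ih =>
    rw [List.cons_append, first, first, ih]
    by_cases h : b.toNat = x ∧ p % 2 = 0
    · simp [h]
    · simp only [h, if_false, List.length_cons, Nat.add_lt_add_iff_right]
      split_ifs
      · rfl
      · rw [show p + 1 + u.length = p + (u.length + 1) by omega]
        omega

theorem first_congr {x p q : ℕ} (h : p % 2 = q % 2) (u : List Bool) :
    first x p u = first x q u := by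
  induction u generalizing p q with
  | nil => rfl
  | cons b u ih => rw [first, first, h, ih (show (p + 1) % 2 = (q + 1) % 2 by omega)]

theorem first_spec (x p : ℕ) (u : List Bool) :
    (∀ k < first x p u, k % 2 = p % 2 → (u[k]?.getD false).toNat ≠ x) ∧
      (first x p u < u.length →
        (u[first x p u]?.getD false).toNat = x ∧ first x p u % 2 = p % 2) := by
  induction u generalizing p with
  | nil => simp [first]
  | cons b u ih =>
    rw [first]
    obtain ⟨h1, h2⟩ := ih (p + 1)
    by_cases h : b.toNat = x ∧ p % 2 = 0
    · rw [if_pos h]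
      exact ⟨by simp, fun _ => ⟨by simpa using h.1, by omega⟩⟩
    · rw [if_neg h]
      constructor
      · intro k hk hp
        rcases k with _ | k
        · intro hb
          exact h ⟨by simpa using hb, by omega⟩
        · rw [List.getElem?_cons_succ]
          exact h1 k (by omega) (by omega)
      · intro hl
        rw [List.getElem?_cons_succ]
        obtain ⟨h3, h4⟩ := h2 (by simpa using hl)
        exact ⟨h3, by omega⟩

theorem chr_drop {S : List Bool} {s k : ℕ} :
    chr S (s + 1 + k) = ((S.drop s)[k]?.getD false).toNat := by
  rw [chr, if_neg (by omega), List.getElem?_drop, show s + 1 + k - 1 = s + k by omega]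

/-- The next occurrence in the string `S` in terms of `first`. -/
theorem isNext_first {S : List Bool} {x st : ℕ} (h1 : 1 ≤ st) (h2 : st ≤ S.length) :
    IsNext (chr S) x st S.length 2 (st + first x 0 (S.drop (st - 1))) := by
  obtain ⟨s, rfl⟩ : ∃ s, st = s + 1 := ⟨st - 1, by omega⟩
  rw [Nat.add_sub_cancel]
  obtain ⟨f1, f2⟩ := first_spec x 0 (S.drop s)
  have f3 := first_le x 0 (S.drop s)
  rw [List.length_drop] at f2 f3
  refine ⟨by omega, ?_, ?_⟩
  · intro k k1 k2 k3 k4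
    have := f1 (k - (s + 1)) (by omega) (by omega)
    rwa [← chr_drop, show s + 1 + (k - (s + 1)) = k by omega] at this
  · intro hq
    obtain ⟨g1, g2⟩ := f2 (by omega)
    rw [chr_drop]
    exact ⟨g1, by omega⟩

theorem IsNext.mono {χ : ℕ → ℕ} {x st lim lim' step q : ℕ} (h : IsNext χ x st lim step q)
    (hl : lim' ≤ lim) : IsNext χ x st lim' step q :=
  ⟨h.1, fun k h1 h2 h3 => h.2.1 k h1 h2 (h3.trans hl), fun hq => h.2.2 (hq.trans hl)⟩

/-- The positions from st on are split by parity, so a search of step 1 is the better of two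
searches of step 2. This is why the table needs to distinguish parities only. -/
theorem IsNext.min {χ : ℕ → ℕ} {x st lim q q' : ℕ} (h : IsNext χ x st lim 2 q)
    (h' : IsNext χ x (st + 1) lim 2 q') : IsNext χ x st lim 1 (min q q') := by
  obtain ⟨a1, a2, a3⟩ := h
  obtain ⟨b1, b2, b3⟩ := h'
  refine ⟨by omega, ?_, ?_⟩
  · intro k k1 k2 k3 _
    rw [lt_min_iff] at k2
    by_cases hk : 2 ∣ k - st
    · exact a2 k k1 k2.1 k3 hk
    · exact b2 k (by omega) k2.2 k3 (by omega)
  · intro hq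
    refine ⟨?_, one_dvd _⟩
    rcases le_total q q' with h | h
    · rw [min_eq_left h] at hq ⊢
      exact (a3 hq).1
    · rw [min_eq_right h] at hq ⊢
      exact (b3 hq).1

/-! ### The grammar and its table in memory -/

/-- The memory `M` represents a grammar with `m` nonterminals that derive the strings `str i`. -/
def Represents (m : ℕ) (M : ℕ → ℕ) (str : ℕ → List Bool) : Prop :=
  ∀ i < m, (M (3 * i) = 0 ∧ ∃ b : Bool, M (3 * i + 1) = b.toNat ∧ str i = [b]) ∨
    (M (3 * i) = 1 ∧ M (3 * i + 1) < i ∧ M (3 * i + 2) < i ∧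
      str i = str (M (3 * i + 1)) ++ str (M (3 * i + 2)))

/-- Both parts have smaller indices, so the length at most doubles with the index. Positions in the
string therefore fit into words of O(m) bits. -/
theorem Represents.length_le {m : ℕ} {M : ℕ → ℕ} {str : ℕ → List Bool}
    (h : Represents m M str) {i : ℕ} (hi : i < m) : (str i).length ≤ 2 ^ i := by
  induction i using Nat.strong_induction_on with
  | _ i ih =>
    rcases h i hi with ⟨-, b, -, hb⟩ | ⟨-, h1, h2, h3⟩
    · rw [hb]
      exact Nat.one_le_two_pow
    · rw [h3, List.length_append]
      have a1 := ih _ h1 (by omega)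
      have a2 := ih _ h2 (by omega)
      obtain ⟨i, rfl⟩ : ∃ k, i = k + 1 := ⟨i - 1, by omega⟩
      have b1 : 2 ^ M (3 * (i + 1) + 1) ≤ 2 ^ i := Nat.pow_le_pow_right (by decide) (by omega)
      have b2 : 2 ^ M (3 * (i + 1) + 2) ≤ 2 ^ i := Nat.pow_le_pow_right (by decide) (by omega)
      rw [pow_succ]
      omega

/-- The table entries for the string `u`: its length, and its first occurrences of both characters
at offsets of both parities. -/
def entry (u : List Bool) : ℕ → ℕ
  | 0 => u.length
  | 1 => first 0 0 u
  | 2 => first 0 1 u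
  | 3 => first 1 0 u
  | _ => first 1 1 u

theorem entry_le (u : List Bool) (k : ℕ) : entry u k ≤ u.length := by
  rcases k with _ | _ | _ | _ | k
  · exact le_rfl
  all_goals exact first_le _ _ _

/-- The memory `mem` contains the grammar `M`, the table for the strings with index below `i₀`, and
the first `k₀` entries for `i₀`. -/
def Tab (m : ℕ) (M : ℕ → ℕ) (str : ℕ → List Bool) (i₀ k₀ : ℕ) (mem : ℕ → ℕ) : Prop :=
  (∀ a < 3 * m, mem a = M a) ∧
    ∀ k < 5, ∀ i < m, i < i₀ ∨ i = i₀ ∧ k < k₀ → mem ((3 + k) * m + i) = entry (str i) k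

theorem addr_inj {m k k' i i' : ℕ} (hi : i < m) (hi' : i' < m)
    (h : (3 + k) * m + i = (3 + k') * m + i') : k = k' ∧ i = i' := by
  have h1 := congrArg (· / m) h
  have h2 := congrArg (· % m) h
  have hm : 0 < m := by omega
  simp only [Nat.mul_comm _ m, Nat.mul_add_div hm, Nat.mul_add_mod, Nat.div_eq_of_lt hi,
    Nat.div_eq_of_lt hi', Nat.mod_eq_of_lt hi, Nat.mod_eq_of_lt hi'] at h1 h2
  omega

theorem Tab.put {m : ℕ} {M : ℕ → ℕ} {str : ℕ → List Bool} {i₀ k₀ : ℕ} {s : State}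
    (h : Tab m M str i₀ k₀ s.mem) (hi : i₀ < m) {a v : ℕ} (ha : a = (3 + k₀) * m + i₀)
    (hv : v = entry (str i₀) k₀) : Tab m M str i₀ (k₀ + 1) (s.put a v).mem := by
  subst ha hv
  refine ⟨fun a ha => ?_, fun k hk i hi' hik => ?_⟩
  · rw [State.put_mem, if_neg, h.1 a ha]
    have : 3 * m ≤ (3 + k₀) * m := Nat.mul_le_mul_right _ (by omega)
    omega
  · rw [State.put_mem]
    split_ifs with he
    · obtain ⟨rfl, rfl⟩ := addr_inj hi' hi he
      rfl
    · refine h.2 k hk i hi' ?_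
      by_cases hc : i = i₀ ∧ k = k₀
      · rw [hc.1, hc.2] at he
        exact absurd rfl he
      · omega

theorem Tab.next {m : ℕ} {M : ℕ → ℕ} {str : ℕ → List Bool} {i₀ : ℕ} {mem : ℕ → ℕ}
    (h : Tab m M str i₀ 5 mem) : Tab m M str (i₀ + 1) 0 mem :=
  ⟨h.1, fun k hk i hi hik => h.2 k hk i hi (by omega)⟩

/-! ## Computing the table -/

/-- The table is filled up to entry `k` for index `i`, and the registers below `120` are those
of `s₁`. -/
def Filled (m : ℕ) (M : ℕ → ℕ) (str : ℕ → List Bool) (s₁ : State) (i k : ℕ) (s : State) : Prop :=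
  Tab m M str i k s.mem ∧ ∀ r < 120, s.reg r = s₁.reg r

theorem Filled.set {m : ℕ} {M : ℕ → ℕ} {str : ℕ → List Bool} {s₁ s : State} {i k r v : ℕ}
    (h : Filled m M str s₁ i k s) (hr : 120 ≤ r) : Filled m M str s₁ i k (s.set r v) :=
  ⟨h.1, fun r' hr' => by rw [State.set_reg_of_ne _ _ (by omega), h.2 r' hr']⟩

/-- Writes register `v` to the row `tb` of the table. -/
def putEntry (tb v : ℕ) : Program := blk [.assign 120 (.add tb 110), .store 120 v]

/-- Computes the entry in the row `tb` from the rows `tb` and `br`. -/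
def combine (tb br : ℕ) : Program :=
  blk [.assign 120 (.add tb 113), .assign 121 (.load 120),
    .branch 121 119 .skip
      (blk [.assign 120 (.add br 114), .assign 121 (.load 120), .assign 121 (.add 119 121)]),
    putEntry tb 121]

section

variable {w m : ℕ} {M : ℕ → ℕ} {str : ℕ → List Bool} {s₁ s : State} {i k : ℕ}

theorem wp_putEntry {tb v : ℕ} (F : Filled m M str s₁ i k s) (hw : 8 * m < 2 ^ w) (hk : k < 5)
    (hi : i < m) (h1 : s₁.reg 110 = i) (ht : tb < 120) (h2 : s₁.reg tb = (3 + k) * m)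
    (hv : v ≠ 120) (h3 : s.reg v = entry (str i) k) :
    Wp w (putEntry tb v) s fun t s' => t = 3 ∧ Filled m M str s₁ i (k + 1) s' := by
  have hm : (3 + k) * m ≤ 7 * m := Nat.mul_le_mul_right _ (by omega)
  rw [putEntry, wp_cons, wp_assign, wp_cons, wp_store, wp_nil]
  simp only [Expr.eval, F.2 tb ht, F.2 110 (by decide), h1, h2]
  refine ⟨by omega, trivial, ?_, ?_⟩
  · refine Tab.put (F.set (r := 120) le_rfl).1 hi ?_ ?_
    · rw [State.set_reg, if_pos rfl]
    · rw [State.set_reg_of_ne _ _ hv, h3]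
  · exact (F.set (r := 120) le_rfl).2

theorem wp_combine {tb br k' : ℕ} (F : Filled m M str s₁ i k s) (hw : 8 * m < 2 ^ w) (hk : k < 5)
    (hi : i < m) (h1 : s₁.reg 110 = i) (ht : tb < 120) (h2 : s₁.reg tb = (3 + k) * m)
    (hb : br < 120) (h3 : s₁.reg br = (3 + k') * m) (hk' : k' < 5)
    {j j' : ℕ} (h4 : s₁.reg 113 = j) (h5 : s₁.reg 114 = j') (hj : j < i) (hj' : j' < i)
    (h6 : s₁.reg 119 = (str j).length) (hl : (str j).length + (str j').length < 2 ^ w)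
    (he : entry (str i) k = if entry (str j) k < (str j).length then entry (str j) k
      else (str j).length + entry (str j') k') :
    Wp w (combine tb br) s fun t s' => t ≤ 12 ∧ Filled m M str s₁ i (k + 1) s' := by
  have hm : (3 + k) * m ≤ 7 * m := Nat.mul_le_mul_right _ (by omega)
  have hm' : (3 + k') * m ≤ 7 * m := Nat.mul_le_mul_right _ (by omega)
  have e1 := F.1.2 k hk j (by omega) (.inl hj)
  have e2 := F.1.2 k' hk' j' (by omega) (.inl hj')
  have l1 := entry_le (str j) k
  have l2 := entry_le (str j') k'
  rw [combine, wp_cons, wp_assign, wp_cons, wp_assign, wp_cons, wp_branch]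
  simp only [Expr.eval, State.set_reg, State.set_mem, F.2 tb ht, F.2 119 (by decide),
    F.2 113 (by decide), h2, h4, e1, if_true, if_false, Nat.reduceEqDiff, h6, wp_skip]
  refine ⟨by omega, by omega, ?_⟩
  have F' := (F.set (r := 120) (v := (3 + k) * m + j) (by decide)).set
    (r := 121) (v := entry (str j) k) (by decide)
  split_ifs with hc
  · rw [wp_cons]
    refine (wp_putEntry F' hw hk hi h1 ht h2 (by decide) ?_).mono ?_
    · rw [State.set_reg, if_pos rfl, he, if_pos hc]
    · rintro t s' ⟨rfl, hF⟩
      rw [wp_nil]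
      exact ⟨by omega, hF⟩
  · generalize hs' : (s.set 120 ((3 + k) * m + j)).set 121 (entry (str j) k) = s' at F'
    have e2' := F'.1.2 k' hk' j' (by omega) (.inl hj')
    simp only [wp_cons, wp_nil, wp_assign, Expr.eval, State.set_reg, State.set_mem, F'.2 br hb,
      F'.2 119 (by decide), F'.2 114 (by decide), h3, h5, h6, e2', if_true, if_false,
      Nat.reduceEqDiff]
    refine ⟨by omega, by omega, by omega, ?_⟩
    refine (wp_putEntry (((F'.set ?_).set ?_).set ?_) hw hk hi h1 ht h2 (by decide) ?_).mono ?_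
    · decide
    · decide
    · decide
    · rw [State.set_reg, if_pos rfl, he, if_neg hc]
    · rintro t s' ⟨rfl, hF⟩
      exact ⟨by omega, hF⟩

/-- Entries 1, 2 and 3, 4 belong to even and odd offsets for the characters 0 and 1. If |u| is odd,
the entry of v is taken from the row of the other parity: k ↦ k + 1 - 2 (k mod 2) swaps 0 with 1 and
2 with 3. -/
theorem entry_append (u v : List Bool) :
    entry (u ++ v) 0 = u.length + v.length ∧ ∀ k < 4, entry (u ++ v) (k + 1) =
      if entry u (k + 1) < u.length then entry u (k + 1)
      else u.length + entry v ((if u.length % 2 = 0 then k else k + 1 - k % 2 * 2) + 1) := by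
  refine ⟨List.length_append, fun k hk => ?_⟩
  by_cases hp : u.length % 2 = 0
  · rw [if_pos hp]
    interval_cases k <;> simp only [entry, first_append]
    · rw [first_congr (show (0 + u.length) % 2 = 0 % 2 by omega)]
    · rw [first_congr (show (1 + u.length) % 2 = 1 % 2 by omega)]
    · rw [first_congr (show (0 + u.length) % 2 = 0 % 2 by omega)]
    · rw [first_congr (show (1 + u.length) % 2 = 1 % 2 by omega)]
  · rw [if_neg hp]
    interval_cases k <;> simp only [entry, first_append]
    · rw [first_congr (show (0 + u.length) % 2 = 1 % 2 by omega)]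
    · rw [first_congr (show (1 + u.length) % 2 = 0 % 2 by omega)]
    · rw [first_congr (show (0 + u.length) % 2 = 1 % 2 by omega)]
    · rw [first_congr (show (1 + u.length) % 2 = 0 % 2 by omega)]

end

/-- The constants and the position that the computation of the table keeps in registers. -/
structure Pre (m i : ℕ) (ρ : ℕ → ℕ) (s : State) : Prop where
  r100 : s.reg 100 = m
  r101 : s.reg 101 = (3 + 0) * m
  r102 : s.reg 102 = (3 + 1) * m
  r103 : s.reg 103 = (3 + 2) * m
  r104 : s.reg 104 = (3 + 3) * m
  r105 : s.reg 105 = (3 + 4) * m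
  r108 : s.reg 108 = 1
  r109 : s.reg 109 = 0
  r110 : s.reg 110 = i
  low : ∀ r < 4, s.reg r = ρ r

theorem Pre.set {m i : ℕ} {ρ : ℕ → ℕ} {s : State} (h : Pre m i ρ s) {r v : ℕ} (hr : 110 < r) :
    Pre m i ρ (s.set r v) := by
  have e : ∀ r' ≤ 110, (s.set r v).reg r' = s.reg r' :=
    fun r' _ => State.set_reg_of_ne _ _ (by omega)
  constructor
  all_goals first | rw [e _ (by decide)] | skip
  · exact h.r100
  · exact h.r101
  · exact h.r102
  · exact h.r103
  · exact h.r104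
  · exact h.r105
  · exact h.r108
  · exact h.r109
  · exact h.r110
  · exact fun r' hr' => by rw [e _ (by omega), h.low r' hr']

theorem Pre.filled {m i : ℕ} {M : ℕ → ℕ} {str : ℕ → List Bool} {ρ : ℕ → ℕ} {s s₁ : State} {k : ℕ}
    (h : Pre m i ρ s₁) (F : Filled m M str s₁ i k s) : Pre m i ρ s := by
  constructor
  all_goals first | rw [F.2 _ (by decide)] | skip
  · exact h.r100
  · exact h.r101
  · exact h.r102
  · exact h.r103
  · exact h.r104
  · exact h.r105
  · exact h.r108
  · exact h.r109
  · exact h.r110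
  · exact fun r' hr' => by rw [F.2 _ (by omega), h.low r' hr']

/-- The table entries of a nonterminal that derives a character. -/
def leafRow : Program :=
  blk [.assign 115 (.sub 108 113), putEntry 101 108, putEntry 102 113, putEntry 103 108,
    putEntry 104 115, putEntry 105 108]

/-- The table entries of a nonterminal that derives a pair, given the length of the left part in
register `119` and the rows for the right part in the registers `115`, …, `118`. -/
def pairEntries : Program :=
  blk [.assign 111 (.add 101 114), .assign 121 (.load 111), .assign 121 (.add 119 121),
    putEntry 101 121, combine 102 115, combine 103 116, combine 104 117, combine 105 118]

/-- The table entries of a nonterminal that derives a pair. -/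
def pairRow : Program :=
  blk [.assign 111 (.add 101 113), .assign 119 (.load 111), .assign 115 (.half 119),
    .assign 115 (.add 115 115), .assign 116 (.sub 119 115),
    .branch 109 116 (blk [mov 115 103, mov 116 102, mov 117 105, mov 118 104])
      (blk [mov 115 102, mov 116 103, mov 117 104, mov 118 105]),
    pairEntries]

section

variable {w m : ℕ} {M : ℕ → ℕ} {str : ℕ → List Bool} {ρ : ℕ → ℕ} {s : State} {i : ℕ}

theorem wp_leafRow (P : Pre m i ρ s) (T : Tab m M str i 0 s.mem) (hw : 8 * m + 2 ≤ 2 ^ w)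
    (hi : i < m) {b : Bool} (h : s.reg 113 = b.toNat) (hb : str i = [b]) :
    Wp w leafRow s fun t s' => t ≤ 17 ∧ Pre m i ρ s' ∧ Tab m M str i 5 s'.mem := by
  have hb' := Bool.toNat_le b
  rw [leafRow, wp_cons, wp_assign]
  simp only [Expr.eval, P.r108, h]
  refine ⟨by omega, ?_⟩
  have P' : Pre m i ρ (s.set 115 (1 - b.toNat)) := P.set (by decide)
  have h3 : (s.set 115 (1 - b.toNat)).reg 113 = b.toNat := h
  have h5 : (s.set 115 (1 - b.toNat)).reg 115 = 1 - b.toNat := by rw [State.set_reg, if_pos rfl]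
  have T' : Tab m M str i 0 (s.set 115 (1 - b.toNat)).mem := T
  generalize s.set 115 (1 - b.toNat) = s₁ at *
  have F : Filled m M str s₁ i 0 s₁ := ⟨T', fun _ _ => rfl⟩
  rw [wp_cons]
  refine (wp_putEntry F (by omega) (by decide) hi P'.r110 (by decide) P'.r101 (by decide) ?_).mono ?_
  · rw [P'.r108, hb]; rfl
  rintro _ s2 ⟨rfl, F⟩
  rw [wp_cons]
  refine (wp_putEntry F (by omega) (by decide) hi P'.r110 (by decide) P'.r102 (by decide) ?_).mono ?_
  · rw [F.2 _ (by decide), h3, hb]; cases b <;> rfl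
  rintro _ s3 ⟨rfl, F⟩
  rw [wp_cons]
  refine (wp_putEntry F (by omega) (by decide) hi P'.r110 (by decide) P'.r103 (by decide) ?_).mono ?_
  · rw [F.2 _ (by decide), P'.r108, hb]; cases b <;> rfl
  rintro _ s4 ⟨rfl, F⟩
  rw [wp_cons]
  refine (wp_putEntry F (by omega) (by decide) hi P'.r110 (by decide) P'.r104 (by decide) ?_).mono ?_
  · rw [F.2 _ (by decide), h5, hb]; cases b <;> rfl
  rintro _ s5 ⟨rfl, F⟩
  rw [wp_cons]
  refine (wp_putEntry F (by omega) (by decide) hi P'.r110 (by decide) P'.r105 (by decide) ?_).mono ?_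
  · rw [F.2 _ (by decide), P'.r108, hb]; cases b <;> rfl
  rintro _ s6 ⟨rfl, F⟩
  rw [wp_nil]
  exact ⟨by omega, P'.filled F, F.1⟩

theorem wp_pairRow (P : Pre m i ρ s) (T : Tab m M str i 0 s.mem) (hw : 8 * m + 2 ≤ 2 ^ w)
    (hi : i < m) {j j' : ℕ} (h : s.reg 113 = j) (h' : s.reg 114 = j') (hj : j < i) (hj' : j' < i)
    (hs : str i = str j ++ str j') (hl : (str i).length < 2 ^ w) :
    Wp w pairRow s fun t s' => t ≤ 90 ∧ Pre m i ρ s' ∧ Tab m M str i 5 s'.mem := by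
  obtain ⟨E0, E⟩ := entry_append (str j) (str j')
  rw [← hs] at E0 E
  rw [hs, List.length_append] at hl
  have e1 : s.mem ((3 + 0) * m + j) = (str j).length := T.2 0 (by decide) j (by omega) (.inl hj)
  have e2 : s.mem ((3 + 0) * m + j') = (str j').length := T.2 0 (by decide) j' (by omega) (.inl hj')
  -- the rows of the right part
  let K : ℕ → ℕ := fun k => (if (str j).length % 2 = 0 then k else k + 1 - k % 2 * 2) + 1
  -- The two branches differ only in the rows chosen for the right part. Written with K, the
  -- remaining program is treated once for both parities.
  suffices H : ∀ s₁ : State, Pre m i ρ s₁ → s₁.mem = s.mem → s₁.reg 113 = j → s₁.reg 114 = j' →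
      s₁.reg 119 = (str j).length → s₁.reg 115 = (3 + K 0) * m → s₁.reg 116 = (3 + K 1) * m →
      s₁.reg 117 = (3 + K 2) * m → s₁.reg 118 = (3 + K 3) * m →
      Wp w pairEntries s₁ fun t s' => t ≤ 60 ∧ Pre m i ρ s' ∧ Tab m M str i 5 s'.mem by
    rw [pairRow]
    simp only [wp_cons, wp_assign, wp_branch]
    simp (disch := decide) only [Expr.eval, State.set_reg, State.set_mem, Nat.reduceEqDiff, if_true,
      if_false, P.r101, P.r109, h, e1]
    refine ⟨by omega, by omega, by omega, by omega, by omega, ?_⟩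
    have P' := ((((P.set (r := 111) (v := (3 + 0) * m + j) (by decide)).set (r := 119)
      (v := (str j).length) (by decide)).set (r := 115) (v := (str j).length / 2) (by decide)).set
      (r := 115) (v := (str j).length / 2 + (str j).length / 2) (by decide)).set (r := 116)
      (v := (str j).length - ((str j).length / 2 + (str j).length / 2)) (by decide)
    generalize hs' : ((((s.set 111 ((3 + 0) * m + j)).set 119 (str j).length).set 115
      ((str j).length / 2)).set 115 ((str j).length / 2 + (str j).length / 2)).set 116
      ((str j).length - ((str j).length / 2 + (str j).length / 2)) = s' at P' ⊢
    have hm : s'.mem = s.mem := by rw [← hs']; rfl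
    have h1 : s'.reg 113 = j := by rw [← hs']; exact h
    have h2 : s'.reg 114 = j' := by rw [← hs']; exact h'
    have h3 : s'.reg 119 = (str j).length := by
      rw [← hs']; simp only [State.set_reg, Nat.reduceEqDiff, if_true, if_false]
    clear hs'
    split_ifs with hc
    · have hK : (str j).length % 2 = 1 := by omega
      simp (disch := decide) only [wp_nil, wp_mov, State.set_reg, Nat.reduceEqDiff,
        if_false, P'.r102, P'.r103, P'.r104, P'.r105]
      refine ⟨by omega, by omega, by omega, by omega, ?_⟩
      refine (H _ ((((P'.set ?_).set ?_).set ?_).set ?_) hm ?_ ?_ ?_ ?_ ?_ ?_ ?_).mono ?_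
      · decide
      · decide
      · decide
      · decide
      all_goals first
        | (simp only [State.set_reg, Nat.reduceEqDiff, if_true, if_false, h1, h2, h3, K, hK, one_ne_zero])
        | skip
      rintro t s' ⟨ht, hp⟩
      exact ⟨by omega, hp⟩
    · have hK : (str j).length % 2 = 0 := by omega
      simp (disch := decide) only [wp_nil, wp_mov, State.set_reg, Nat.reduceEqDiff,
        if_false, P'.r102, P'.r103, P'.r104, P'.r105]
      refine ⟨by omega, by omega, by omega, by omega, ?_⟩
      refine (H _ ((((P'.set ?_).set ?_).set ?_).set ?_) hm ?_ ?_ ?_ ?_ ?_ ?_ ?_).mono ?_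
      · decide
      · decide
      · decide
      · decide
      all_goals first
        | (simp only [State.set_reg, Nat.reduceEqDiff, if_true, if_false, h1, h2, h3, K, hK])
        | skip
      rintro t s' ⟨ht, hp⟩
      exact ⟨by omega, hp⟩
  intro s₁ P₁ hm h1 h2 h3 k0 k1 k2 k3
  have hK : ∀ k < 4, K k < 5 := by
    intro k hk
    simp only [K]
    split_ifs <;> omega
  rw [pairEntries]
  simp only [wp_cons, wp_assign]
  simp (disch := decide) only [Expr.eval, State.set_reg, State.set_mem, Nat.reduceEqDiff, if_true,
    if_false, P₁.r101, h2, h3, hm, e2]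
  refine ⟨by omega, by omega, by omega, ?_⟩
  have P2 := P₁.set (r := 111) (v := (3 + 0) * m + j') (by decide)
  replace k0 : (s₁.set 111 ((3 + 0) * m + j')).reg 115 = (3 + K 0) * m := k0
  replace k1 : (s₁.set 111 ((3 + 0) * m + j')).reg 116 = (3 + K 1) * m := k1
  replace k2 : (s₁.set 111 ((3 + 0) * m + j')).reg 117 = (3 + K 2) * m := k2
  replace k3 : (s₁.set 111 ((3 + 0) * m + j')).reg 118 = (3 + K 3) * m := k3
  replace h1 : (s₁.set 111 ((3 + 0) * m + j')).reg 113 = j := h1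
  replace h2 : (s₁.set 111 ((3 + 0) * m + j')).reg 114 = j' := h2
  replace h3 : (s₁.set 111 ((3 + 0) * m + j')).reg 119 = (str j).length := h3
  replace hm : (s₁.set 111 ((3 + 0) * m + j')).mem = s.mem := hm
  generalize s₁.set 111 ((3 + 0) * m + j') = s₁ at *
  have F : Filled m M str s₁ i 0 s₁ := ⟨hm ▸ T, fun _ _ => rfl⟩
  refine (wp_putEntry ((F.set (r := 121) (by decide)).set (r := 121) (by decide)) (by omega)
    (by decide) hi P2.r110 (by decide) P2.r101 (by decide) ?_).mono ?_
  · rw [State.set_reg, if_pos rfl, E0]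
  rintro _ s2 ⟨rfl, F⟩
  refine (wp_combine F (by omega) (by decide) hi P2.r110 (by decide) P2.r102 (by decide) k0
    (hK 0 (by decide)) h1 h2 hj hj' h3 hl (E 0 (by decide))).mono ?_
  rintro t2 s3 ⟨ht2, F⟩
  refine (wp_combine F (by omega) (by decide) hi P2.r110 (by decide) P2.r103 (by decide) k1
    (hK 1 (by decide)) h1 h2 hj hj' h3 hl (E 1 (by decide))).mono ?_
  rintro t3 s4 ⟨ht3, F⟩
  refine (wp_combine F (by omega) (by decide) hi P2.r110 (by decide) P2.r104 (by decide) k2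
    (hK 2 (by decide)) h1 h2 hj hj' h3 hl (E 2 (by decide))).mono ?_
  rintro t4 s5 ⟨ht4, F⟩
  refine (wp_combine F (by omega) (by decide) hi P2.r110 (by decide) P2.r105 (by decide) k3
    (hK 3 (by decide)) h1 h2 hj hj' h3 hl (E 3 (by decide))).mono ?_
  rintro t5 s6 ⟨ht5, F⟩
  rw [wp_nil]
  exact ⟨by omega, P2.filled F, F.1⟩

end

/-- Computes all table entries of the nonterminal whose index is in register `110`. -/
def row : Program :=
  blk [.assign 111 (.add 110 110), .assign 111 (.add 111 110), .assign 112 (.load 111),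
    .assign 111 (.add 111 108), .assign 113 (.load 111), .assign 111 (.add 111 108),
    .assign 114 (.load 111), .branch 112 108 leafRow pairRow, .assign 110 (.add 110 108)]

theorem wp_row {w m : ℕ} {M : ℕ → ℕ} {str : ℕ → List Bool} {ρ : ℕ → ℕ} {s : State} {i : ℕ}
    (R : Represents m M str) (P : Pre m i ρ s) (T : Tab m M str i 0 s.mem)
    (hw : 8 * m + 2 ≤ 2 ^ w) (hM : ∀ a, M a < 2 ^ w) (hi : i < m) (hl : (str i).length < 2 ^ w) :
    Wp w row s fun t s' => t ≤ 100 ∧ Pre m (i + 1) ρ s' ∧ Tab m M str (i + 1) 0 s'.mem := by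
  have m0 : s.mem (i + i + i) = M (3 * i) := by rw [← T.1 _ (by omega)]; congr 1; omega
  have m1 : s.mem (i + i + i + 1) = M (3 * i + 1) := by rw [← T.1 _ (by omega)]; congr 1; omega
  have m2 : s.mem (i + i + i + 1 + 1) = M (3 * i + 2) := by
    rw [← T.1 _ (by omega)]; congr 1; omega
  have b0 := hM (3 * i)
  have b1 := hM (3 * i + 1)
  have b2 := hM (3 * i + 2)
  rw [row]
  simp only [wp_cons, wp_assign, wp_branch]
  simp (disch := decide) only [Expr.eval, State.set_reg, State.set_mem, Nat.reduceEqDiff, if_true,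
    if_false, P.r110, P.r108, m0, m1, m2]
  refine ⟨by omega, by omega, b0, by omega, b1, by omega, b2, ?_⟩
  have P' := ((((((P.set (r := 111) (v := i + i) (by decide)).set (r := 111) (v := i + i + i)
    (by decide)).set (r := 112) (v := M (3 * i)) (by decide)).set (r := 111) (v := i + i + i + 1)
    (by decide)).set (r := 113) (v := M (3 * i + 1)) (by decide)).set (r := 111)
    (v := i + i + i + 1 + 1) (by decide)).set (r := 114) (v := M (3 * i + 2)) (by decide)
  generalize hs' : ((((((s.set 111 (i + i)).set 111 (i + i + i)).set 112 (M (3 * i))).set 111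
    (i + i + i + 1)).set 113 (M (3 * i + 1))).set 111 (i + i + i + 1 + 1)).set 114
    (M (3 * i + 2)) = s' at P' ⊢
  have T' : Tab m M str i 0 s'.mem := by rw [← hs']; exact T
  have h1 : s'.reg 113 = M (3 * i + 1) := by
    rw [← hs']; simp only [State.set_reg, Nat.reduceEqDiff, if_true, if_false]
  have h2 : s'.reg 114 = M (3 * i + 2) := by
    rw [← hs']; simp only [State.set_reg, if_true]
  clear hs'
  have fin : ∀ s'' : State, Pre m i ρ s'' → Tab m M str i 5 s''.mem →
      Pre m (i + 1) ρ (s''.set 110 (i + 1)) ∧ Tab m M str (i + 1) 0 (s''.set 110 (i + 1)).mem := by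
    intro s'' Q U
    refine ⟨⟨Q.r100, Q.r101, Q.r102, Q.r103, Q.r104, Q.r105, Q.r108, Q.r109, ?_, ?_⟩, U.next⟩
    · rw [State.set_reg, if_pos rfl]
    · exact fun r hr => by rw [State.set_reg_of_ne _ _ (by omega), Q.low r hr]
  rcases R i hi with ⟨g0, b, g1, g2⟩ | ⟨g0, g1, g2, g3⟩
  · rw [if_pos (by omega)]
    refine (wp_leafRow P' T' hw hi (h1.trans g1) g2).mono ?_
    rintro t s'' ⟨ht, Q, U⟩
    simp only [wp_nil, Q.r110, Q.r108]
    exact ⟨by omega, by omega, fin s'' Q U⟩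
  · rw [if_neg (by omega)]
    refine (wp_pairRow P' T' hw hi h1 h2 g1 g2 g3 hl).mono ?_
    rintro t s'' ⟨ht, Q, U⟩
    simp only [wp_nil, Q.r110, Q.r108]
    exact ⟨by omega, by omega, fin s'' Q U⟩

/-- The table of a grammar, and the constants that its traversal uses. -/
structure Table (m : ℕ) (M : ℕ → ℕ) (str : ℕ → List Bool) (s : State) : Prop where
  tab : Tab m M str m 0 s.mem
  r101 : s.reg 101 = (3 + 0) * m
  r102 : s.reg 102 = (3 + 1) * m
  r103 : s.reg 103 = (3 + 2) * m
  r104 : s.reg 104 = (3 + 3) * m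
  r105 : s.reg 105 = (3 + 4) * m
  r106 : s.reg 106 = (str (m - 1)).length + 1
  r107 : s.reg 107 = m - 1
  r108 : s.reg 108 = 1
  r109 : s.reg 109 = 0

/-- Computes the table of the grammar. -/
def fillTable : Program :=
  blk [mov 100 4, .assign 101 (.add 100 100), .assign 101 (.add 101 100),
    .assign 102 (.add 101 100), .assign 103 (.add 102 100), .assign 104 (.add 103 100),
    .assign 105 (.add 104 100), .assign 108 (.const 1), .assign 109 (.const 0),
    .assign 110 (.const 0), .loop 110 100 row, .assign 107 (.sub 100 108),
    .assign 106 (.add 101 107), .assign 106 (.load 106), .assign 106 (.add 106 108)]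

theorem wp_fillTable {w m : ℕ} {str : ℕ → List Bool} {s : State} (R : Represents m s.mem str)
    (hs : s.reg 4 = m) (hm : 0 < m) (hw : 8 * m + 2 ^ m + 2 ≤ 2 ^ w) (hM : ∀ a, s.mem a < 2 ^ w) :
    Wp w fillTable s fun t s' =>
      t ≤ 101 * m + 30 ∧ (∀ r < 4, s'.reg r = s.reg r) ∧ Table m s.mem str s' := by
  have hl : ∀ i < m, (str i).length < 2 ^ m := fun i hi =>
    (R.length_le hi).trans_lt (Nat.pow_lt_pow_right (by decide) hi)
  have h1 : 1 ≤ 2 ^ m := Nat.one_le_two_pow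
  rw [fillTable]
  simp only [wp_cons, wp_assign]
  simp (disch := decide) only [Expr.eval, wp_mov, State.set_reg, State.set_mem, Nat.reduceEqDiff,
    if_true, if_false, hs]
  refine ⟨by omega, by omega, by omega, by omega, by omega, by omega, by omega, by omega, by omega,
    by omega, ?_⟩
  have P : Pre m 0 s.reg ((((((((((s.set 100 m).set 101 (m + m)).set 101 (m + m + m)).set 102
      (m + m + m + m)).set 103 (m + m + m + m + m)).set 104 (m + m + m + m + m + m)).set 105
      (m + m + m + m + m + m + m)).set 108 1).set 109 0).set 110 0) := by
    constructor
    all_goals first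
      | (simp only [State.set_reg, Nat.reduceEqDiff, if_true, if_false]; first | done | omega)
      | skip
    intro r hr
    repeat rw [State.set_reg_of_ne _ _ (by omega)]
  generalize hs' : (((((((((s.set 100 m).set 101 (m + m)).set 101 (m + m + m)).set 102
      (m + m + m + m)).set 103 (m + m + m + m + m)).set 104 (m + m + m + m + m + m)).set 105
      (m + m + m + m + m + m + m)).set 108 1).set 109 0).set 110 0 = s' at P ⊢
  have T : Tab m s.mem str 0 0 s'.mem := by
    rw [← hs']
    exact ⟨fun _ _ => rfl, fun k hk i hi h => by omega⟩
  clear hs'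
  refine (wp_loop (fun s'' v => ∃ i, i ≤ m ∧ Pre m i s.reg s'' ∧ Tab m s.mem str i 0 s''.mem ∧
    101 * (m - i) ≤ v) ?_ (v := 101 * m) ⟨0, by omega, P, T, by omega⟩).mono ?_
  · rintro s'' v ⟨i, hi, Q, U, hv⟩ hc
    rw [Q.r110, Q.r100] at hc
    have := hl i hc
    refine (wp_row R Q U (by omega) hM hc (by omega)).mono ?_
    rintro t s₂ ⟨ht, Q', U'⟩
    exact ⟨101 * (m - (i + 1)), ⟨i + 1, hc, Q', U', le_rfl⟩, by omega⟩
  · rintro t s'' ⟨ht, ⟨v, i, hi, Q, U, -⟩, hc⟩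
    rw [Q.r110, Q.r100] at hc
    obtain rfl : i = m := by omega
    have e := U.2 0 (by decide) (i - 1) (by omega) (.inl (by omega))
    rw [show entry (str (i - 1)) 0 = (str (i - 1)).length from rfl] at e
    have := hl (i - 1) (by omega)
    simp (disch := decide) only [State.set_reg,
      wp_nil, Q.r100, Q.r101, Q.r108, e]
    refine ⟨by omega, by omega, by omega, by omega, by omega, ?_, ?_⟩
    · intro r hr
      iterate 4 rw [if_neg (by omega)]
      exact Q.low r hr
    · constructor
      · exact U
      all_goals simp only [State.set_reg, Nat.reduceEqDiff, if_true, if_false]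
      · exact Q.r101
      · exact Q.r102
      · exact Q.r103
      · exact Q.r104
      · exact Q.r105
      · exact Q.r108
      · exact Q.r109

/-! ## Walking down the grammar -/

/-- The first even offset at or after `o` at which `u` carries `x`, plus `B`, or `c` if there is none;
parities are relative to `o`. -/
def target (x B c o : ℕ) (u : List Bool) : ℕ :=
  if first x 0 (u.drop o) < u.length - o then B + o + first x 0 (u.drop o) else c

/-- An occurrence in the left part takes precedence; otherwise the first suitable one in the right
part, if any, replaces c as the fallback. An offset in v has even distance from o iff its parity is
that of |u| - o. -/
theorem target_left {x B c o : ℕ} {u v : List Bool} (h : o < u.length) :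
    target x B c o (u ++ v) = target x B (if first x ((u.length - o) % 2) v < v.length
      then B + u.length + first x ((u.length - o) % 2) v else c) o u := by
  have e : (u ++ v).drop o = u.drop o ++ v := List.drop_append_of_le_length h.le
  have l : (u.drop o).length = u.length - o := List.length_drop
  have p : first x ((u.length - o) % 2) v = first x (0 + (u.length - o)) v :=
    first_congr (by omega) v
  rw [target, target, e, first_append, l, List.length_append, p]
  split_ifs <;> omega

theorem target_right {x B c o : ℕ} {u v : List Bool} (h : u.length ≤ o) :
    target x B c o (u ++ v) = target x (B + u.length) c (o - u.length) v := by
  have e : (u ++ v).drop o = v.drop (o - u.length) := by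
    rw [List.drop_append, List.drop_eq_nil_of_le h, List.nil_append]
  rw [target, target, e, List.length_append]
  split_ifs <;> omega

/-- Since `first` returns the length in the absence of an occurrence, the initial fallback |S| + 1
agrees with the formula on the right, and no case distinction remains. -/
theorem target_start {x o : ℕ} {S : List Bool} (h : o < S.length) :
    target x 1 (S.length + 1) o S = o + 1 + first x 0 (S.drop o) := by
  have := first_le x 0 (S.drop o)
  rw [List.length_drop] at this
  rw [target]
  split_ifs <;> omega

theorem target_leaf {x B c : ℕ} (b : Bool) :
    target x B c 0 [b] = if first x 0 [b] < 1 then B else c := by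
  rw [target, List.drop_zero, List.length_singleton]
  split_ifs <;> omega

theorem entry_first {x : ℕ} (hx : x ≤ 1) (u : List Bool) :
    entry u (1 + 2 * x) = first x 0 u ∧ entry u (2 + 2 * x) = first x 1 u := by
  interval_cases x <;> exact ⟨rfl, rfl⟩

/-- Goes to the left part, whose length is in register `96`, after updating the candidate in
register `87` by means of the entry for the right part in the row that register `97` contains. -/
def goLeft : Program :=
  blk [.assign 97 (.add 97 95), .assign 97 (.load 97), .assign 98 (.add 101 95),
    .assign 98 (.load 98),
    .branch 97 98 (blk [.assign 87 (.add 91 96), .assign 87 (.add 87 97)]) .skip, mov 89 94]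

/-- Selects the row for the parity of the distance from the offset to the end of the left part. -/
def selectRow : Program :=
  blk [.assign 98 (.sub 96 90), .assign 97 (.half 98), .assign 97 (.add 97 97),
    .assign 97 (.sub 98 97), .branch 109 97 (mov 97 86) (mov 97 85)]

/-- Goes to the right part. -/
def goRight : Program := blk [.assign 90 (.sub 90 96), .assign 91 (.add 91 96), mov 89 95]

/-- Loads the type of the nonterminal in register `89`. -/
def loadType : Program :=
  blk [.assign 92 (.add 89 89), .assign 92 (.add 92 89), .assign 92 (.load 92)]

/-- Loads the parts of the nonterminal in register `89` and the length of the left one. -/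
def loadParts : Program :=
  blk [.assign 93 (.add 89 89), .assign 93 (.add 93 89), .assign 93 (.add 93 108),
    .assign 94 (.load 93), .assign 93 (.add 93 108), .assign 95 (.load 93),
    .assign 96 (.add 101 94), .assign 96 (.load 96)]

/-- One step down from the nonterminal in register `89`. -/
def descendStep : Program :=
  blk [loadParts, .branch 90 96 (blk [selectRow, goLeft]) goRight, loadType]

/-- The walk has reached the nonterminal `i`, whose occurrence starts at position `B`; it looks for the
first occurrence at or after the offset `o`, and `c` is the answer if there is none below `i`. -/
structure Walk (m n : ℕ) (M : ℕ → ℕ) (str : ℕ → List Bool) (x V : ℕ) (s₀ : State)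
    (i o B c : ℕ) (s : State) : Prop where
  agree : Agree 87 s₀ s
  lt : i < m
  off : o < (str i).length
  base : B + (str i).length ≤ n + 1
  cand : c ≤ n + 1
  value : V = target x B c o (str i)
  r87 : s.reg 87 = c
  r89 : s.reg 89 = i
  r90 : s.reg 90 = o
  r91 : s.reg 91 = B

/-- `Agree` protects the memory and the registers from 100 on for every `lo`, and the table uses
nothing else. -/
theorem Table.agree {m lo : ℕ} {M : ℕ → ℕ} {str : ℕ → List Bool} {s s' : State}
    (T : Table m M str s) (h : Agree lo s s') : Table m M str s' := by
  constructor
  · exact h.1 ▸ T.tab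
  all_goals rw [h.2 _ (.inr (by decide))]
  · exact T.r101
  · exact T.r102
  · exact T.r103
  · exact T.r104
  · exact T.r105
  · exact T.r106
  · exact T.r107
  · exact T.r108
  · exact T.r109

section

variable {w m n : ℕ} {M : ℕ → ℕ} {str : ℕ → List Bool} {x V : ℕ} {s₀ s : State} {i o B c j j' : ℕ}

theorem wp_loadType (R : Represents m M str) (T : Table m M str s₀) (hw : 8 * m + 4 * n + 16 < 2 ^ w)
    (W : Walk m n M str x V s₀ i o B c s) :
    Wp w loadType s fun t s' => t = 4 ∧ Walk m n M str x V s₀ i o B c s' ∧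
      s'.reg 92 = M (3 * i) := by
  have h : s.mem (i + i + i) = M (3 * i) ∧ M (3 * i) ≤ 1 := by
    have lt := W.lt
    refine ⟨by rw [W.agree.1, ← T.tab.1 _ (by omega)]; congr 1; omega, ?_⟩
    rcases R i lt with h | h <;> omega
  obtain ⟨A, lt, off, base, cand, value, r87, r89, r90, r91⟩ := W
  rw [loadType]
  simp only [wp_cons, wp_nil, wp_assign, Expr.eval, State.set_reg, State.set_mem, Nat.reduceEqDiff,
    if_true, if_false, r89, h.1]
  refine ⟨by omega, by omega, by omega, by trivial, ⟨?_, lt, off, base, cand, value, r87, r89, r90,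
    r91⟩, trivial⟩
  repeat refine Agree.set ?_ (by decide) (by decide)
  exact A

theorem wp_loadParts (T : Table m M str s₀) (hw : 8 * m + 4 * n + 16 < 2 ^ w)
    (W : Walk m n M str x V s₀ i o B c s) (hj : M (3 * i + 1) < i) (hj' : M (3 * i + 2) < i)
    (hl : (str (M (3 * i + 1))).length ≤ n + 1) :
    Wp w loadParts s fun t s' => t = 9 ∧ Walk m n M str x V s₀ i o B c s' ∧
      s'.reg 94 = M (3 * i + 1) ∧ s'.reg 95 = M (3 * i + 2) ∧
      s'.reg 96 = (str (M (3 * i + 1))).length := by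
  have T' := T.agree W.agree
  obtain ⟨A, lt, off, base, cand, value, r87, r89, r90, r91⟩ := W
  have m1 : s.mem (i + i + i + 1) = M (3 * i + 1) := by rw [← T'.tab.1 _ (by omega)]; congr 1; omega
  have m2 : s.mem (i + i + i + 1 + 1) = M (3 * i + 2) := by
    rw [← T'.tab.1 _ (by omega)]; congr 1; omega
  have m3 : s.mem ((3 + 0) * m + M (3 * i + 1)) = (str (M (3 * i + 1))).length :=
    T'.tab.2 0 (by decide) _ (by omega) (.inl (by omega))
  rw [loadParts]
  simp only [wp_cons, wp_nil, wp_assign, Expr.eval, State.set_reg, State.set_mem, Nat.reduceEqDiff,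
    if_true, if_false, r89, T'.r101, T'.r108, m1, m2, m3]
  refine ⟨by omega, by omega, by omega, by omega, by omega, by omega, by omega, by omega, by trivial,
    ⟨?_, lt, off, base, cand, value, r87, r89, r90, r91⟩, trivial, trivial, trivial⟩
  repeat refine Agree.set ?_ (by decide) (by decide)
  exact A

theorem wp_goRight (hw : 8 * m + 4 * n + 16 < 2 ^ w) (W : Walk m n M str x V s₀ i o B c s)
    (hj' : j' < i) (hs : str i = str j ++ str j') (h95 : s.reg 95 = j')
    (h96 : s.reg 96 = (str j).length) (hc : (str j).length ≤ o) :
    Wp w goRight s fun t s' => t ≤ 5 ∧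
      Walk m n M str x V s₀ j' (o - (str j).length) (B + (str j).length) c s' := by
  obtain ⟨A, lt, off, base, cand, value, r87, r89, r90, r91⟩ := W
  rw [hs, List.length_append] at off base
  rw [hs, target_right hc] at value
  rw [goRight]
  simp (disch := decide) only [wp_cons, wp_nil, wp_assign, wp_mov, Expr.eval, State.set_reg,
    Nat.reduceEqDiff, if_false, r90, r91, h95, h96]
  refine ⟨by omega, by omega, by omega, by omega, ?_, by omega, by omega, by omega, cand, value,
    ?_, ?_, ?_, ?_⟩
  · repeat refine Agree.set ?_ (by decide) (by decide)
    exact A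
  all_goals simp only [State.set_reg, Nat.reduceEqDiff, if_true, if_false, r87]

theorem wp_selectRow (T : Table m M str s₀) (W : Walk m n M str x V s₀ i o B c s)
    (h85 : s₀.reg 85 = (3 + (1 + 2 * x)) * m) (h86 : s₀.reg 86 = (3 + (2 + 2 * x)) * m)
    (hx : x ≤ 1) (hw : 8 * m + 4 * n + 16 < 2 ^ w) {l : ℕ} (h96 : s.reg 96 = l)
    (hl : l ≤ n + 1) :
    Wp w selectRow s fun t s' => t ≤ 8 ∧ Walk m n M str x V s₀ i o B c s' ∧
      s'.reg 94 = s.reg 94 ∧ s'.reg 95 = s.reg 95 ∧ s'.reg 96 = l ∧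
      s'.reg 97 = (3 + (1 + (l - o) % 2 + 2 * x)) * m := by
  have T' := T.agree W.agree
  have a85 := (W.agree.reg (r := 85) (by decide)).trans h85
  have a86 := (W.agree.reg (r := 86) (by decide)).trans h86
  obtain ⟨A, lt, off, base, cand, value, r87, r89, r90, r91⟩ := W
  have x1 : (3 + (1 + 2 * x)) * m ≤ 6 * m := Nat.mul_le_mul_right _ (by omega)
  have x2 : (3 + (2 + 2 * x)) * m ≤ 7 * m := Nat.mul_le_mul_right _ (by omega)
  rw [selectRow]
  simp (disch := decide) only [wp_cons, wp_nil, wp_assign, wp_branch, wp_mov, Expr.eval,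
    State.set_reg, Nat.reduceEqDiff, if_true, if_false, r90, a85, a86, h96, T'.r109]
  refine ⟨by omega, by omega, by omega, by omega, ?_⟩
  split_ifs with h
  · rw [show (l - o) % 2 = 1 by omega]
    refine ⟨by omega, by decide, ⟨?_, lt, off, base, cand, value, r87, r89, r90, r91⟩, trivial,
      trivial, trivial, rfl⟩
    repeat refine Agree.set ?_ (by decide) (by decide)
    exact A
  · rw [show (l - o) % 2 = 0 by omega]
    refine ⟨by omega, by decide, ⟨?_, lt, off, base, cand, value, r87, r89, r90, r91⟩, trivial,
      trivial, trivial, rfl⟩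
    repeat refine Agree.set ?_ (by decide) (by decide)
    exact A

theorem wp_goLeft (T : Table m M str s₀) (hw : 8 * m + 4 * n + 16 < 2 ^ w) (hx : x ≤ 1)
    (W : Walk m n M str x V s₀ i o B c s)
    (hj : j < i) (hj' : j' < i) (hs : str i = str j ++ str j') (h94 : s.reg 94 = j)
    (h95 : s.reg 95 = j') (h96 : s.reg 96 = (str j).length)
    (h97 : s.reg 97 = (3 + (1 + ((str j).length - o) % 2 + 2 * x)) * m)
    (hc : o < (str j).length) :
    Wp w goLeft s fun t s' => t ≤ 11 ∧ ∃ c', Walk m n M str x V s₀ j o B c' s' := by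
  have T' := T.agree W.agree
  obtain ⟨A, lt, off, base, cand, value, r87, r89, r90, r91⟩ := W
  have hp : ((str j).length - o) % 2 < 2 := Nat.mod_lt _ (by decide)
  rw [hs, List.length_append] at off base
  rw [hs, target_left hc] at value
  generalize ((str j).length - o) % 2 = p at hp h97 value
  have x1 : (3 + (1 + p + 2 * x)) * m ≤ 7 * m := Nat.mul_le_mul_right _ (by omega)
  have m4 : s.mem ((3 + 0) * m + j') = (str j').length :=
    T'.tab.2 0 (by decide) _ (by omega) (.inl (by omega))
  have m5 : s.mem ((3 + (1 + p + 2 * x)) * m + j') = first x p (str j') := by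
    rw [T'.tab.2 (1 + p + 2 * x) (by omega) j' (by omega) (.inl (by omega))]
    interval_cases p
    · exact (entry_first hx _).1
    · exact (entry_first hx _).2
  have f1 := first_le x p (str j')
  generalize first x p (str j') = f at *
  rw [goLeft]
  simp (disch := decide) only [wp_cons, wp_nil, wp_assign, wp_branch, wp_mov, wp_skip, Expr.eval,
    State.set_reg, State.set_mem, Nat.reduceEqDiff, if_true, if_false, r91, h94, h95, h96, h97,
    T'.r101, m4, m5]
  refine ⟨by omega, by omega, by omega, by omega, ?_⟩
  split_ifs at value ⊢ with hf
  · refine ⟨by omega, by omega, by omega, by omega, B + (str j).length + f, ?_, by omega, hc,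
      by omega, by omega, value, ?_, ?_, ?_, ?_⟩
    · repeat refine Agree.set ?_ (by decide) (by decide)
      exact A
    all_goals simp only [State.set_reg, Nat.reduceEqDiff, if_true, if_false, r90, r91]
  · refine ⟨by omega, by omega, c, ?_, by omega, hc, by omega, cand, value, ?_, ?_, ?_, ?_⟩
    · repeat refine Agree.set ?_ (by decide) (by decide)
      exact A
    all_goals simp only [State.set_reg, Nat.reduceEqDiff, if_true, if_false, r87, r90, r91]

/-- The field `value` of `Walk` is invariant by `target_left` and `target_right`. Information about
the right part is folded into the candidate before the walk turns left, so no stack is needed. -/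
theorem wp_descendStep (R : Represents m M str) (T : Table m M str s₀)
    (h85 : s₀.reg 85 = (3 + (1 + 2 * x)) * m) (h86 : s₀.reg 86 = (3 + (2 + 2 * x)) * m)
    (hx : x ≤ 1) (hw : 8 * m + 4 * n + 16 < 2 ^ w) (W : Walk m n M str x V s₀ i o B c s)
    (hi : M (3 * i) = 1) :
    Wp w descendStep s fun t s' => t ≤ 40 ∧ ∃ i' o' B' c', i' < i ∧
      Walk m n M str x V s₀ i' o' B' c' s' ∧ s'.reg 92 = M (3 * i') := by
  rcases R i W.lt with ⟨g0, -⟩ | ⟨-, g1, g2, g3⟩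
  · omega
  have hb := W.base
  rw [g3, List.length_append] at hb
  rw [descendStep, wp_cons]
  refine (wp_loadParts T hw W g1 g2 (by omega)).mono ?_
  rintro _ s1 ⟨rfl, W, h94, h95, h96⟩
  rw [wp_cons, wp_branch]
  split_ifs with hc
  · rw [h96, W.r90] at hc
    rw [wp_cons]
    refine (wp_selectRow T W h85 h86 hx hw h96 (by omega)).mono ?_
    rintro t2 s2 ⟨ht2, W, k94, k95, k96, k97⟩
    rw [wp_cons]
    refine (wp_goLeft T hw hx W g1 g2 g3 (k94.trans h94) (k95.trans h95) k96 k97 hc).mono ?_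
    rintro t3 s3 ⟨ht3, c', W⟩
    rw [wp_nil, wp_cons]
    refine (wp_loadType R T hw W).mono ?_
    rintro _ s4 ⟨rfl, W, h92⟩
    rw [wp_nil]
    exact ⟨by omega, _, _, _, _, g1, W, h92⟩
  · rw [h96, W.r90, not_lt] at hc
    refine (wp_goRight hw W g2 g3 h95 h96 hc).mono ?_
    rintro t3 s3 ⟨ht3, W⟩
    rw [wp_cons]
    refine (wp_loadType R T hw W).mono ?_
    rintro _ s4 ⟨rfl, W, h92⟩
    rw [wp_nil]
    exact ⟨by omega, _, _, _, _, g2, W, h92⟩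

end

/-- The first occurrence at an even distance from the position in register `88`, for the character
whose rows are in the registers `85` and `86`. The result is in register `87`. -/
def descend : Program :=
  .branch 88 106
    (blk [mov 87 106, mov 89 107, .assign 90 (.sub 88 108), mov 91 108, loadType,
      .loop 109 92 descendStep, .assign 93 (.add 85 89), .assign 93 (.load 93),
      .branch 93 108 (mov 87 91) .skip])
    (mov 87 88)

theorem wp_descend {w m n : ℕ} {M : ℕ → ℕ} {str : ℕ → List Bool} {x st : ℕ} {s : State}
    (R : Represents m M str) (T : Table m M str s) (hm : 0 < m) (hn : n = (str (m - 1)).length)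
    (h85 : s.reg 85 = (3 + (1 + 2 * x)) * m) (h86 : s.reg 86 = (3 + (2 + 2 * x)) * m)
    (hx : x ≤ 1) (hw : 8 * m + 4 * n + 32 < 2 ^ w) (hs : s.reg 88 = st) (h1 : 1 ≤ st)
    (h2 : st ≤ 4 * n + 17) :
    Wp w descend s fun t s' => t ≤ 41 * m + 30 ∧ Agree 87 s s' ∧
      s'.reg 87 = st + first x 0 ((str (m - 1)).drop (st - 1)) := by
  have r106 := T.r106
  rw [← hn] at r106
  rw [descend, wp_branch, hs, r106]
  split_ifs with hc
  · obtain ⟨o, rfl⟩ : ∃ o, st = o + 1 := ⟨st - 1, by omega⟩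
    rw [Nat.add_sub_cancel, ← target_start (by omega)]
    simp (disch := decide) only [wp_cons, wp_mov, wp_assign, Expr.eval, State.set_reg,
      Nat.reduceEqDiff, if_true, if_false, r106, T.r107, T.r108, hs, Nat.add_sub_cancel]
    refine ⟨by omega, by omega, by omega, by omega, ?_⟩
    have W : Walk m n M str x (target x 1 (n + 1) o (str (m - 1))) s (m - 1) o 1 (n + 1)
        ((((s.set 87 (n + 1)).set 89 (m - 1)).set 90 o).set 91 1) := by
      refine ⟨?_, by omega, by omega, by omega, by omega, rfl, ?_, ?_, ?_, ?_⟩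
      · repeat refine Agree.set ?_ (by decide) (by decide)
        exact Agree.refl _ _
      all_goals simp only [State.set_reg, Nat.reduceEqDiff, if_true, if_false]
    rw [← hn]
    generalize target x 1 (n + 1) o (str (m - 1)) = V at *
    generalize (((s.set 87 (n + 1)).set 89 (m - 1)).set 90 o).set 91 1 = s1 at W ⊢
    refine (wp_loadType R T (by omega) W).mono ?_
    rintro _ s2 ⟨rfl, W, h92⟩
    -- The index of the nonterminal decreases with each step, which bounds the number of levels by
    -- m; a level costs at most 40 steps and the loop test.
    refine (wp_loop (fun s' v => ∃ i o B c, Walk m n M str x V s i o B c s' ∧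
      s'.reg 92 = M (3 * i) ∧ 41 * i ≤ v) ?_ (v := 41 * m)
      ⟨_, _, _, _, W, h92, by omega⟩).mono ?_
    · rintro s' v ⟨i, o, B, c, W, h92, hv⟩ hc
      have T' := T.agree W.agree
      have hi : M (3 * i) = 1 := by
        rw [T'.r109, h92] at hc
        rcases R i W.lt with h | h <;> omega
      refine (wp_descendStep R T h85 h86 hx (by omega) W hi).mono ?_
      rintro t s'' ⟨ht, i', o', B', c', hlt, W, h92⟩
      exact ⟨41 * i', ⟨i', o', B', c', W, h92, le_rfl⟩, by omega⟩
    · rintro t s' ⟨ht, ⟨v, i, o, B, c, W, h92, -⟩, hc⟩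
      have T' := T.agree W.agree
      have a85 := (W.agree.reg (r := 85) (by decide)).trans h85
      rw [T'.r109, h92] at hc
      obtain ⟨A, lt, off, base, cand, value, r87, r89, r90, r91⟩ := W
      obtain ⟨-, b, -, hb⟩ : M (3 * i) = 0 ∧ ∃ b : Bool, M (3 * i + 1) = b.toNat ∧ str i = [b] := by
        rcases R i lt with h | h
        · exact h
        · omega
      have x1 : (3 + (1 + 2 * x)) * m ≤ 6 * m := Nat.mul_le_mul_right _ (by omega)
      have m1 : s'.mem ((3 + (1 + 2 * x)) * m + i) = first x 0 (str i) := by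
        rw [T'.tab.2 (1 + 2 * x) (by omega) i lt (.inl lt), (entry_first hx _).1]
      rw [hb, List.length_singleton] at off base
      obtain rfl : o = 0 := by omega
      rw [hb, target_leaf] at value
      have f1 := first_le x 0 [b]
      rw [List.length_singleton] at f1
      rw [hb] at m1
      simp (disch := decide) only [wp_nil, wp_mov, wp_branch, wp_skip,
        State.set_reg, State.set_mem, Nat.reduceEqDiff, if_true, if_false, r89, r91,
        a85, m1, T'.r108]
      refine ⟨by omega, by omega, ?_⟩
      split_ifs at value ⊢ with hf
      · refine ⟨by omega, by omega, ?_, value.symm⟩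
        repeat refine Agree.set ?_ (by decide) (by decide)
        exact A
      · refine ⟨by omega, ?_, r87.trans value.symm⟩
        repeat refine Agree.set ?_ (by decide) (by decide)
        exact A
  · rw [wp_mov (by decide), hs, List.drop_eq_nil_of_le (by omega)]
    refine ⟨by omega, by omega, ?_, ?_⟩
    · exact (Agree.refl _ _).set (by decide) (by decide)
    · rw [State.set_reg, if_pos rfl]
      rfl

/-! ### Next occurrences in a compressed string -/

/-- Finds next occurrences in a string given by a grammar. -/
def gramNext : Program :=
  blk [.branch 80 108 (blk [mov 85 102, mov 86 103]) (blk [mov 85 104, mov 86 105]), mov 88 81,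
    descend, mov 84 87,
    .branch 108 83 .skip (blk [.assign 88 (.add 81 108), descend,
      .branch 87 84 (mov 84 87) .skip])]

theorem isNext_first_of_le {S : List Bool} {x st lim : ℕ} (h1 : 1 ≤ st) (hl : lim ≤ S.length) :
    IsNext (chr S) x st lim 2 (st + first x 0 (S.drop (st - 1))) := by
  by_cases h2 : st ≤ S.length
  · exact (isNext_first h1 h2).mono hl
  · rw [List.drop_eq_nil_of_le (by omega)]
    exact ⟨by omega, fun k hk hk' => absurd hk' (by rw [first]; omega), by omega⟩

/-- At most two descents are made, one for each parity, and their cost does not depend on the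
distance covered. Hence B = 0, so exponentially long intervals do no harm. -/
theorem nextSpec_gramNext {w m n : ℕ} {M : ℕ → ℕ} {str : ℕ → List Bool} {s₀ : State}
    (R : Represents m M str) (T : Table m M str s₀) (hm : 0 < m) (hn : n = (str (m - 1)).length)
    (hw : 64 * n + 8 * m + 256 < 2 ^ w) :
    NextSpec s₀ w n (chr (str (m - 1))) gramNext (82 * m + 90) 0 := by
  refine ⟨by omega, by omega, chr_le _, ?_⟩
  intro s x st lim step A h80 h81 h82 h83 hx h1 h2 hl hstep
  have T₁ := T.agree A
  have N1 := isNext_first_of_le (x := x) h1 (hl.trans hn.le)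
  have N2 := isNext_first_of_le (x := x) (st := st + 1) (by omega) (hl.trans hn.le)
  have f1 := first_le x 0 ((str (m - 1)).drop (st - 1))
  have f2 := first_le x 0 ((str (m - 1)).drop (st + 1 - 1))
  rw [List.length_drop, ← hn] at f1 f2
  have b1 : st + first x 0 ((str (m - 1)).drop (st - 1)) ≤ max st (n + 2) := by
    clear N1 N2; omega
  have b2 : st + 1 + first x 0 ((str (m - 1)).drop (st + 1 - 1)) ≤ max (st + 1) (n + 2) := by
    clear N1 N2; omega
  clear f1 f2
  have H : ∀ {t : ℕ} {s' : State}, t ≤ 82 * m + 90 → Agree 80 s s' →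
      IsNext (chr (str (m - 1))) x st lim step (s'.reg 84) →
      s'.reg 84 ≤ max st (n + 2) → Agree 80 s s' ∧
      IsNext (chr (str (m - 1))) x st lim step (s'.reg 84) ∧ s'.reg 84 ≤ max st (n + 2) ∧
      ∃ μ, t ≤ (82 * m + 90) + 0 * μ ∧ μ ≤ min (s'.reg 84) (lim + 2) - st :=
    fun ht a b c => ⟨a, b, c, 0, by omega, Nat.zero_le _⟩
  have key : ∀ s1, Agree 85 s s1 → s1.reg 85 = (3 + (1 + 2 * x)) * m →
      s1.reg 86 = (3 + (2 + 2 * x)) * m →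
      Wp w (blk [mov 88 81, descend, mov 84 87,
        .branch 108 83 .skip (blk [.assign 88 (.add 81 108), descend,
          .branch 87 84 (mov 84 87) .skip])]) s1 fun t s' => t ≤ 82 * m + 80 ∧ Agree 80 s s' ∧
        IsNext (chr (str (m - 1))) x st lim step (s'.reg 84) ∧ s'.reg 84 ≤ max st (n + 2) := by
    intro s1 A1 h85 h86
    rw [wp_cons, wp_mov (by decide), A1.reg (by decide), h81]
    refine ⟨by omega, ?_⟩
    have A2 : Agree 85 s (s1.set 88 st) := A1.set (by decide) (by decide)
    rw [wp_cons]
    refine (wp_descend R (T₁.agree A2) hm hn h85 h86 hx (by omega)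
      (by rw [State.set_reg, if_pos rfl]) h1 (by omega)).mono ?_
    rintro t2 s2 ⟨ht2, A3, k87⟩
    generalize st + first x 0 ((str (m - 1)).drop (st - 1)) = q at *
    rw [wp_cons, wp_mov (by decide), k87]
    refine ⟨by omega, ?_⟩
    have k85 : (s2.set 84 q).reg 85 = (3 + (1 + 2 * x)) * m := (A3.reg (by decide)).trans h85
    have k86 : (s2.set 84 q).reg 86 = (3 + (2 + 2 * x)) * m := (A3.reg (by decide)).trans h86
    have A4 : Agree 84 s (s2.set 84 q) :=
      ((A2.mono (by decide)).trans (A3.mono (by decide))).set (by decide) (by decide)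
    have k84 : (s2.set 84 q).reg 84 = q := by rw [State.set_reg, if_pos rfl]
    generalize s2.set 84 q = s3 at *
    clear A1 A2 A3 k87 h85 h86
    have T3 := T₁.agree A4
    have k81 : s3.reg 81 = st := (A4.reg (by decide)).trans h81
    have k83 : s3.reg 83 = step := (A4.reg (by decide)).trans h83
    rw [wp_cons, wp_branch, T3.r108, k83]
    rcases hstep with rfl | rfl
    · rw [if_neg (by decide), wp_cons, wp_assign]
      simp only [Expr.eval, k81, T3.r108]
      refine ⟨by omega, ?_⟩
      have A5 : Agree 85 s3 (s3.set 88 (st + 1)) :=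
        (Agree.refl _ _).set (by decide) (by decide)
      rw [wp_cons]
      refine (wp_descend R (T3.agree A5) hm hn k85 k86 hx (by omega)
        (by rw [State.set_reg, if_pos rfl]) (by omega) (by omega)).mono ?_
      rintro t4 s4 ⟨ht4, A6, k87⟩
      generalize st + 1 + first x 0 ((str (m - 1)).drop (st + 1 - 1)) = q' at *
      have A7 : Agree 84 s s4 := A4.trans ((A5.mono (by decide)).trans (A6.mono (by decide)))
      have j84 : s4.reg 84 = q :=
        (A6.reg (by decide)).trans ((A5.reg (by decide)).trans k84)
      have Nq := N1.min N2
      clear N1 N2 A5 A6 A4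
      rw [wp_cons, wp_branch, k87, j84]
      split_ifs with hq
      · rw [min_eq_right hq.le] at Nq
        rw [wp_mov (by decide), k87]
        refine ⟨by omega, ?_⟩
        simp only [wp_nil, State.set_reg, if_true]
        exact ⟨by omega, (A7.mono (by decide)).set (by decide) (by decide), Nq, by omega⟩
      · rw [min_eq_left (by omega)] at Nq
        simp only [wp_nil, wp_skip, j84]
        exact ⟨by omega, A7.mono (by decide), Nq, by omega⟩
    · rw [if_pos (by decide), wp_skip, wp_nil, k84]
      exact ⟨by omega, A4.mono (by decide), N1, by omega⟩
  rw [gramNext, wp_cons, wp_branch, h80, T₁.r108]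
  split_ifs with hc
  · obtain rfl : x = 0 := by omega
    have e1 := T₁.r102
    have e2 := T₁.r103
    have l1 : (3 + 1) * m < 2 ^ w ∧ (3 + 2) * m < 2 ^ w := by omega
    rw [wp_cons, wp_mov (by decide), wp_cons, wp_mov (by decide),
      State.set_reg_of_ne _ _ (by decide), e1, e2, wp_nil]
    refine ⟨l1.1, l1.2, (key _ (((Agree.refl _ _).set (by decide) (by decide)).set (by decide)
      (by decide)) ?_ ?_).mono fun t s' h => H (by omega) h.2.1 h.2.2.1 h.2.2.2⟩
    · simp only [State.set_reg, Nat.reduceEqDiff, if_true, if_false]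
    · simp only [State.set_reg, if_true]
  · obtain rfl : x = 1 := by omega
    have e1 := T₁.r104
    have e2 := T₁.r105
    have l1 : (3 + 3) * m < 2 ^ w ∧ (3 + 4) * m < 2 ^ w := by omega
    rw [wp_cons, wp_mov (by decide), wp_cons, wp_mov (by decide),
      State.set_reg_of_ne _ _ (by decide), e1, e2, wp_nil]
    refine ⟨l1.1, l1.2, (key _ (((Agree.refl _ _).set (by decide) (by decide)).set (by decide)
      (by decide)) ?_ ?_).mono fun t s' h => H (by omega) h.2.1 h.2.2.1 h.2.2.2⟩
    · simp only [State.set_reg, Nat.reduceEqDiff, if_true, if_false]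
    · simp only [State.set_reg, if_true]

/-! ### The input grammar and the polynomial time bound -/

/-- The string derived from the nonterminal `i`. -/
def grammarString (G : SLGrammar Bool) (i : ℕ) : List Bool :=
  if h : i < G.size then G.derive i h else []

theorem grammarString_eq (G : SLGrammar Bool) {i : ℕ} (h : i < G.size) :
    grammarString G i = G.derive i h := dif_pos h

theorem grammarString_start (G : SLGrammar Bool) : grammarString G (G.size - 1) = G.string :=
  grammarString_eq G _

theorem inputGrammar_mem (G : SLGrammar Bool) (L R : IndexInterval G.string.length) {i k : ℕ}
    (hi : i < G.size) (hk : k < 3) : (inputGrammar G L R).mem (3 * i + k) =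
      match G.rhs ⟨i, hi⟩ with
      | Sum.inl b => if k = 1 then b.toNat else 0
      | Sum.inr (j, j') => if k = 0 then 1 else if k = 1 then j else j' := by
  obtain ⟨a, ha⟩ : ∃ a, a = 3 * i + k := ⟨_, rfl⟩
  rw [← ha]
  obtain rfl : a / 3 = i := by omega
  obtain rfl : a % 3 = k := by omega
  simp only [inputGrammar, hi, dite_true]
  rcases G.rhs ⟨a / 3, hi⟩ with b | ⟨j, j'⟩ <;> rfl

theorem represents_inputGrammar (G : SLGrammar Bool) (L R : IndexInterval G.string.length) :
    Represents G.size (inputGrammar G L R).mem (grammarString G) := by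
  intro i hi
  have m0 := inputGrammar_mem G L R hi (k := 0) (by decide)
  have m1 := inputGrammar_mem G L R hi (k := 1) (by decide)
  have m2 := inputGrammar_mem G L R hi (k := 2) (by decide)
  have hd := grammarString_eq G hi
  rw [SLGrammar.derive] at hd
  rw [Nat.add_zero] at m0
  rcases hG : G.rhs ⟨i, hi⟩ with b | ⟨j, j'⟩
  · simp only [hG] at m0 m1 hd
    exact .inl ⟨m0, b, m1, hd⟩
  · simp only [hG] at m0 m1 m2 hd
    refine .inr ⟨m0, m1 ▸ j.isLt, m2 ▸ j'.isLt, ?_⟩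
    rw [hd]
    simp only [m1, m2, if_true, if_false, one_ne_zero, OfNat.ofNat_ne_one, OfNat.ofNat_ne_zero,
      grammarString_eq G (j.isLt.trans hi), grammarString_eq G (j'.isLt.trans hi)]

theorem inputGrammar_mem_le (G : SLGrammar Bool) (L R : IndexInterval G.string.length) (a : ℕ) :
    (inputGrammar G L R).mem a ≤ G.size := by
  have hp := G.size_pos
  by_cases h : a / 3 < G.size
  · simp only [inputGrammar, h, dite_true]
    rcases G.rhs ⟨a / 3, h⟩ with b | ⟨j, j'⟩
    · have := Bool.toNat_le b
      dsimp only
      split_ifs <;> omega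
    · have h1 := j.isLt
      have h2 := j'.isLt
      dsimp only at h1 h2 ⊢
      split_ifs <;> omega
  · simp only [inputGrammar, h, dite_false, Nat.zero_le]

theorem compressed : ∃ (P : Program) (p : MvPolynomial (Fin 2) ℚ),
      ∀ (G : SLGrammar Bool) (L R : IndexInterval G.string.length),
        ∃ (w t : ℕ) (s : State),
          Runs w P (inputGrammar G L R) t s ∧
          Answers 3 G.string L R s ∧
          (t : ℚ) * (w : ℚ) ≤ MvPolynomial.eval
            ![(G.size : ℚ),
              max ((L.length : ℚ) / (R.length : ℚ)) ((R.length : ℚ) / (L.length : ℚ))] p := by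
  -- One factor m comes from the cost of a descent, the other from the word length m + 10, and X₁ +
  -- 1 bounds the rounded-up ratio.
  refine ⟨.seq fillTable (mainSearch gramNext),
    .C 30000000 * (.X 0) ^ 2 * (.X 1 + 1), fun G L R => ?_⟩
  have hm := G.size_pos
  have rep := represents_inputGrammar G L R
  have hn := rep.length_le (i := G.size - 1) (by omega)
  have hS := grammarString_start G
  rw [hS] at hn
  set m := G.size with hm'
  have hpow : m < 2 ^ m := Nat.lt_two_pow_self
  have hle : 2 ^ (m - 1) ≤ 2 ^ m := Nat.pow_le_pow_right (by decide) (by omega)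
  have hw : 2 ^ (m + 10) = 1024 * 2 ^ m := by rw [pow_add]; omega
  have hLl := IndexInterval.length_eq L
  have hRl := IndexInterval.length_eq R
  have l1 := L.one_le_lo
  have l2 := L.lo_le_hi
  have l3 := L.hi_le
  have l4 := R.one_le_lo
  have l5 := R.lo_le_hi
  have l6 := R.hi_le
  have hL : (0 : ℚ) < L.length := by exact_mod_cast (by omega : 0 < L.length)
  have hR : (0 : ℚ) < R.length := by exact_mod_cast (by omega : 0 < R.length)
  set r : ℚ := max ((L.length : ℚ) / (R.length : ℚ)) ((R.length : ℚ) / (L.length : ℚ)) with hr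
  have hr0 : 0 ≤ r := le_max_of_le_left (by positivity)
  -- The search needs an integral ratio, and rounding up costs at most 1.
  have q1 : R.length ≤ ⌈r⌉₊ * L.length := by
    have h : (R.length : ℚ) / L.length ≤ (⌈r⌉₊ : ℚ) := (le_max_right _ _).trans (Nat.le_ceil r)
    rw [div_le_iff₀ hL] at h
    exact_mod_cast h
  have q2 : L.length ≤ ⌈r⌉₊ * R.length := by
    have h : (L.length : ℚ) / R.length ≤ (⌈r⌉₊ : ℚ) := (le_max_left _ _).trans (Nat.le_ceil r)
    rw [div_le_iff₀ hR] at h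
    exact_mod_cast h
  have q3 : (⌈r⌉₊ : ℚ) ≤ r + 1 := (Nat.ceil_lt_add_one hr0).le
  have D := mainData L R q1 q2
  have hM := inputGrammar_mem_le G L R
  -- Words of m + 10 bits suffice: the string has length at most 2 ^ (m - 1) and m < 2 ^ m, so 64 n
  -- + 8 m + 256 < 1024 · 2 ^ m.
  have W : Wp (m + 10) (.seq fillTable (mainSearch gramNext)) (inputGrammar G L R) fun t s =>
      Answers 3 G.string L R s ∧ t ≤ 101 * m + 30 + (82 * m + 90) * (6480 * ⌈r⌉₊ + 5450) := by
    rw [wp_seq]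
    refine (wp_fillTable (w := m + 10) rep rfl hm (by omega) fun a => (hM a).trans_lt (by omega)).mono ?_
    rintro t s ⟨ht, low, T⟩
    have H := nextSpec_gramNext (w := m + 10) (n := G.string.length) rep T hm (by rw [hS]) (by omega)
    rw [hS] at H
    refine (wp_mainSearch H (Agree.refl 0 s) (low 0 (by decide)) (low 1 (by decide))
      (low 2 (by decide)) (low 3 (by decide)) D).mono ?_
    rintro t' s' ⟨ha, ht'⟩
    refine ⟨answers_of_search ha, ?_⟩
    rw [Nat.zero_mul, Nat.add_zero] at ht'
    exact Nat.add_le_add ht ht'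
  obtain ⟨t, s, he, ha, ht⟩ := W
  refine ⟨m + 10, t, s, ⟨⟨fun k => ?_, fun a => (hM a).trans_lt (by omega)⟩, he⟩, ha, ?_⟩
  · rcases k with _ | _ | _ | _ | _ | k <;> simp only [inputGrammar, inputReg] <;> omega
  · have ht' : (t : ℚ) ≤ 101 * m + 30 + (82 * m + 90) * (6480 * ⌈r⌉₊ + 5450) := by
      exact_mod_cast ht
    have m1 : (1 : ℚ) ≤ m := by exact_mod_cast hm
    -- Since m ≥ 1, all additive constants are absorbed into multiples of m; likewise r ≥ 0 absorbs
    -- the remaining ones into r + 1.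
    have s1 : (t : ℚ) ≤ m * (2100000 * (r + 1)) :=
      calc (t : ℚ) ≤ 101 * m + 30 + (82 * m + 90) * (6480 * ⌈r⌉₊ + 5450) := ht'
        _ ≤ 131 * m + (172 * m) * (6480 * (r + 1) + 5450) := by gcongr <;> linarith
        _ = m * (131 + 172 * (6480 * (r + 1) + 5450)) := by ring
        _ ≤ m * (2100000 * (r + 1)) := by gcongr; linarith
    have s2 : ((m + 10 : ℕ) : ℚ) ≤ 11 * m := by push_cast; linarith
    calc (t : ℚ) * ((m + 10 : ℕ) : ℚ) ≤ (m * (2100000 * (r + 1))) * (11 * m) := by gcongr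
      _ ≤ 30000000 * (m : ℚ) ^ 2 * (r + 1) := by
        have : 0 ≤ (m : ℚ) ^ 2 * (r + 1) := by positivity
        linarith
      _ = _ := by simp

end RAM

theorem mainTheorem7 :
    -- uncompressed strings: linear time on a machine with words of logarithmic length
    (∃ (P : RAM.Program) (C : ℕ), ∀ (S : List Bool) (L R : IndexInterval S.length),
      ∃ (t : ℕ) (s : RAM.State),
        RAM.Runs (C * (Nat.log 2 S.length + 1)) P (RAM.inputString S L R) t s ∧
        RAM.Answers 3 S L R s ∧
        t ≤ C * (L.length + R.length)) ∧
    -- compressed strings: `t` steps on `w`-bit words with `t * w` bounded by a polynomial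
    (∃ (P : RAM.Program) (p : MvPolynomial (Fin 2) ℚ),
      ∀ (G : SLGrammar Bool) (L R : IndexInterval G.string.length),
        ∃ (w t : ℕ) (s : RAM.State),
          RAM.Runs w P (RAM.inputGrammar G L R) t s ∧
          RAM.Answers 3 G.string L R s ∧
          (t : ℚ) * (w : ℚ) ≤ MvPolynomial.eval
            ![(G.size : ℚ),
              max ((L.length : ℚ) / (R.length : ℚ)) ((R.length : ℚ) / (L.length : ℚ))] p) :=
  ⟨RAM.uncompressed, RAM.compressed⟩
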